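/- Let $N\ge 2$ be an integer, let $\frac{4-N}{2}<\alpha<2$, and put $2^{**}_\alpha=\frac{2N}{N-4+2\alpha}$. Let $\mathcal D^{2,2}_\alpha(\mathbb R^N)$ be the closure of $\{\varphi\in C_c^\infty(\mathbb R^N):\int_{\mathbb R^N}|\mathrm{div}(|x|^\alpha\nabla\varphi)|^2\,dx<\infty\}$ with respect to the norm $\left(\int_{\mathbb R^N}|\mathrm{div}(|x|^\alpha\nabla \varphi)|^2\,dx\right)^{1/2}$. Its elements are regarded as functions: $u\in L^1_{loc}(\mathbb R^N)$ belongs to it if there are such $\varphi_n$ with $\varphi_n\to u$ in $L^1_{loc}(\mathbb R^N)$ and $\mathrm{div}(|x|^\alpha\nabla\varphi_n)\to w$ in $L^2(\mathbb R^N)$ for some $w$, and then $\mathrm{div}(|x|^\alpha\nabla u):=w$. Functions that agree almost everywhere are identified. A solution in $\mathcal D^{2,2}_\alpha(\mathbb R^N)$ of $$\mathrm{div}\big(|x|^\alpha\nabla(\mathrm{div}(|x|^\alpha\nabla u))\big)=|u|^{2^{**}_\alpha-2}u\quad\text{in }\mathbb R^N \tag{1}$$ is a real-valued function $u\in\mathcal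 D^{2,2}_\alpha(\mathbb R^N)$ such that $|u|^{2^{**}_\alpha-2}u\in L^1_{loc}(\mathbb R^N)$ and $$\int_{\mathbb R^N}\mathrm{div}(|x|^\alpha\nabla u)\,\mathrm{div}(|x|^\alpha\nabla\psi)\,dx=\int_{\mathbb R^N}|u|^{2^{**}_\alpha-2}u\,\psi\,dx\qquad\text{for all }\psi\in C_c^\infty(\mathbb R^N).$$ Theorem 1.1. Equation (1) has a nontrivial radial solution in $\mathcal D^{2,2}_\alpha(\mathbb R^N)$, and it is unique up to scaling and change of sign: if $u$ and $v$ are two nontrivial radial solutions, then there is $\lambda>0$ such that $v(x)=\pm\lambda^{\frac{N-4+2\alpha}{2}}u(\lambda x)$, with one fixed sign. More precisely, a function $u$ is a nontrivial radial solution of (1) in $\mathcal D^{2,2}_\alpha(\mathbb R^N)$ if and only if $u=U_{\lambda,\alpha}$ or $u=-U_{\lambda,\alpha}$ for some $\lambda>0$, where $$U_{\lambda,\alpha}(x)=\frac{C_{N,\alpha}\,\lambda^{\frac{N-4+2\alpha}{2}}}{\left(1+\lambda^{2-\alpha}|x|^{2-\alpha}\right)^{\frac{N-4+2\alpha}{2-\alpha}}},\qquad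 C_{N,\alpha}=\big[(N-4+2\alpha)(N-2+\alpha)N(N+2-\alpha)\big]^{\frac{N-4+2\alpha}{8-4\alpha}}.$$ -/

import Mathlib

open MeasureTheory Filter Topology
open scoped ContDiff

/-- The classical divergence of a vector field on `ℝ^N`. -/
noncomputable def euclDiv {N : ℕ}
    (F : EuclideanSpace ℝ (Fin N) → EuclideanSpace ℝ (Fin N))
    (x : EuclideanSpace ℝ (Fin N)) : ℝ :=
  ∑ i : Fin N, (fderiv ℝ F x (EuclideanSpace.single i 1)) i

/-- The classical expression `div(|x|^α ∇ φ)`. For smooth `φ` it is the genuine expression at every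
`x ≠ 0`; the value at the single point `0` plays no role, since only integrals of it are used. -/
noncomputable def weightedLap {N : ℕ} (α : ℝ) (φ : EuclideanSpace ℝ (Fin N) → ℝ) :
    EuclideanSpace ℝ (Fin N) → ℝ :=
  euclDiv (fun y => ‖y‖ ^ α • gradient φ y)

/-- `φ ∈ C_c^∞(ℝ^N)`. -/
def IsTestFun {N : ℕ} (φ : EuclideanSpace ℝ (Fin N) → ℝ) : Prop :=
  ContDiff ℝ ∞ φ ∧ HasCompactSupport φ

/-- `u` is the element of the space `D^{2,2}_α(ℝ^N)` whose (extended) `div(|x|^α ∇ u)` is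
`w ∈ L²(ℝ^N)`.

The space is the closure of `{φ ∈ C_c^∞(ℝ^N) : ∫ |div(|x|^α ∇ φ)|² < ∞}` in the norm
`(∫ |div(|x|^α ∇ φ)|²)^{1/2}`. An element is represented by a sequence `φ n` that is Cauchy in this
norm, that is, for which `div(|x|^α ∇ φ n)` converges in `L²` to some `w`; as a function, the
element is the limit `u` of `φ n` in `L¹_loc(ℝ^N)`. -/
def IsEnergyLimit {N : ℕ} (α : ℝ) (u w : EuclideanSpace ℝ (Fin N) → ℝ) : Prop :=
  LocallyIntegrable u volume ∧ MemLp w 2 volume ∧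
    ∃ φ : ℕ → EuclideanSpace ℝ (Fin N) → ℝ,
      (∀ n, IsTestFun (φ n) ∧ MemLp (weightedLap α (φ n)) 2 volume) ∧
      Tendsto (fun n => eLpNorm (weightedLap α (φ n) - w) 2 volume) atTop (𝓝 0) ∧
      ∀ K : Set (EuclideanSpace ℝ (Fin N)), IsCompact K →
        Tendsto (fun n => eLpNorm (φ n - u) 1 (volume.restrict K)) atTop (𝓝 0)

/-- `u ∈ D^{2,2}_α(ℝ^N)`. -/
def MemEnergySpace {N : ℕ} (α : ℝ) (u : EuclideanSpace ℝ (Fin N) → ℝ) : Prop :=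
  ∃ w, IsEnergyLimit α u w

/-- The critical exponent `2N / (N - 4 + 2α)`. -/
noncomputable def critExp (N : ℕ) (α : ℝ) : ℝ := 2 * N / (N - 4 + 2 * α)

/-- The nonlinearity `|u|^{p-2} u` with `p` the critical exponent. -/
noncomputable def critPower {N : ℕ} (α : ℝ) (u : EuclideanSpace ℝ (Fin N) → ℝ)
    (x : EuclideanSpace ℝ (Fin N)) : ℝ :=
  |u x| ^ (critExp N α - 2) * u x

/-- `u ∈ D^{2,2}_α(ℝ^N)` is a (weak) solution of
`div(|x|^α ∇(div(|x|^α ∇ u))) = |u|^{p-2} u` in `ℝ^N`: the right-hand side is locally integrable,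
and `∫ div(|x|^α ∇ u) div(|x|^α ∇ ψ) = ∫ |u|^{p-2} u ψ` for all `ψ ∈ C_c^∞(ℝ^N)`. -/
def IsEnergySolution {N : ℕ} (α : ℝ) (u : EuclideanSpace ℝ (Fin N) → ℝ) : Prop :=
  LocallyIntegrable (critPower α u) volume ∧
    ∃ w, IsEnergyLimit α u w ∧
      ∀ ψ : EuclideanSpace ℝ (Fin N) → ℝ, IsTestFun ψ →
        ∫ x, w x * weightedLap α ψ x = ∫ x, critPower α u x * ψ x

/-- `u(x) = g(|x|)` almost everywhere. -/
def IsRadial {N : ℕ} (u : EuclideanSpace ℝ (Fin N) → ℝ) : Prop :=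
  ∃ g : ℝ → ℝ, Measurable g ∧ u =ᵐ[volume] fun x => g ‖x‖

/-- `u` is a nontrivial radial solution in `D^{2,2}_α(ℝ^N)`. -/
def IsNontrivialRadialSolution {N : ℕ} (α : ℝ) (u : EuclideanSpace ℝ (Fin N) → ℝ) : Prop :=
  MemEnergySpace α u ∧ IsEnergySolution α u ∧ IsRadial u ∧ ¬ u =ᵐ[volume] 0

/-- The scaling `u ↦ t^{(N-4+2α)/2} u(t ·)`. -/
noncomputable def energyScale {N : ℕ} (α t : ℝ) (u : EuclideanSpace ℝ (Fin N) → ℝ)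
    (x : EuclideanSpace ℝ (Fin N)) : ℝ :=
  t ^ (((N : ℝ) - 4 + 2 * α) / 2) * u (t • x)

/-- `C_{N,α} = [(N-4+2α)(N-2+α)N(N+2-α)]^{(N-4+2α)/(8-4α)}`. -/
noncomputable def bubbleConst (N : ℕ) (α : ℝ) : ℝ :=
  (((N : ℝ) - 4 + 2 * α) * (N - 2 + α) * N * (N + 2 - α)) ^
    (((N : ℝ) - 4 + 2 * α) / (8 - 4 * α))

/-- `U_{t,α}(x) = C_{N,α} t^{(N-4+2α)/2} / (1 + t^{2-α}|x|^{2-α})^{(N-4+2α)/(2-α)}`. -/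
noncomputable def bubble (N : ℕ) (α t : ℝ) (x : EuclideanSpace ℝ (Fin N)) : ℝ :=
  bubbleConst N α * t ^ (((N : ℝ) - 4 + 2 * α) / 2) /
    (1 + t ^ (2 - α) * ‖x‖ ^ (2 - α)) ^ (((N : ℝ) - 4 + 2 * α) / (2 - α))

/-! Write β = N - 2 + α, σ = 2 - α = N - β and γ = β - N/2 = (N - 4 + 2α)/2. The two bounds on α say
that β < N < 2β. On radial functions, -div(|x|^α ∇ ·) is inverted by the operator S with kernel
proportional to max(r, |y|)^{-β} (`greenOp`). The fourth order equation thus becomes the integral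
system g = S v, v = S(|g|^{p-2} g) for radial profiles, where p is the critical exponent.

From weak solution to system. If u is a radial element of the energy space and w its weighted
Laplacian, duality with radial test functions supported off the origin gives u = -S w
(`energyLimit_eq_greenOp`). Since w is in L², Cauchy-Schwarz yields u = O(r^{-γ}) everywhere and u =
o(r^{-γ}) at the origin. The first bound controls the nonlinearity well enough to test the weak
equation with double potentials, so u = S S(|u|^{p-2} u) (`solution_eq_greenOp`).

Regularity at the origin. Criticality means (p - 2)γ = 2σ, so |u|^{p-2} is o(r^{-2σ}), a potential
of exactly the homogeneity that S S gains, with an arbitrarily small constant. Iterating the system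
near the origin halves the r^{-γ} part of the bound each time, leaving r^{-θ} with any small θ > 0
(`exists_improved_bound`). The profiles g and v are then continuous up to r = 0
(`isRegularProfile_of_isLittleO`).

Uniqueness. Let (g, v) and (G, V) be regular profiles with g(0) = G(0). If v(0) < V(0), monotonicity
of the nonlinearity and of S keeps v - V below the negative number v(0) - V(0) for all r,
contradicting the decay of v and V (`not_lt_right_zero`). Hence v(0) = V(0), and a Gronwall argument
gives g = G (`eq_of_eq_zero`). So g is determined by g(0), and g(0) = 0 only for the zero solution.

Bubbles. The functions (1 + q r^σ)^{-c} have weighted Laplacians in their own span, and a direct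
computation shows that `bubble` solves the equation (`isNontrivialRadialSolution_bubble`). As t
varies its value at the origin takes every positive value, so up to sign every nontrivial radial
solution is a bubble.

A technical device serves throughout: a radial function is approximated by cutting off its
derivative in logarithmic scale and integrating back. The result is constant near the origin,
vanishes near infinity, and has an error of size 1/(n + 1) in its weighted Laplacian. -/

/-- The Euclidean space `ℝ^N`. -/
abbrev Euc (N : ℕ) := EuclideanSpace ℝ (Fin N)

/-! ### The divergence theorem and symmetry of the weighted Laplacian away from the origin. -/

section Divergence

variable {N : ℕ}

lemma euclDiv_congr {F G : Euc N → Euc N} {x : Euc N} (h : F =ᶠ[𝓝 x] G) :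
    euclDiv F x = euclDiv G x := by
  simp only [euclDiv, h.fderiv_eq]

lemma euclDiv_smul {m : Euc N → ℝ} {F : Euc N → Euc N} {x : Euc N}
    (hm : DifferentiableAt ℝ m x) (hF : DifferentiableAt ℝ F x) :
    euclDiv (fun y => m y • F y) x = m x * euclDiv F x + fderiv ℝ m x (F x) := by
  have h1 : F x = ∑ i, F x i • EuclideanSpace.single i (1 : ℝ) := by
    simpa using ((EuclideanSpace.basisFun (Fin N) ℝ).sum_repr (F x)).symm
  unfold euclDiv
  rw [fderiv_fun_smul hm hF]
  conv_rhs => rw [h1]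
  simp only [map_sum, map_smul, Finset.mul_sum, ← Finset.sum_add_distrib]
  refine Finset.sum_congr rfl fun i _ => ?_
  simp [mul_comm]

lemma continuous_euclDiv {F : Euc N → Euc N} (hF : ContDiff ℝ 1 F) : Continuous (euclDiv F) := by
  have h := hF.continuous_fderiv one_ne_zero
  unfold euclDiv
  fun_prop

lemma HasCompactSupport.euclDiv {F : Euc N → Euc N} (hc : HasCompactSupport F) :
    HasCompactSupport (euclDiv F) := by
  refine (hc.fderiv ℝ).mono fun x hx h0 => hx ?_
  unfold _root_.euclDiv
  simp [h0]

lemma integral_euclDiv_eq_zero {F : Euc N → Euc N} (hF : ContDiff ℝ 1 F)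
    (hc : HasCompactSupport F) : ∫ x, euclDiv F x = 0 := by
  have hcoord : ∀ i x v, (fderiv ℝ F x v) i = fderiv ℝ (fun y => F y i) x v := by
    intro i x v
    have h1 := ((EuclideanSpace.proj (𝕜 := ℝ) i).hasFDerivAt (x := F x)).comp x
      ((hF.differentiable one_ne_zero x).hasFDerivAt)
    rw [show (fun y => F y i) = (EuclideanSpace.proj (𝕜 := ℝ) i) ∘ F from rfl, h1.fderiv]
    rfl
  have hFi : ∀ i, ContDiff ℝ 1 (fun y => F y i) := fun i => by fun_prop
  have hci : ∀ i, HasCompactSupport (fun y => F y i) := fun i =>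
    hc.mono fun x hx h0 => hx (by simp [h0])
  have hint : ∀ i, Integrable (fun x => fderiv ℝ (fun y => F y i) x (EuclideanSpace.single i 1)) := by
    intro i
    refine Continuous.integrable_of_hasCompactSupport ?_ ?_
    · have := (hFi i).continuous_fderiv one_ne_zero
      fun_prop
    · exact ((hci i).fderiv ℝ).mono fun x hx h0 => hx (by simp [h0])
  unfold euclDiv
  simp only [hcoord]
  rw [integral_finsetSum _ fun i _ => hint i]
  refine Finset.sum_eq_zero fun i _ => ?_
  -- Integration by parts in direction i against the constant function 1.
  have := integral_mul_fderiv_eq_neg_fderiv_mul_of_integrable (μ := (volume : Measure (Euc N)))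
    (f := fun _ => (1 : ℝ)) (g := fun y => F y i) (v := EuclideanSpace.single i 1)
    (by simp) (by simpa using hint i)
    (by simpa using (hFi i).continuous.integrable_of_hasCompactSupport (hci i))
    (by simp) (fun x _ => (hFi i).differentiable one_ne_zero x)
  simpa using this

lemma contDiff_gradient {φ : Euc N → ℝ} (h : ContDiff ℝ ∞ φ) : ContDiff ℝ ∞ (gradient φ) := by
  unfold gradient
  exact (InnerProductSpace.toDual ℝ (Euc N)).symm.contDiff.comp (h.fderiv_right (by simp))

lemma fderiv_eq_inner_gradient (φ : Euc N → ℝ) (x v : Euc N) :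
    fderiv ℝ φ x v = inner ℝ (gradient φ x) v := by
  simp [gradient]

lemma contDiffAt_norm_rpow {x : Euc N} (hx : x ≠ 0) (s : ℝ) :
    ContDiffAt ℝ ∞ (fun y : Euc N => ‖y‖ ^ s) x :=
  (contDiffAt_norm ℝ hx).rpow_const_of_ne (norm_ne_zero_iff.2 hx)

lemma ae_ne_zero [NeZero N] : ∀ᵐ x : Euc N, x ≠ 0 := by
  have : Nonempty (Fin N) := ⟨0⟩
  exact Measure.ae_ne volume 0

lemma contDiff_of_eventuallyEq_zero {F : Type*} [NormedAddCommGroup F] [NormedSpace ℝ F]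
    {f : Euc N → F} {n : WithTop ℕ∞} {c : F}
    (h0 : ∀ᶠ x in 𝓝 0, f x = c) (h : ∀ x ≠ 0, ContDiffAt ℝ n f x) : ContDiff ℝ n f := by
  rw [contDiff_iff_contDiffAt]
  intro x
  by_cases hx : x = 0
  · subst hx
    exact contDiffAt_const.congr_of_eventuallyEq h0
  · exact h x hx

lemma gradient_eventually_zero {η : Euc N → ℝ} {c : ℝ} (h0 : ∀ᶠ x in 𝓝 0, η x = c) :
    ∀ᶠ x in 𝓝 0, gradient η x = 0 := by
  filter_upwards [h0.eventually_nhds] with x hx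
  have : η =ᶠ[𝓝 x] fun _ => c := hx
  simp [gradient, this.fderiv_eq]

lemma HasCompactSupport.gradient {φ : Euc N → ℝ} (h : HasCompactSupport φ) :
    HasCompactSupport (gradient φ) :=
  (h.fderiv ℝ).mono fun x hx h0 => hx (by simp [_root_.gradient, h0])

lemma euclDiv_smul_weighted (α : ℝ) {φ η : Euc N → ℝ} {x : Euc N} (hη : DifferentiableAt ℝ η x)
    (hφ : DifferentiableAt ℝ (fun y => ‖y‖ ^ α • gradient φ y) x) :
    euclDiv (fun y => η y • (‖y‖ ^ α • gradient φ y)) x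
      = η x * weightedLap α φ x + ‖x‖ ^ α * inner ℝ (gradient η x) (gradient φ x) := by
  rw [euclDiv_smul hη hφ, fderiv_eq_inner_gradient, inner_smul_right, weightedLap]

lemma integrable_euclDiv {F : Euc N → Euc N} (hF : ContDiff ℝ ∞ F) (hc : HasCompactSupport F) :
    Integrable (euclDiv F) :=
  (continuous_euclDiv (hF.of_le (by exact_mod_cast le_top))).integrable_of_hasCompactSupport
    hc.euclDiv

/-- Symmetry of the weighted Laplacian, with one of the functions vanishing near the origin. -/
lemma weightedLap_symm [NeZero N] (α : ℝ) {φ η : Euc N → ℝ} (hφ : IsTestFun φ)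
    (hη : ContDiff ℝ ∞ η) (h0 : ∀ᶠ x in 𝓝 0, η x = 0) :
    ∫ x, φ x * weightedLap α η x = ∫ x, η x * weightedLap α φ x := by
  obtain ⟨hφs, hφc⟩ := hφ
  have gφ := contDiff_gradient hφs
  have gη := contDiff_gradient hη
  have hH : ContDiff ℝ ∞ (fun y => ‖y‖ ^ α • gradient η y) := by
    refine contDiff_of_eventuallyEq_zero (c := 0) ?_ fun x hx =>
      (contDiffAt_norm_rpow hx α).smul gη.contDiffAt
    filter_upwards [gradient_eventually_zero h0] with x hx
    rw [hx, smul_zero]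
  have hG1s : ContDiff ℝ ∞ (fun y => η y • (‖y‖ ^ α • gradient φ y)) := by
    refine contDiff_of_eventuallyEq_zero (c := 0) ?_ fun x hx =>
      hη.contDiffAt.smul ((contDiffAt_norm_rpow hx α).smul gφ.contDiffAt)
    filter_upwards [h0] with x hx
    rw [hx, zero_smul]
  have hG2s : ContDiff ℝ ∞ (fun y => φ y • (‖y‖ ^ α • gradient η y)) := hφs.smul hH
  have hG1c : HasCompactSupport (fun y => η y • (‖y‖ ^ α • gradient φ y)) :=
    HasCompactSupport.smul_left (f := η) (hφc.gradient.smul_left (f := fun y : Euc N => ‖y‖ ^ α))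
  have hG2c : HasCompactSupport (fun y => φ y • (‖y‖ ^ α • gradient η y)) :=
    hφc.smul_right (f' := fun y => ‖y‖ ^ α • gradient η y)
  have e1 : ∀ x ≠ 0, euclDiv (fun y => η y • (‖y‖ ^ α • gradient φ y)) x
      = η x * weightedLap α φ x + ‖x‖ ^ α * inner ℝ (gradient η x) (gradient φ x) := fun x hx =>
    euclDiv_smul_weighted α (hη.differentiable (by simp) x)
      (((contDiffAt_norm_rpow hx α).smul gφ.contDiffAt).differentiableAt (by simp))
  have e2 : ∀ x, euclDiv (fun y => φ y • (‖y‖ ^ α • gradient η y)) x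
      = φ x * weightedLap α η x + ‖x‖ ^ α * inner ℝ (gradient η x) (gradient φ x) := fun x => by
    rw [euclDiv_smul_weighted α (hφs.differentiable (by simp) x)
      (hH.differentiable (by simp) x), real_inner_comm]
  have i1 := integrable_euclDiv hG1s hG1c
  have i2 := integrable_euclDiv hG2s hG2c
  have z1 := integral_euclDiv_eq_zero (hG1s.of_le (by exact_mod_cast le_top)) hG1c
  have z2 := integral_euclDiv_eq_zero (hG2s.of_le (by exact_mod_cast le_top)) hG2c
  have ic : Integrable (fun x => φ x * weightedLap α η x) := by
    refine Continuous.integrable_of_hasCompactSupport ?_ hφc.mul_right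
    exact hφs.continuous.mul (continuous_euclDiv (hH.of_le (by exact_mod_cast le_top)))
  -- The integrability of this product is read off from the two divergences and from `ic`, since the
  -- gradient terms agree.
  have id : Integrable (fun x => η x * weightedLap α φ x) := by
    refine ((i1.sub i2).add ic).congr ?_
    filter_upwards [ae_ne_zero] with x hx
    simp only [Pi.add_apply, Pi.sub_apply, e1 x hx, e2 x]
    ring
  rw [← sub_eq_zero, ← integral_sub ic id]
  calc _ = ∫ x, (euclDiv (fun y => φ y • (‖y‖ ^ α • gradient η y)) x
            - euclDiv (fun y => η y • (‖y‖ ^ α • gradient φ y)) x) := by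
        refine integral_congr_ae ?_
        filter_upwards [ae_ne_zero] with x hx
        rw [e1 x hx, e2 x]
        ring
    _ = 0 := by rw [integral_sub i2 i1, z1, z2, sub_zero]

end Divergence

/-! ### Integrability of powers of the norm near the origin and near infinity. -/

section PowerIntegrals

variable {N : ℕ}

lemma integrableOn_norm_rpow_ball [NeZero N] {s : ℝ} (hs : -(N : ℝ) < s) (R : ℝ) :
    IntegrableOn (fun x : Euc N => ‖x‖ ^ s) (Metric.ball 0 R) := by
  have : Nonempty (Fin N) := ⟨0⟩
  rw [integrableOn_fun_norm_addHaar volume (f := fun r : ℝ => r ^ s)]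
  rcases le_or_gt R 0 with hR | hR
  · simp [Set.Ioo_eq_empty (not_lt.2 hR)]
  have h1 : IntervalIntegrable (fun y : ℝ => y ^ ((N : ℝ) - 1 + s)) volume 0 R :=
    intervalIntegral.intervalIntegrable_rpow' (by linarith)
  rw [intervalIntegrable_iff_integrableOn_Ioo_of_le hR.le] at h1
  refine h1.congr_fun (fun y hy => ?_) measurableSet_Ioo
  have hN : 1 ≤ N := NeZero.one_le
  simp only [finrank_euclideanSpace, Fintype.card_fin, smul_eq_mul]
  rw [Real.rpow_add hy.1, ← Real.rpow_natCast, Nat.cast_sub hN, Nat.cast_one]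

lemma integrableOn_norm_rpow_compl_ball {s : ℝ} (hs : s < -(N : ℝ)) {R : ℝ} (hR : 0 < R) :
    IntegrableOn (fun x : Euc N => ‖x‖ ^ s) (Metric.ball 0 R)ᶜ := by
  have h1 : Integrable (fun x : Euc N => (1 / R + 1) ^ (-s) * (1 + ‖x‖) ^ (-(-s))) :=
    (integrable_one_add_norm (by simp; linarith)).const_mul _
  refine Integrable.mono' h1.integrableOn (Measurable.aestronglyMeasurable (by fun_prop)) ?_
  refine (ae_restrict_iff' (by measurability)).2 (.of_forall fun x hx => ?_)
  have hx : R ≤ ‖x‖ := by simpa using hx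
  have hx0 : 0 < ‖x‖ := hR.trans_le hx
  have hs0 : s ≤ 0 := by linarith [(Nat.cast_nonneg N : (0 : ℝ) ≤ N)]
  have h2 : 1 + ‖x‖ ≤ (1 / R + 1) * ‖x‖ := by
    have : 1 ≤ 1 / R * ‖x‖ := by rw [one_div, inv_mul_eq_div, one_le_div hR]; exact hx
    linarith
  rw [Real.norm_of_nonneg (by positivity), neg_neg]
  calc ‖x‖ ^ s = (1 / R + 1) ^ (-s) * ((1 / R + 1) * ‖x‖) ^ s := by
        rw [Real.mul_rpow (by positivity) (by positivity), ← mul_assoc, ← Real.rpow_add (by positivity)]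
        simp
    _ ≤ _ := by
        gcongr ?_ * ?_
        exact Real.rpow_le_rpow_of_nonpos (by positivity) h2 hs0

end PowerIntegrals

/-! ### Gradient and weighted Laplacian of radial functions. -/

section Radial

variable {N : ℕ}

lemma hasFDerivAt_norm_of_ne {x : Euc N} (hx : x ≠ 0) :
    HasFDerivAt (fun y : Euc N => ‖y‖) (‖x‖⁻¹ • innerSL ℝ x) x := by
  have h1 : HasFDerivAt (fun y : Euc N => ‖y‖ ^ 2) (2 • innerSL ℝ x) x :=
    (hasStrictFDerivAt_norm_sq x).hasFDerivAt
  have h2 := h1.sqrt (by simpa using hx)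
  have e : (fun y : Euc N => √(‖y‖ ^ 2)) = fun y => ‖y‖ := by
    ext y; simp
  rw [e] at h2
  refine h2.congr_fderiv ?_
  rw [Real.sqrt_sq (norm_nonneg x), ← Nat.cast_smul_eq_nsmul ℝ, smul_smul]
  congr 1
  have := norm_ne_zero_iff.2 hx
  push_cast
  field_simp

lemma gradient_comp_norm {h : ℝ → ℝ} {h' : ℝ} {x : Euc N} (hx : x ≠ 0)
    (hh : HasDerivAt h h' ‖x‖) : gradient (fun y : Euc N => h ‖y‖) x = (h' * ‖x‖⁻¹) • x := by
  have h1 := hh.hasFDerivAt.comp x (hasFDerivAt_norm_of_ne hx)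
  refine HasGradientAt.gradient ?_
  rw [hasGradientAt_iff_hasFDerivAt]
  refine h1.congr_fderiv ?_
  ext v
  simp
  ring

lemma euclDiv_id (x : Euc N) : euclDiv (fun y : Euc N => y) x = N := by
  simp [euclDiv]

/-- Factoring h' as r^(1-α) Q turns the field |x|^α ∇h(|x|) into the multiple Q(|x|) x of the
position field, whose divergence needs only one derivative of Q. All radial computations use this
normal form. -/
lemma weightedLap_comp_norm {α : ℝ} {h Q : ℝ → ℝ} {Q' : ℝ} {x : Euc N} (hx : x ≠ 0)
    (hh : ∀ r > 0, HasDerivAt h (r ^ (1 - α) * Q r) r) (hQ : HasDerivAt Q Q' ‖x‖) :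
    weightedLap α (fun y => h ‖y‖) x = N * Q ‖x‖ + ‖x‖ * Q' := by
  have h1 : (fun y : Euc N => ‖y‖ ^ α • gradient (fun y => h ‖y‖) y) =ᶠ[𝓝 x]
      fun y => Q ‖y‖ • y := by
    filter_upwards [isOpen_ne.mem_nhds hx] with y hy
    have hy0 : 0 < ‖y‖ := norm_pos_iff.2 hy
    rw [gradient_comp_norm hy (hh _ hy0), smul_smul]
    congr 1
    have : ‖y‖ ^ α * ‖y‖ ^ (1 - α) = ‖y‖ := by
      rw [← Real.rpow_add hy0]; simp
    calc _ = (‖y‖ ^ α * ‖y‖ ^ (1 - α)) * ‖y‖⁻¹ * Q ‖y‖ := by ring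
      _ = _ := by rw [this, mul_inv_cancel₀ hy0.ne', one_mul]
  have h2 : HasFDerivAt (fun y : Euc N => Q ‖y‖)
      ((ContinuousLinearMap.toSpanSingleton ℝ Q').comp (‖x‖⁻¹ • innerSL ℝ x)) x :=
    hQ.hasFDerivAt.comp x (hasFDerivAt_norm_of_ne hx)
  rw [weightedLap, euclDiv_congr h1, euclDiv_smul (F := fun y => y) h2.differentiableAt differentiableAt_fun_id,
    euclDiv_id, h2.fderiv]
  have := norm_ne_zero_iff.2 hx
  simp
  field_simp

end Radial

/-! ### The weighted Laplacian of a test function lies in L¹ and L². -/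

section TestFunctions

variable {N : ℕ}

lemma measurable_weightedLap (α : ℝ) (φ : Euc N → ℝ) : Measurable (weightedLap α φ) := by
  unfold weightedLap euclDiv
  refine Finset.measurable_sum _ fun i _ => ?_
  have := measurable_fderiv_apply_const ℝ (fun y => ‖y‖ ^ α • gradient φ y) (EuclideanSpace.single i 1)
  fun_prop

lemma weightedLap_eq {α : ℝ} {φ : Euc N → ℝ} (hφ : ContDiff ℝ ∞ φ) {x : Euc N} (hx : x ≠ 0) :
    weightedLap α φ x = ‖x‖ ^ α * euclDiv (gradient φ) x
      + α * ‖x‖ ^ (α - 2) * inner ℝ x (gradient φ x) := by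
  have hx' := norm_ne_zero_iff.2 hx
  have h1 : HasFDerivAt (fun y : Euc N => ‖y‖ ^ α) ((α * ‖x‖ ^ (α - 1)) • (‖x‖⁻¹ • innerSL ℝ x)) x := by
    have := (Real.hasDerivAt_rpow_const (p := α) (Or.inl hx')).hasFDerivAt.comp x (hasFDerivAt_norm_of_ne hx)
    refine this.congr_fderiv ?_
    ext v
    simp
    ring
  rw [weightedLap, euclDiv_smul h1.differentiableAt
    ((contDiff_gradient hφ).differentiable (by simp) x), h1.fderiv]
  have h2 : ‖x‖ ^ (α - 2) = ‖x‖ ^ (α - 1) * ‖x‖⁻¹ := by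
    rw [← Real.rpow_neg_one, ← Real.rpow_add (norm_pos_iff.2 hx)]
    congr 1; ring
  rw [h2]
  simp
  ring

/-- The term in which the derivative falls on |x|^α is the most singular one; as the gradient of φ
is bounded, it is of order |x|^(α-1). This controls all integrability questions at the origin. -/
lemma exists_norm_weightedLap_le (α : ℝ) {φ : Euc N → ℝ} (hφ : IsTestFun φ) :
    ∃ C R, 0 ≤ C ∧ ∀ x ≠ 0, |weightedLap α φ x| ≤
      (Metric.ball 0 R).indicator (fun x => C * ‖x‖ ^ (α - 1)) x := by
  obtain ⟨hs, hc⟩ := hφ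
  have gs := contDiff_gradient hs
  obtain ⟨R, hR⟩ := hc.isCompact.isBounded.subset_ball 0
  have c1 : Continuous (euclDiv (gradient φ)) :=
    continuous_euclDiv (gs.of_le (by exact_mod_cast le_top))
  obtain ⟨C1, hC1⟩ := hc.gradient.euclDiv.exists_bound_of_continuous c1
  obtain ⟨C2, hC2⟩ := hc.gradient.exists_bound_of_continuous gs.continuous
  have p1 : 0 ≤ C1 := (norm_nonneg _).trans (hC1 0)
  have p2 : 0 ≤ C2 := (norm_nonneg _).trans (hC2 0)
  refine ⟨max R 0 * C1 + |α| * C2, R, by positivity, fun x hx => ?_⟩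
  by_cases hxR : x ∈ Metric.ball 0 R
  · rw [Set.indicator_of_mem hxR, weightedLap_eq hs hx]
    have hx0 : 0 < ‖x‖ := norm_pos_iff.2 hx
    have e1 : ‖x‖ ^ α = ‖x‖ * ‖x‖ ^ (α - 1) := by
      rw [Real.rpow_sub_one hx0.ne']; field_simp
    have e2 : ‖x‖ ^ (α - 2) * ‖x‖ = ‖x‖ ^ (α - 1) := by
      rw [show α - 2 = α - 1 - 1 by ring, Real.rpow_sub_one hx0.ne' (α - 1)]; field_simp
    have hxR' : ‖x‖ ≤ max R 0 := by
      have : ‖x‖ < R := by simpa using hxR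
      exact this.le.trans (le_max_left _ _)
    have b1 : |‖x‖ ^ α * euclDiv (gradient φ) x| ≤ max R 0 * C1 * ‖x‖ ^ (α - 1) := by
      rw [abs_mul, abs_of_nonneg (by positivity), e1]
      calc _ ≤ max R 0 * ‖x‖ ^ (α - 1) * C1 := by gcongr; exact hC1 x
        _ = _ := by ring
    have b2 : |α * ‖x‖ ^ (α - 2) * inner ℝ x (gradient φ x)| ≤ |α| * C2 * ‖x‖ ^ (α - 1) := by
      rw [abs_mul, abs_mul, abs_of_nonneg (by positivity : 0 ≤ ‖x‖ ^ (α - 2)), ← e2]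
      calc _ ≤ |α| * ‖x‖ ^ (α - 2) * (‖x‖ * C2) := by
            gcongr
            exact (abs_real_inner_le_norm _ _).trans (by gcongr; exact hC2 x)
        _ = _ := by ring
    refine (abs_add_le _ _).trans ((add_le_add b1 b2).trans_eq ?_)
    ring
  · rw [Set.indicator_of_notMem hxR]
    have : x ∉ tsupport φ := fun h => hxR (hR h)
    have h0 : φ =ᶠ[𝓝 x] 0 := notMem_tsupport_iff_eventuallyEq.1 this
    have : (fun y => ‖y‖ ^ α • gradient φ y) =ᶠ[𝓝 x] fun _ => 0 := by
      filter_upwards [h0.eventually_nhds] with y hy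
      have : φ =ᶠ[𝓝 y] 0 := hy
      simp [gradient, this.fderiv_eq]
    rw [weightedLap, euclDiv_congr this]
    simp [euclDiv]

lemma integrable_weightedLap [NeZero N] {α : ℝ} (hα : 2 - (N : ℝ) < α) {φ : Euc N → ℝ}
    (hφ : IsTestFun φ) : Integrable (weightedLap α φ) := by
  obtain ⟨C, R, hC, h⟩ := exists_norm_weightedLap_le α hφ
  have h1 := IntegrableOn.integrable_indicator
    ((integrableOn_norm_rpow_ball (N := N) (s := α - 1) (by linarith) R).const_mul C)
    measurableSet_ball
  refine h1.mono' (measurable_weightedLap α φ).aestronglyMeasurable ?_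
  filter_upwards [ae_ne_zero] with x hx using h x hx

lemma memLp_two_weightedLap [NeZero N] {α : ℝ} (hα : (4 - (N : ℝ)) / 2 < α) {φ : Euc N → ℝ}
    (hφ : IsTestFun φ) : MemLp (weightedLap α φ) 2 := by
  obtain ⟨C, R, hC, h⟩ := exists_norm_weightedLap_le α hφ
  have m := (measurable_weightedLap α φ).aestronglyMeasurable (μ := volume)
  rw [memLp_two_iff_integrable_sq m]
  have h1 := IntegrableOn.integrable_indicator
    ((integrableOn_norm_rpow_ball (N := N) (s := 2 * α - 2) (by linarith) R).const_mul (C ^ 2))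
    measurableSet_ball
  refine h1.mono' (m.pow 2) ?_
  filter_upwards [ae_ne_zero] with x hx
  have hx0 : 0 < ‖x‖ := norm_pos_iff.2 hx
  have := h x hx
  rw [Real.norm_of_nonneg (sq_nonneg _), ← sq_abs]
  by_cases hR : x ∈ Metric.ball 0 R
  · rw [Set.indicator_of_mem hR] at this ⊢
    calc _ ≤ (C * ‖x‖ ^ (α - 1)) ^ 2 := by gcongr
      _ = _ := by
        rw [mul_pow, ← Real.rpow_mul_natCast hx0.le]; congr 2; push_cast; ring
  · rw [Set.indicator_of_notMem hR] at this ⊢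
    rw [le_antisymm this (abs_nonneg _)]; simp

end TestFunctions

/-! ### Cutoffs in logarithmic scale. -/

section Cutoff

/-- A smooth bump function on the line, equal to `1` on `[-1, 1]` and vanishing off `(-2, 2)`. -/
noncomputable def lineBump : ContDiffBump (0 : ℝ) := ⟨1, 2, one_pos, one_lt_two⟩

/-- A smooth cutoff in logarithmic scale, exhausting `(0, ∞)`. -/
noncomputable def logCutoff (n : ℕ) (r : ℝ) : ℝ :=
  if 0 < r then lineBump (Real.log r / (n + 1)) else 0

lemma logCutoff_of_pos (n : ℕ) {r : ℝ} (hr : 0 < r) :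
    logCutoff n r = lineBump (Real.log r / (n + 1)) := if_pos hr

lemma logCutoff_of_nonpos (n : ℕ) {r : ℝ} (hr : r ≤ 0) : logCutoff n r = 0 := if_neg hr.not_gt

lemma logCutoff_nonneg (n : ℕ) (r : ℝ) : 0 ≤ logCutoff n r := by
  unfold logCutoff
  split_ifs
  exacts [lineBump.nonneg, le_rfl]

lemma logCutoff_le_one (n : ℕ) (r : ℝ) : logCutoff n r ≤ 1 := by
  unfold logCutoff
  split_ifs
  exacts [lineBump.le_one, zero_le_one]

lemma eventually_logCutoff_eq_one {r : ℝ} (hr : 0 < r) : ∀ᶠ n in atTop, logCutoff n r = 1 := by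
  obtain ⟨m, hm⟩ := exists_nat_ge |Real.log r|
  filter_upwards [eventually_ge_atTop m] with n hn
  rw [logCutoff_of_pos n hr]
  refine lineBump.one_of_mem_closedBall ?_
  have : (0 : ℝ) < n + 1 := by positivity
  have hmn : (m : ℝ) ≤ n := by exact_mod_cast hn
  rw [mem_closedBall_zero_iff, Real.norm_eq_abs, abs_div, abs_of_pos this, div_le_iff₀ this]
  simp only [lineBump]
  linarith

lemma logCutoff_eq_zero {n : ℕ} {r : ℝ} (h : 2 * ((n : ℝ) + 1) ≤ |Real.log r|) :
    logCutoff n r = 0 := by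
  rcases le_or_gt r 0 with hr | hr
  · exact logCutoff_of_nonpos n hr
  rw [logCutoff_of_pos n hr]
  refine lineBump.zero_of_le_dist ?_
  have : (0 : ℝ) < n + 1 := by positivity
  rw [dist_zero_right, Real.norm_eq_abs, abs_div, abs_of_pos this, le_div_iff₀ this]
  exact h

lemma logCutoff_eq_zero_of_le {n : ℕ} {r : ℝ}
    (h : r ≤ Real.exp (-(2 * ((n : ℝ) + 1)))) : logCutoff n r = 0 := by
  rcases le_or_gt r 0 with h0 | h0
  · exact logCutoff_of_nonpos n h0
  · have h1 : Real.log r ≤ -(2 * ((n : ℝ) + 1)) := by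
      rwa [← Real.log_exp (-(2 * ((n : ℝ) + 1))), Real.log_le_log_iff h0 (Real.exp_pos _)]
    exact logCutoff_eq_zero (by rw [abs_of_nonpos] <;> linarith [Nat.cast_nonneg (α := ℝ) n])

lemma logCutoff_eq_zero_of_ge {n : ℕ} {r : ℝ}
    (h : Real.exp (2 * ((n : ℝ) + 1)) ≤ r) : logCutoff n r = 0 := by
  have h0 : 0 < r := (Real.exp_pos _).trans_le h
  have h1 : 2 * ((n : ℝ) + 1) ≤ Real.log r := by
    rwa [← Real.log_exp (2 * ((n : ℝ) + 1)), Real.log_le_log_iff (Real.exp_pos _) h0]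
  exact logCutoff_eq_zero (h1.trans (le_abs_self _))

lemma eventuallyEq_logCutoff (n : ℕ) {r : ℝ} (hr : 0 < r) :
    logCutoff n =ᶠ[𝓝 r] fun s => lineBump (Real.log s / (n + 1)) := by
  filter_upwards [Ioi_mem_nhds hr] with s hs using logCutoff_of_pos n hs

lemma contDiffOn_logCutoff (n : ℕ) : ContDiffOn ℝ ∞ (logCutoff n) (Set.Ioi 0) := by
  refine ContDiffOn.congr ?_ fun r hr => logCutoff_of_pos n hr
  refine lineBump.contDiff.comp_contDiffOn (s := Set.Ioi 0) ?_
  exact (Real.contDiffOn_log.mono fun x hx => ne_of_gt hx).div_const _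

lemma measurable_logCutoff (n : ℕ) : Measurable (logCutoff n) :=
  Measurable.ite measurableSet_Ioi
    (lineBump.continuous.measurable.comp (Real.measurable_log.div_const _)) measurable_const

lemma hasDerivAt_comp_log_div {f : ℝ → ℝ} {f' c r : ℝ} (hr : 0 < r)
    (hf : HasDerivAt f f' (Real.log r / c)) :
    HasDerivAt (fun s => f (Real.log s / c)) (f' * (r⁻¹ / c)) r :=
  hf.comp r ((Real.hasDerivAt_log hr.ne').div_const c)

lemma differentiable_lineBump : Differentiable ℝ lineBump :=
  (lineBump.contDiff (n := ⊤)).differentiable (by simp)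

lemma contDiff_deriv_lineBump : ContDiff ℝ ∞ (deriv lineBump) :=
  (contDiff_infty_iff_deriv.1 (lineBump.contDiff (n := ⊤))).2

lemma hasDerivAt_logCutoff (n : ℕ) {r : ℝ} (hr : 0 < r) :
    HasDerivAt (logCutoff n) (deriv lineBump (Real.log r / (n + 1)) * (r⁻¹ / (n + 1))) r :=
  (hasDerivAt_comp_log_div hr (differentiable_lineBump _).hasDerivAt).congr_of_eventuallyEq
    (eventuallyEq_logCutoff n hr)

lemma exists_bound_deriv_lineBump : ∃ C, 0 ≤ C ∧ (∀ t, |deriv lineBump t| ≤ C) ∧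
    ∀ t, |deriv (deriv lineBump) t| ≤ C := by
  obtain ⟨C1, h1⟩ := lineBump.hasCompactSupport.deriv.exists_bound_of_continuous
    contDiff_deriv_lineBump.continuous
  obtain ⟨C2, h2⟩ := lineBump.hasCompactSupport.deriv.deriv.exists_bound_of_continuous
    (contDiff_infty_iff_deriv.1 contDiff_deriv_lineBump).2.continuous
  exact ⟨max C1 C2, ((norm_nonneg _).trans (h1 0)).trans (le_max_left _ _),
    fun t => (h1 t).trans (le_max_left _ _), fun t => (h2 t).trans (le_max_right _ _)⟩

end Cutoff

/-! ### Smoothness of radial functions that are constant near the origin. -/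

section RadialSmooth

variable {N : ℕ}

lemma contDiff_comp_norm {h : ℝ → ℝ} {a c : ℝ} (ha : 0 < a) (hs : ContDiffOn ℝ ∞ h (Set.Ioi 0))
    (h0 : ∀ r, 0 ≤ r → r < a → h r = c) : ContDiff ℝ ∞ (fun x : Euc N => h ‖x‖) := by
  refine contDiff_of_eventuallyEq_zero (c := c) ?_ fun x hx => ?_
  · filter_upwards [Metric.ball_mem_nhds (0 : Euc N) ha] with x hx
    exact h0 _ (norm_nonneg x) (by simpa using hx)
  · have hx' : 0 < ‖x‖ := norm_pos_iff.2 hx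
    exact (hs.contDiffAt (Ioi_mem_nhds hx')).comp x (contDiffAt_norm ℝ hx)

lemma isTestFun_comp_norm {h : ℝ → ℝ} {a b c : ℝ} (ha : 0 < a)
    (hs : ContDiffOn ℝ ∞ h (Set.Ioi 0)) (h0 : ∀ r, 0 ≤ r → r < a → h r = c)
    (hb : ∀ r, b ≤ r → h r = 0) : IsTestFun (fun x : Euc N => h ‖x‖) := by
  refine ⟨contDiff_comp_norm ha hs h0, ?_⟩
  refine HasCompactSupport.of_support_subset_isCompact (isCompact_closedBall (0 : Euc N) b) ?_
  intro x hx
  by_contra hxb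
  exact hx (hb _ (by simpa using (not_le.1 (by simpa using hxb)).le))

lemma isTestFun_logCutoff (n : ℕ) : IsTestFun (fun x : Euc N => logCutoff n ‖x‖) :=
  isTestFun_comp_norm (Real.exp_pos _) (contDiffOn_logCutoff n)
    (fun _ _ h2 => logCutoff_eq_zero_of_le h2.le) fun _ hr => logCutoff_eq_zero_of_ge hr

end RadialSmooth

/-! ### Mean zero of weighted Laplacians, and symmetry for functions constant near the origin. -/

section SymmetryConst

variable {N : ℕ}

/-- Every term carries a factor 1/(n + 1) on top of the scale-invariant weight r^(α-2); this is the
gain from cutting off in log r. -/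
lemma weightedLap_logCutoff (α : ℝ) (n : ℕ) {x : Euc N} (hx : x ≠ 0) :
    weightedLap α (fun y : Euc N => logCutoff n ‖y‖) x =
      ‖x‖ ^ (α - 2) / (n + 1) * ((N + α - 2) * deriv lineBump (Real.log ‖x‖ / (n + 1))
        + deriv (deriv lineBump) (Real.log ‖x‖ / (n + 1)) / (n + 1)) := by
  have hx0 : 0 < ‖x‖ := norm_pos_iff.2 hx
  have hn : (0 : ℝ) < n + 1 := by positivity
  have h1 : HasDerivAt (fun r : ℝ => r ^ (α - 2) * (deriv lineBump (Real.log r / (n + 1)) / (n + 1)))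
      (((α - 2) * ‖x‖ ^ (α - 2 - 1)) * (deriv lineBump (Real.log ‖x‖ / (n + 1)) / (n + 1)) +
        ‖x‖ ^ (α - 2) * (deriv (deriv lineBump) (Real.log ‖x‖ / (n + 1)) * (‖x‖⁻¹ / (n + 1))
          / (n + 1))) ‖x‖ :=
    (Real.hasDerivAt_rpow_const (Or.inl hx0.ne')).mul ((hasDerivAt_comp_log_div hx0
      (contDiff_deriv_lineBump.differentiable (by simp) _).hasDerivAt).div_const _)
  rw [weightedLap_comp_norm hx (fun r hr => ?_) h1]
  · rw [Real.rpow_sub_one hx0.ne']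
    field_simp
    ring
  · convert hasDerivAt_logCutoff n hr using 1
    have : r ^ (1 - α) * r ^ (α - 2) = r⁻¹ := by
      rw [← Real.rpow_add hr, ← Real.rpow_neg_one]; congr 1; ring
    rw [← mul_assoc, this]
    ring

/-- The singular field has no flux through the origin. Pair with the logarithmic cutoffs and move
the operator onto them: what remains is O(1/(n + 1)) times the integral of |x|^(α-2) over a ball,
finite because α > 2 - N. -/
lemma integral_weightedLap_eq_zero [NeZero N] {α : ℝ} (hα : 2 - (N : ℝ) < α) {φ : Euc N → ℝ}
    (hφ : IsTestFun φ) : ∫ x, weightedLap α φ x = 0 := by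
  obtain ⟨C, hC0, hC1, hC2⟩ := exists_bound_deriv_lineBump
  obtain ⟨M, hM⟩ := hφ.2.exists_bound_of_continuous hφ.1.continuous
  have hM0 : 0 ≤ M := (norm_nonneg _).trans (hM 0)
  obtain ⟨R, hR⟩ := hφ.2.isCompact.isBounded.subset_ball 0
  have key : ∀ n : ℕ, ∫ x, logCutoff n ‖x‖ * weightedLap α φ x
      = ∫ x, φ x * weightedLap α (fun y : Euc N => logCutoff n ‖y‖) x := fun n =>
    (weightedLap_symm α hφ (isTestFun_logCutoff n).1 (by
      filter_upwards [Metric.ball_mem_nhds (0 : Euc N) (Real.exp_pos (-(2 * ((n : ℝ) + 1))))]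
        with x hx
      exact logCutoff_eq_zero_of_le (by simpa using (mem_ball_zero_iff.1 hx).le))).symm
  have l1 : Tendsto (fun n : ℕ => ∫ x, logCutoff n ‖x‖ * weightedLap α φ x) atTop
      (𝓝 (∫ x, weightedLap α φ x)) := by
    refine tendsto_integral_of_dominated_convergence (fun x => ‖weightedLap α φ x‖) ?_
      (integrable_weightedLap hα hφ).norm ?_ ?_
    · intro n
      exact (((measurable_logCutoff n).comp measurable_norm).mul
        (measurable_weightedLap α φ)).aestronglyMeasurable
    · intro n
      refine .of_forall fun x => ?_
      rw [norm_mul]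
      refine mul_le_of_le_one_left (norm_nonneg _) ?_
      rw [Real.norm_of_nonneg (logCutoff_nonneg _ _)]
      exact logCutoff_le_one _ _
    · filter_upwards [ae_ne_zero] with x hx
      refine tendsto_const_nhds.congr' ?_
      filter_upwards [eventually_logCutoff_eq_one (norm_pos_iff.2 hx)] with n hn
      rw [hn, one_mul]
  have hI : Integrable (fun x : Euc N => (Metric.ball 0 R).indicator
      (fun x => M * (|N + α - 2| * C + C) * ‖x‖ ^ (α - 2)) x) :=
    IntegrableOn.integrable_indicator ((integrableOn_norm_rpow_ball (by linarith) R).const_mul _)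
      measurableSet_ball
  have l2 : Tendsto (fun n : ℕ => ∫ x, logCutoff n ‖x‖ * weightedLap α φ x) atTop (𝓝 0) := by
    refine squeeze_zero_norm (a := fun n : ℕ => (∫ x : Euc N, (Metric.ball 0 R).indicator
      (fun x => M * (|N + α - 2| * C + C) * ‖x‖ ^ (α - 2)) x) * (1 / ((n : ℝ) + 1)))
      (fun n => ?_) ?_
    · rw [key n, ← integral_mul_const]
      refine norm_integral_le_of_norm_le (hI.mul_const _) ?_
      filter_upwards [ae_ne_zero] with x hx
      have hn : (0 : ℝ) < n + 1 := by positivity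
      by_cases hxR : x ∈ Metric.ball 0 R
      · rw [Set.indicator_of_mem hxR, weightedLap_logCutoff α n hx]
        rw [norm_mul, norm_mul, Real.norm_of_nonneg (by positivity : 0 ≤ ‖x‖ ^ (α - 2) / (n + 1))]
        have hb : ‖(N + α - 2) * deriv lineBump (Real.log ‖x‖ / (n + 1))
            + deriv (deriv lineBump) (Real.log ‖x‖ / (n + 1)) / (n + 1)‖
            ≤ |N + α - 2| * C + C := by
          refine (norm_add_le _ _).trans (add_le_add ?_ ?_)
          · rw [norm_mul]
            exact mul_le_mul_of_nonneg_left (hC1 _) (norm_nonneg _)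
          · rw [norm_div, Real.norm_of_nonneg hn.le]
            refine (div_le_self (norm_nonneg _) ?_).trans (hC2 _)
            linarith [Nat.cast_nonneg (α := ℝ) n]
        calc _ ≤ M * (‖x‖ ^ (α - 2) / (n + 1) * (|N + α - 2| * C + C)) := by
              gcongr
              exact hM x
          _ = _ := by ring
      · have : φ x = 0 := image_eq_zero_of_notMem_tsupport fun h => hxR (hR h)
        rw [Set.indicator_of_notMem hxR, this]
        simp
    · simpa using tendsto_one_div_add_atTop_nhds_zero_nat.const_mul (∫ x : Euc N,
        (Metric.ball 0 R).indicator (fun x => M * (|N + α - 2| * C + C) * ‖x‖ ^ (α - 2)) x)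
  exact tendsto_nhds_unique l1 l2

/-- Symmetry of the weighted Laplacian, with one of the functions constant near the origin. -/
lemma weightedLap_symm_of_const [NeZero N] {α : ℝ} (hα : 2 - (N : ℝ) < α) {φ η : Euc N → ℝ}
    (hφ : IsTestFun φ) (hη : ContDiff ℝ ∞ η) {c : ℝ} (h0 : ∀ᶠ x in 𝓝 0, η x = c) {B : ℝ}
    (hB : ∀ x, |η x| ≤ B) :
    ∫ x, φ x * weightedLap α η x = ∫ x, η x * weightedLap α φ x := by
  -- Subtracting c makes η vanish near the origin; the price is c times the integral of `weightedLap
  -- α φ`, which is zero.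
  have h1 := weightedLap_symm α hφ (hη.sub contDiff_const (f := η) (g := fun _ => c))
    (by filter_upwards [h0] with x hx; simp [hx])
  have h2 : weightedLap α (fun x => η x - c) = weightedLap α η := by
    have : gradient (fun x => η x - c) = gradient η := by
      ext1 x
      simp [gradient, fderiv_sub_const]
    simp only [weightedLap, this]
  have iL := integrable_weightedLap hα hφ
  have i1 : Integrable (fun x => η x * weightedLap α φ x) :=
    iL.bdd_mul hη.continuous.aestronglyMeasurable (.of_forall hB)
  rw [h2] at h1
  rw [h1]
  simp only [sub_mul]
  rw [integral_sub i1 (iL.const_mul c), integral_const_mul, integral_weightedLap_eq_zero hα hφ]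
  simp

end SymmetryConst

/-! ### Dominated convergence in L² and continuity of the L² pairing. -/

section LpConvergence

variable {X : Type*} [MeasurableSpace X] {μ : Measure X}

lemma tendsto_eLpNorm_two_zero_of_dominated {D : ℕ → X → ℝ} {G : X → ℝ}
    (hD : ∀ n, AEStronglyMeasurable (D n) μ) (hG : MemLp G 2 μ)
    (hle : ∀ n, ∀ᵐ x ∂μ, |D n x| ≤ G x) (hlim : ∀ᵐ x ∂μ, Tendsto (fun n => D n x) atTop (𝓝 0)) :
    Tendsto (fun n => eLpNorm (D n) 2 μ) atTop (𝓝 0) := by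
  have e : ∀ f : X → ℝ, eLpNorm f 2 μ = (∫⁻ x, ‖f x‖ₑ ^ (2 : ℝ) ∂μ) ^ (1 / (2 : ℝ)) := fun f => by
    simpa using eLpNorm_eq_lintegral_rpow_enorm_toReal (p := 2) (f := f) (μ := μ)
      two_ne_zero ENNReal.ofNat_ne_top
  simp only [e]
  have h1 : Tendsto (fun n => ∫⁻ x, ‖D n x‖ₑ ^ (2 : ℝ) ∂μ) atTop (𝓝 (∫⁻ _, 0 ∂μ)) := by
    refine tendsto_lintegral_of_dominated_convergence' (fun x => ‖G x‖ₑ ^ (2 : ℝ))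
      (fun n => (hD n).enorm.pow_const _) (fun n => ?_) ?_ ?_
    · filter_upwards [hle n] with x hx
      gcongr
      rw [enorm_le_iff_norm_le]
      exact hx.trans (le_abs_self _)
    · have := lintegral_rpow_enorm_lt_top_of_eLpNorm_lt_top (p := 2) two_ne_zero
        ENNReal.ofNat_ne_top hG.2
      simpa using this.ne
    · filter_upwards [hlim] with x hx
      have := (ENNReal.continuous_rpow_const (y := 2)).tendsto (‖(0 : ℝ)‖ₑ)
      simpa [Function.comp_def] using this.comp hx.enorm
  have := (ENNReal.continuous_rpow_const (y := 1 / (2 : ℝ))).tendsto (∫⁻ _, 0 ∂μ)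
  simpa [Function.comp_def] using this.comp h1

lemma tendsto_integral_mul_of_eLpNorm_two {w a : X → ℝ} {b : ℕ → X → ℝ} (hw : MemLp w 2 μ)
    (ha : MemLp a 2 μ) (hb : ∀ n, MemLp (b n) 2 μ)
    (h : Tendsto (fun n => eLpNorm (b n - a) 2 μ) atTop (𝓝 0)) :
    Tendsto (fun n => ∫ x, w x * b n x ∂μ) atTop (𝓝 (∫ x, w x * a x ∂μ)) := by
  refine tendsto_integral_of_L1' _ (hw.integrable_mul ha).1
    (.of_forall fun n => hw.integrable_mul (hb n)) ?_
  have h2 := ENNReal.Tendsto.const_mul (a := eLpNorm w 2 μ) h (Or.inr hw.2.ne)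
  rw [mul_zero] at h2
  refine tendsto_of_tendsto_of_tendsto_of_le_of_le tendsto_const_nhds h2 (fun _ => zero_le)
    fun n => ?_
  have := eLpNorm_smul_le_mul_eLpNorm (p := 2) (q := 2) (r := 1) ((hb n).sub ha).1 hw.1
  refine le_trans (le_of_eq ?_) this
  congr 1
  ext x
  simp [mul_sub]

end LpConvergence

/-! ### Tail integrals of s^(σ-1) (1 + s)^(-β). -/

section Tail

lemma rpow_mul_one_add_rpow_integrableOn {σ β : ℝ} (hσ : 0 < σ) (hβ : σ < β) :
    IntegrableOn (fun s : ℝ => s ^ (σ - 1) * (1 + s) ^ (-β)) (Set.Ioi 0) := by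
  have hm : Measurable (fun s : ℝ => s ^ (σ - 1) * (1 + s) ^ (-β)) := by fun_prop
  rw [← Set.Ioc_union_Ioi_eq_Ioi zero_le_one]
  refine IntegrableOn.union ?_ ?_
  · have h1 : IntervalIntegrable (fun y : ℝ => y ^ (σ - 1)) volume 0 1 :=
      intervalIntegral.intervalIntegrable_rpow' (by linarith)
    rw [intervalIntegrable_iff_integrableOn_Ioc_of_le zero_le_one] at h1
    refine Integrable.mono' h1 hm.aestronglyMeasurable ?_
    refine (ae_restrict_iff' measurableSet_Ioc).2 (.of_forall fun s hs => ?_)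
    have hs0 : 0 < s := hs.1
    rw [Real.norm_of_nonneg (by positivity)]
    exact mul_le_of_le_one_right (by positivity)
      (Real.rpow_le_one_of_one_le_of_nonpos (by linarith) (by linarith))
  · refine Integrable.mono' (integrableOn_Ioi_rpow_of_lt (a := σ - 1 - β) (c := 1) (by linarith)
      one_pos) hm.aestronglyMeasurable ?_
    refine (ae_restrict_iff' measurableSet_Ioi).2 (.of_forall fun s (hs : 1 < s) => ?_)
    have hs0 : 0 < s := one_pos.trans hs
    rw [Real.norm_of_nonneg (by positivity), sub_eq_add_neg (σ - 1), Real.rpow_add hs0]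
    gcongr ?_ * ?_
    exact Real.rpow_le_rpow_of_nonpos hs0 (by linarith) (by linarith)

/-- For r ≤ 1 the full integral is a bound, for r > 1 the tail of the pure power s^(σ-1-β) is. The
factor 2^(β-σ) merges the regimes, as (1 + r)/2 ≤ max(1, r). -/
lemma exists_tail_bound {σ β : ℝ} (hσ : 0 < σ) (hβ : σ < β) : ∃ C : ℝ, 0 ≤ C ∧ ∀ r : ℝ, 0 ≤ r →
    ∫ s in Set.Ioi r, s ^ (σ - 1) * (1 + s) ^ (-β) ≤ C * (1 + r) ^ (-(β - σ)) := by
  have hI := rpow_mul_one_add_rpow_integrableOn hσ hβ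
  have hnn : ∀ s ∈ Set.Ioi (0 : ℝ), 0 ≤ s ^ (σ - 1) * (1 + s) ^ (-β) := fun s hs => by
    have : 0 < s := hs
    positivity
  have hI0 := setIntegral_nonneg (μ := volume) measurableSet_Ioi hnn
  set I := ∫ s in Set.Ioi (0 : ℝ), s ^ (σ - 1) * (1 + s) ^ (-β)
  have hβσ : 0 < β - σ := by linarith
  refine ⟨(I + 1 / (β - σ)) * 2 ^ (β - σ), by positivity, fun r hr => ?_⟩
  rcases le_or_gt r 1 with h1 | h1
  · have e1 : ∫ s in Set.Ioi r, s ^ (σ - 1) * (1 + s) ^ (-β) ≤ I :=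
      setIntegral_mono_set hI ((ae_restrict_iff' measurableSet_Ioi).2 (.of_forall hnn))
        (Set.Ioi_subset_Ioi hr).eventuallyLE
    have e2 : 1 ≤ 2 ^ (β - σ) * (1 + r) ^ (-(β - σ)) := by
      rw [Real.rpow_neg (by positivity), ← div_eq_mul_inv, one_le_div (by positivity)]
      exact Real.rpow_le_rpow (by positivity) (by linarith) hβσ.le
    calc _ ≤ I := e1
      _ ≤ I + 1 / (β - σ) := by linarith [one_div_pos.2 hβσ]
      _ ≤ (I + 1 / (β - σ)) * (2 ^ (β - σ) * (1 + r) ^ (-(β - σ))) :=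
        le_mul_of_one_le_right (by positivity) e2
      _ = _ := by ring
  · have hr0 : 0 < r := by linarith
    have e1 : ∫ s in Set.Ioi r, s ^ (σ - 1) * (1 + s) ^ (-β) ≤ ∫ s in Set.Ioi r, s ^ (σ - 1 - β) := by
      refine setIntegral_mono_on (hI.mono_set (Set.Ioi_subset_Ioi hr))
        (integrableOn_Ioi_rpow_of_lt (by linarith) hr0) measurableSet_Ioi fun s (hs : r < s) => ?_
      have hs0 : 0 < s := hr0.trans hs
      rw [sub_eq_add_neg (σ - 1), Real.rpow_add hs0]
      gcongr ?_ * ?_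
      exact Real.rpow_le_rpow_of_nonpos hs0 (by linarith) (by linarith)
    have e2 : r ^ (-(β - σ)) ≤ 2 ^ (β - σ) * (1 + r) ^ (-(β - σ)) := by
      have : 2 ^ (β - σ) * (1 + r) ^ (-(β - σ)) = ((1 + r) / 2) ^ (-(β - σ)) := by
        rw [Real.div_rpow (by positivity) zero_le_two, Real.rpow_neg zero_le_two]
        field_simp
      rw [this]
      exact Real.rpow_le_rpow_of_nonpos (by positivity) (by linarith) (by linarith)
    rw [integral_Ioi_rpow_of_lt (by linarith) hr0] at e1
    calc _ ≤ _ := e1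
      _ = 1 / (β - σ) * r ^ (-(β - σ)) := by
        rw [show σ - 1 - β + 1 = -(β - σ) by ring]; field_simp
      _ ≤ (I + 1 / (β - σ)) * (2 ^ (β - σ) * (1 + r) ^ (-(β - σ))) := by
        gcongr
        linarith
      _ = _ := by ring

end Tail

/-! ### Approximation of radial profiles by truncating the derivative. -/

section Truncation

/-- The derivative of a radial profile, cut off near `0` and near infinity. -/
noncomputable def truncDeriv (α : ℝ) (Q : ℝ → ℝ) (n : ℕ) (s : ℝ) : ℝ :=
  logCutoff n s * (s ^ (1 - α) * Q s)

/-- The primitive of the truncated derivative that vanishes near infinity. -/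
noncomputable def truncProfile (α : ℝ) (Q : ℝ → ℝ) (n : ℕ) (r : ℝ) : ℝ :=
  -∫ s in Set.Ioi r, truncDeriv α Q n s

variable {α : ℝ} {Q : ℝ → ℝ}

lemma truncDeriv_of_le {n : ℕ} {s : ℝ} (h : s ≤ Real.exp (-(2 * ((n : ℝ) + 1)))) :
    truncDeriv α Q n s = 0 := by
  rw [truncDeriv, logCutoff_eq_zero_of_le h, zero_mul]

lemma truncDeriv_of_ge {n : ℕ} {s : ℝ} (h : Real.exp (2 * ((n : ℝ) + 1)) ≤ s) :
    truncDeriv α Q n s = 0 := by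
  rw [truncDeriv, logCutoff_eq_zero_of_ge h, zero_mul]

lemma contDiff_truncDeriv (hQ : ContDiffOn ℝ ∞ Q (Set.Ioi 0)) (n : ℕ) :
    ContDiff ℝ ∞ (truncDeriv α Q n) := by
  rw [contDiff_iff_contDiffAt]
  intro s
  rcases le_or_gt s 0 with hs | hs
  · have : truncDeriv α Q n =ᶠ[𝓝 s] fun _ => 0 := by
      filter_upwards [Iio_mem_nhds (hs.trans_lt (Real.exp_pos (-(2 * ((n : ℝ) + 1)))))] with t ht
      exact truncDeriv_of_le (le_of_lt ht)
    exact contDiffAt_const.congr_of_eventuallyEq this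
  · exact ((contDiffOn_logCutoff n).contDiffAt (Ioi_mem_nhds hs)).mul
      ((contDiffAt_id.rpow_const_of_ne hs.ne').mul (hQ.contDiffAt (Ioi_mem_nhds hs)))

lemma integrable_truncDeriv (hQ : ContDiffOn ℝ ∞ Q (Set.Ioi 0)) (n : ℕ) :
    Integrable (truncDeriv α Q n) := by
  refine (contDiff_truncDeriv hQ n).continuous.integrable_of_hasCompactSupport ?_
  refine HasCompactSupport.of_support_subset_isCompact
    (isCompact_Icc (a := Real.exp (-(2 * ((n : ℝ) + 1)))) (b := Real.exp (2 * ((n : ℝ) + 1))))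
    fun s hs => ⟨?_, ?_⟩
  · by_contra h
    exact hs (truncDeriv_of_le (not_le.1 h).le)
  · by_contra h
    exact hs (truncDeriv_of_ge (not_le.1 h).le)

lemma truncProfile_eq (hQ : ContDiffOn ℝ ∞ Q (Set.Ioi 0)) (n : ℕ) (r : ℝ) :
    truncProfile α Q n r = (∫ s in (0 : ℝ)..r, truncDeriv α Q n s)
      - ∫ s in Set.Ioi 0, truncDeriv α Q n s := by
  have hI := integrable_truncDeriv (α := α) hQ n
  have := intervalIntegral.integral_interval_add_Ioi (a := 0) (b := r) hI.integrableOn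
    hI.integrableOn
  rw [truncProfile]
  linarith

lemma hasDerivAt_truncProfile (hQ : ContDiffOn ℝ ∞ Q (Set.Ioi 0)) (n : ℕ) (r : ℝ) :
    HasDerivAt (truncProfile α Q n) (truncDeriv α Q n r) r := by
  have hc := (contDiff_truncDeriv (α := α) hQ n).continuous
  rw [funext (truncProfile_eq (α := α) hQ n)]
  exact (hc.integral_hasStrictDerivAt 0 r).hasDerivAt.sub_const _

lemma contDiff_truncProfile (hQ : ContDiffOn ℝ ∞ Q (Set.Ioi 0)) (n : ℕ) :
    ContDiff ℝ ∞ (truncProfile α Q n) := by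
  rw [contDiff_infty_iff_deriv]
  refine ⟨fun r => (hasDerivAt_truncProfile hQ n r).differentiableAt, ?_⟩
  rw [funext fun r => (hasDerivAt_truncProfile (α := α) hQ n r).deriv]
  exact contDiff_truncDeriv hQ n

lemma truncProfile_of_lt (hQ : ContDiffOn ℝ ∞ Q (Set.Ioi 0)) {n : ℕ} {r : ℝ} (h0 : 0 ≤ r)
    (h : r < Real.exp (-(2 * ((n : ℝ) + 1)))) : truncProfile α Q n r = truncProfile α Q n 0 := by
  rw [truncProfile_eq hQ, truncProfile_eq hQ, intervalIntegral.integral_same, zero_sub,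
    intervalIntegral.integral_congr (g := fun _ => 0)]
  · simp
  · intro s hs
    rw [Set.uIcc_of_le h0] at hs
    exact truncDeriv_of_le (hs.2.trans h.le)

lemma truncProfile_of_ge {n : ℕ} {r : ℝ} (h : Real.exp (2 * ((n : ℝ) + 1)) ≤ r) :
    truncProfile α Q n r = 0 := by
  rw [truncProfile, setIntegral_eq_zero_of_forall_eq_zero, neg_zero]
  exact fun s hs => truncDeriv_of_ge (h.trans (le_of_lt hs))

lemma isTestFun_truncProfile {N : ℕ} (hQ : ContDiffOn ℝ ∞ Q (Set.Ioi 0)) (n : ℕ) :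
    IsTestFun (fun x : Euc N => truncProfile α Q n ‖x‖) :=
  isTestFun_comp_norm (Real.exp_pos _) (contDiff_truncProfile hQ n).contDiffOn
    (fun _ h1 h2 => truncProfile_of_lt hQ h1 h2) fun _ hr => truncProfile_of_ge hr

/-- Since the derivative is cut off instead of the function, only one derivative of the cutoff
appears, and it comes with 1/(n + 1) times Q and no extra power of r. -/
lemma weightedLap_truncProfile {N : ℕ} (hQ : ContDiffOn ℝ ∞ Q (Set.Ioi 0)) (n : ℕ) {x : Euc N}
    (hx : x ≠ 0) : weightedLap α (fun y : Euc N => truncProfile α Q n ‖y‖) x =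
      logCutoff n ‖x‖ * (N * Q ‖x‖ + ‖x‖ * deriv Q ‖x‖)
        + deriv lineBump (Real.log ‖x‖ / (n + 1)) / (n + 1) * Q ‖x‖ := by
  have hx0 : 0 < ‖x‖ := norm_pos_iff.2 hx
  have hQd : HasDerivAt Q (deriv Q ‖x‖) ‖x‖ :=
    ((hQ.contDiffAt (Ioi_mem_nhds hx0)).differentiableAt (by simp)).hasDerivAt
  rw [weightedLap_comp_norm hx (Q := fun r => logCutoff n r * Q r) (fun r hr => ?_)
    ((hasDerivAt_logCutoff n hx0).mul hQd)]
  · field_simp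
    ring
  · convert hasDerivAt_truncProfile hQ n r using 1
    rw [truncDeriv]
    ring

end Truncation

/-! ### Convergence of the truncated profiles. -/

section Approximation

variable {N : ℕ} {α C : ℝ} {Q : ℝ → ℝ}

lemma memLp_two_one_add_norm {b : ℝ} (hb : (N : ℝ) < 2 * b) :
    MemLp (fun x : Euc N => (1 + ‖x‖) ^ (-b)) 2 := by
  rw [memLp_two_iff_integrable_sq (Measurable.aestronglyMeasurable (by fun_prop))]
  refine (integrable_one_add_norm (E := Euc N) (r := 2 * b) (by simpa using hb)).congr
    (.of_forall fun x => ?_)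
  simp only
  rw [← Real.rpow_mul_natCast (by positivity)]
  congr 1
  push_cast
  ring

/-- Dominated convergence: the decay exponent N - 2 + α of Q and of N Q + r Q' exceeds N/2, which is
exactly the lower bound on α, so the dominating function is in L². -/
lemma tendsto_weightedLap_truncProfile [NeZero N] (hα : (4 - (N : ℝ)) / 2 < α)
    (hQ : ContDiffOn ℝ ∞ Q (Set.Ioi 0)) (hC : ∀ r > 0, |Q r| ≤ C * (1 + r) ^ (-(N - 2 + α)))
    (hC' : ∀ r > 0, |N * Q r + r * deriv Q r| ≤ C * (1 + r) ^ (-(N - 2 + α))) :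
    Tendsto (fun n => eLpNorm (weightedLap α (fun y : Euc N => truncProfile α Q n ‖y‖)
      - fun x => N * Q ‖x‖ + ‖x‖ * deriv Q ‖x‖) 2) atTop (𝓝 0) := by
  obtain ⟨B, hB0, hB, -⟩ := exists_bound_deriv_lineBump
  have hmem := (memLp_two_one_add_norm (N := N) (b := N - 2 + α) (by linarith)).const_mul
    (C + B * C)
  have hC0 : 0 ≤ C := by
    have := (abs_nonneg _).trans (hC 1 one_pos)
    exact nonneg_of_mul_nonneg_left this (by positivity)
  have hcont : ContinuousOn (fun r => N * Q r + r * deriv Q r) (Set.Ioi 0) := by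
    have h1 := hQ.continuousOn
    have h2 := ((contDiffOn_infty_iff_deriv_of_isOpen isOpen_Ioi).1 hQ).2.continuousOn
    fun_prop
  have hmeas : AEStronglyMeasurable (fun x : Euc N => N * Q ‖x‖ + ‖x‖ * deriv Q ‖x‖) := by
    have h1 : ContinuousOn (fun x : Euc N => N * Q ‖x‖ + ‖x‖ * deriv Q ‖x‖) {0}ᶜ :=
      hcont.comp (t := Set.Ioi 0) continuous_norm.continuousOn fun x hx => norm_pos_iff.2 hx
    have := h1.aestronglyMeasurable (μ := volume) (measurableSet_singleton _).compl
    rwa [Measure.restrict_eq_self_of_ae_mem] at this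
    filter_upwards [ae_ne_zero] with x hx using hx
  refine tendsto_eLpNorm_two_zero_of_dominated
    (fun n => (measurable_weightedLap α _).aestronglyMeasurable.sub hmeas) hmem (fun n => ?_) ?_
  · filter_upwards [ae_ne_zero] with x hx
    have hx0 : 0 < ‖x‖ := norm_pos_iff.2 hx
    have hn : (1 : ℝ) ≤ n + 1 := by linarith [Nat.cast_nonneg (α := ℝ) n]
    rw [Pi.sub_apply, weightedLap_truncProfile hQ n hx]
    have e : logCutoff n ‖x‖ * (N * Q ‖x‖ + ‖x‖ * deriv Q ‖x‖)
        + deriv lineBump (Real.log ‖x‖ / (n + 1)) / (n + 1) * Q ‖x‖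
        - (N * Q ‖x‖ + ‖x‖ * deriv Q ‖x‖) = -((1 - logCutoff n ‖x‖) *
          (N * Q ‖x‖ + ‖x‖ * deriv Q ‖x‖)) +
        deriv lineBump (Real.log ‖x‖ / (n + 1)) / (n + 1) * Q ‖x‖ := by ring
    rw [e]
    have c0 := logCutoff_nonneg n ‖x‖
    have c1 := logCutoff_le_one n ‖x‖
    refine (abs_add_le _ _).trans ?_
    rw [abs_neg, abs_mul, abs_mul, abs_of_nonneg (by linarith : 0 ≤ 1 - logCutoff n ‖x‖), abs_div,
      abs_of_nonneg (by linarith : (0 : ℝ) ≤ n + 1), add_mul]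
    refine add_le_add ?_ ?_
    · exact (mul_le_of_le_one_left (abs_nonneg _) (by linarith)).trans (hC' _ hx0)
    · rw [mul_assoc]
      exact mul_le_mul ((div_le_self (abs_nonneg _) hn).trans (hB _)) (hC _ hx0) (abs_nonneg _) hB0
  · filter_upwards [ae_ne_zero] with x hx
    have hx0 : 0 < ‖x‖ := norm_pos_iff.2 hx
    have t1 : Tendsto (fun n : ℕ => deriv lineBump (Real.log ‖x‖ / (n + 1)) / (n + 1) * Q ‖x‖)
        atTop (𝓝 0) := by
      suffices h : Tendsto (fun n : ℕ => deriv lineBump (Real.log ‖x‖ / (n + 1)) / ((n : ℝ) + 1))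
          atTop (𝓝 0) by simpa only [zero_mul] using h.mul_const (Q ‖x‖)
      refine squeeze_zero_norm (a := fun n : ℕ => B * (1 / ((n : ℝ) + 1))) (fun n => ?_) ?_
      · have hn : (0 : ℝ) < n + 1 := by positivity
        rw [norm_div, Real.norm_of_nonneg hn.le, mul_one_div]
        gcongr
        exact hB _
      · simpa using tendsto_one_div_add_atTop_nhds_zero_nat.const_mul B
    refine t1.congr' ?_
    filter_upwards [eventually_logCutoff_eq_one hx0] with n hn
    rw [Pi.sub_apply, weightedLap_truncProfile hQ n hx, hn]
    ring

/-- The bound is uniform in n because the cutoffs are at most 1. Integrating s^(1-α) (1 +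
s)^(-(N-2+α)) over the tail leaves the exponent (N - 2 + α) - (2 - α) = N - 4 + 2α. -/
lemma exists_truncProfile_bound (hα : (4 - (N : ℝ)) / 2 < α) (hα2 : α < 2)
    (hC : ∀ r > 0, |Q r| ≤ C * (1 + r) ^ (-(N - 2 + α))) :
    ∃ C', ∀ n r, 0 ≤ r → |truncProfile α Q n r| ≤ C' * (1 + r) ^ (-(N - 4 + 2 * α)) := by
  have hC0 : 0 ≤ C := by
    have := (abs_nonneg _).trans (hC 1 one_pos)
    exact nonneg_of_mul_nonneg_left this (by positivity)
  have hσ : 0 < 2 - α := by linarith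
  have hβ : 2 - α < N - 2 + α := by linarith
  obtain ⟨A, hA0, hA⟩ := exists_tail_bound hσ hβ
  refine ⟨C * A, fun n r hr => ?_⟩
  rw [truncProfile, abs_neg]
  have hI := rpow_mul_one_add_rpow_integrableOn hσ hβ
  calc _ ≤ ∫ s in Set.Ioi r, C * (s ^ (2 - α - 1) * (1 + s) ^ (-(N - 2 + α))) := by
        rw [← Real.norm_eq_abs]
        refine norm_integral_le_of_norm_le ((hI.mono_set (Set.Ioi_subset_Ioi hr)).const_mul C) ?_
        refine (ae_restrict_iff' measurableSet_Ioi).2 (.of_forall fun s (hs : r < s) => ?_)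
        have hs0 : 0 < s := hr.trans_lt hs
        rw [truncDeriv, norm_mul, norm_mul, Real.norm_of_nonneg (logCutoff_nonneg n s),
          Real.norm_of_nonneg (by positivity : 0 ≤ s ^ (1 - α))]
        refine (mul_le_of_le_one_left (by positivity) (logCutoff_le_one n s)).trans ?_
        rw [show 2 - α - 1 = 1 - α by ring, mul_left_comm]
        gcongr
        exact hC s hs0
    _ ≤ C * (A * (1 + r) ^ (-(N - 2 + α - (2 - α)))) := by
        rw [integral_const_mul]
        gcongr
        exact hA r hr
    _ = _ := by
        rw [mul_assoc]; congr 4; ring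

lemma tendsto_truncProfile (hα : (4 - (N : ℝ)) / 2 < α) (hα2 : α < 2)
    (hQ : ContDiffOn ℝ ∞ Q (Set.Ioi 0)) (hC : ∀ r > 0, |Q r| ≤ C * (1 + r) ^ (-(N - 2 + α)))
    {h : ℝ → ℝ} (hh : ∀ r > 0, HasDerivAt h (r ^ (1 - α) * Q r) r) (hlim : Tendsto h atTop (𝓝 0))
    {r : ℝ} (hr : 0 < r) : Tendsto (fun n => truncProfile α Q n r) atTop (𝓝 (h r)) := by
  have hσ : 0 < 2 - α := by linarith
  have hβ : 2 - α < N - 2 + α := by linarith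
  have hI : IntegrableOn (fun s => C * (s ^ (2 - α - 1) * (1 + s) ^ (-(N - 2 + α)))) (Set.Ioi r) :=
    ((rpow_mul_one_add_rpow_integrableOn hσ hβ).mono_set (Set.Ioi_subset_Ioi hr.le)).const_mul C
  have hbd : ∀ s ∈ Set.Ioi r, ‖s ^ (1 - α) * Q s‖
      ≤ C * (s ^ (2 - α - 1) * (1 + s) ^ (-(N - 2 + α))) := fun s hs => by
    have hs0 : 0 < s := hr.trans hs
    rw [norm_mul, Real.norm_of_nonneg (by positivity : 0 ≤ s ^ (1 - α)),
      show 2 - α - 1 = 1 - α by ring, mul_left_comm]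
    gcongr
    exact hC s hs0
  have hmeas : AEStronglyMeasurable (fun s => s ^ (1 - α) * Q s) (volume.restrict (Set.Ioi r)) := by
    refine ContinuousOn.aestronglyMeasurable (fun s hs => ?_) measurableSet_Ioi
    have hs0 : 0 < s := hr.trans hs
    exact ((Real.continuousAt_rpow_const _ _ (Or.inl hs0.ne')).mul
      (hQ.contDiffAt (Ioi_mem_nhds hs0)).continuousAt).continuousWithinAt
  have hint : IntegrableOn (fun s => s ^ (1 - α) * Q s) (Set.Ioi r) :=
    Integrable.mono' hI hmeas ((ae_restrict_iff' measurableSet_Ioi).2 (.of_forall hbd))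
  -- As h vanishes at infinity, it is minus the tail integral of its derivative, the same
  -- normalization as for the truncated profiles.
  have e : h r = -∫ s in Set.Ioi r, s ^ (1 - α) * Q s := by
    rw [integral_Ioi_of_hasDerivAt_of_tendsto' (fun s hs => hh s (hr.trans_le hs)) hint hlim]
    ring
  rw [e]
  refine Tendsto.neg ?_
  refine tendsto_integral_of_dominated_convergence _
    (fun n => (contDiff_truncDeriv hQ n).continuous.aestronglyMeasurable) hI (fun n => ?_) ?_
  · refine (ae_restrict_iff' measurableSet_Ioi).2 (.of_forall fun s hs => ?_)
    rw [truncDeriv, norm_mul, Real.norm_of_nonneg (logCutoff_nonneg n s)]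
    exact (mul_le_of_le_one_left (norm_nonneg _) (logCutoff_le_one n s)).trans (hbd s hs)
  · refine (ae_restrict_iff' measurableSet_Ioi).2 (.of_forall fun s (hs : r < s) => ?_)
    refine tendsto_const_nhds.congr' ?_
    filter_upwards [eventually_logCutoff_eq_one (hr.trans hs)] with n hn
    rw [truncDeriv, hn, one_mul]

end Approximation

/-! ### The Green operator of the weighted Laplacian on radial functions. -/

section GreenOp

variable {N : ℕ}

/-- The reciprocal of `β` times the area of the unit sphere. -/
noncomputable def greenConst (N : ℕ) (β : ℝ) : ℝ :=
  (β * (N * volume.real (Metric.ball (0 : Euc N) 1)))⁻¹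

/-- The integral operator with kernel proportional to `max(r, |y|)^{-β}`. For `β = N - 2 + α` it
inverts `-div(|x|^α ∇ ·)` on radial functions. -/
noncomputable def greenOp (β : ℝ) (F : Euc N → ℝ) (r : ℝ) : ℝ :=
  greenConst N β * ∫ y, F y * max r ‖y‖ ^ (-β)

lemma volume_real_ball_pos : 0 < volume.real (Metric.ball (0 : Euc N) 1) :=
  ENNReal.toReal_pos (Metric.measure_ball_pos volume _ one_pos).ne' measure_ball_lt_top.ne

lemma greenConst_pos [NeZero N] {β : ℝ} (hβ : 0 < β) : 0 < greenConst N β := by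
  have := volume_real_ball_pos (N := N)
  have hN : 0 < N := Nat.pos_of_neZero N
  unfold greenConst
  positivity

lemma greenConst_nonneg {β : ℝ} (hβ : 0 ≤ β) : 0 ≤ greenConst N β := by
  unfold greenConst
  positivity

lemma max_rpow_neg_le {a r t β : ℝ} (hβ : 0 ≤ β) (har : a ≤ r) (h : 0 < max a t) :
    max r t ^ (-β) ≤ max a t ^ (-β) :=
  Real.rpow_le_rpow_of_nonpos h (max_le_max_right t har) (by linarith)

lemma measurable_max_norm_rpow (r β : ℝ) : Measurable (fun y : Euc N => max r ‖y‖ ^ (-β)) :=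
  (measurable_const.max measurable_norm).pow_const _

lemma continuousAt_max_rpow {r t β : ℝ} (h : 0 < max r t) :
    ContinuousAt (fun s => max s t ^ (-β)) r :=
  (continuousAt_id.max continuousAt_const).rpow_const (Or.inl h.ne')

/-! ### Continuity and decay of Green potentials. -/

section Continuity

variable {β a : ℝ} {F : Euc N → ℝ}

/-- The kernel is positive off the origin, whatever a is, and can be divided out. -/
lemma aestronglyMeasurable_of_mul_max {a : ℝ} [NeZero N]
    (hF : Integrable (fun y => F y * max a ‖y‖ ^ (-β))) : AEStronglyMeasurable F := by
  refine (hF.1.mul (measurable_max_norm_rpow a (-β)).aestronglyMeasurable).congr ?_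
  filter_upwards [ae_ne_zero] with y hy
  have : 0 < max a ‖y‖ := lt_max_of_lt_right (norm_pos_iff.2 hy)
  simp only [Pi.mul_apply, neg_neg]
  rw [mul_assoc, ← Real.rpow_add this]
  simp

lemma greenOp_bound_aux [NeZero N] (hβ : 0 ≤ β) {r : ℝ} (har : a ≤ r) :
    ∀ᵐ y : Euc N, ‖F y * max r ‖y‖ ^ (-β)‖ ≤ ‖F y * max a ‖y‖ ^ (-β)‖ := by
  filter_upwards [ae_ne_zero] with y hy
  have h0 : 0 < ‖y‖ := norm_pos_iff.2 hy
  have h1 : 0 < max a ‖y‖ := lt_max_of_lt_right h0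
  have h2 : 0 < max r ‖y‖ := lt_max_of_lt_right h0
  rw [norm_mul, norm_mul, Real.norm_of_nonneg (by positivity : 0 ≤ max r ‖y‖ ^ (-β)),
    Real.norm_of_nonneg (by positivity : 0 ≤ max a ‖y‖ ^ (-β))]
  exact mul_le_mul_of_nonneg_left (max_rpow_neg_le hβ har h1) (norm_nonneg _)

lemma integrable_mul_max_mono [NeZero N] (hβ : 0 ≤ β)
    (hF : Integrable (fun y => F y * max a ‖y‖ ^ (-β))) {r : ℝ} (har : a ≤ r) :
    Integrable (fun y => F y * max r ‖y‖ ^ (-β)) :=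
  hF.mono ((aestronglyMeasurable_of_mul_max hF).mul
    (measurable_max_norm_rpow r β).aestronglyMeasurable) (greenOp_bound_aux hβ har)

/-- The kernel decreases in r, so integrability at the left endpoint dominates. The endpoint a = 0
is allowed, which later gives continuity of regular profiles up to the origin. -/
lemma continuousOn_greenOp [NeZero N] (hβ : 0 ≤ β)
    (hF : Integrable (fun y => F y * max a ‖y‖ ^ (-β))) :
    ContinuousOn (greenOp β F) (Set.Ici a) := by
  have hm := aestronglyMeasurable_of_mul_max hF
  unfold greenOp
  refine ContinuousOn.const_mul (fun r hr => ?_) _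
  refine tendsto_integral_filter_of_dominated_convergence _ (.of_forall fun s =>
    hm.mul (measurable_max_norm_rpow s β).aestronglyMeasurable) ?_ hF.norm ?_
  · filter_upwards [self_mem_nhdsWithin] with s hs using greenOp_bound_aux hβ hs
  · filter_upwards [ae_ne_zero] with y hy
    exact ((continuousAt_max_rpow (lt_max_of_lt_right (norm_pos_iff.2 hy))).tendsto.mono_left
      nhdsWithin_le_nhds).const_mul _

lemma tendsto_greenOp_atTop [NeZero N] (hβ : 0 < β)
    (hF : Integrable (fun y => F y * max a ‖y‖ ^ (-β))) :
    Tendsto (greenOp β F) atTop (𝓝 0) := by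
  have hm := aestronglyMeasurable_of_mul_max hF
  have : Tendsto (fun r => ∫ y, F y * max r ‖y‖ ^ (-β)) atTop (𝓝 (∫ _ : Euc N, (0 : ℝ))) := by
    refine tendsto_integral_filter_of_dominated_convergence _ (.of_forall fun s =>
      hm.mul (measurable_max_norm_rpow s β).aestronglyMeasurable) ?_ hF.norm ?_
    · filter_upwards [eventually_ge_atTop a] with s hs using greenOp_bound_aux hβ.le hs
    · refine .of_forall fun y => ?_
      have h1 : Tendsto (fun s => max s ‖y‖) atTop atTop :=
        tendsto_atTop_mono (fun s => le_max_left s _) tendsto_id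
      simpa [Function.comp_def] using
        ((tendsto_rpow_neg_atTop hβ).comp h1).const_mul (F y)
  have h2 := this.const_mul (greenConst N β)
  rw [integral_zero, mul_zero] at h2
  exact h2

end Continuity

/-! ### Differentiating the potential of a radial function. -/

section RadialGreen

variable {β : ℝ} {Z : ℝ → ℝ}

lemma greenOp_radial [NeZero N] (hβ : 0 < β) (Z : ℝ → ℝ) (r : ℝ) :
    greenOp β (fun y : Euc N => Z ‖y‖) r =
      β⁻¹ * ∫ t in Set.Ioi (0 : ℝ), t ^ (N - 1) * (Z t * max r t ^ (-β)) := by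
  have : Nonempty (Fin N) := ⟨0⟩
  have hN : (N : ℝ) ≠ 0 := Nat.cast_ne_zero.2 (NeZero.ne N)
  have h1 := integral_fun_norm_addHaar (volume : Measure (Euc N))
    (fun t => Z t * max r t ^ (-β))
  have h2 := (volume_real_ball_pos (N := N)).ne'
  rw [greenOp, h1, greenConst]
  simp only [finrank_euclideanSpace, Fintype.card_fin, nsmul_eq_mul, smul_eq_mul]
  field_simp

lemma integrable_radial_iff [NeZero N] {f : ℝ → ℝ} :
    Integrable (fun y : Euc N => f ‖y‖) ↔
      IntegrableOn (fun t => t ^ (N - 1) * f t) (Set.Ioi 0) := by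
  have : Nonempty (Fin N) := ⟨0⟩
  have := integrable_fun_norm_addHaar (volume : Measure (Euc N)) (f := f)
  simpa using this

variable [NeZero N]

lemma integrableOn_Ioc_of_green
    (hint : ∀ r > 0, Integrable (fun y : Euc N => Z ‖y‖ * max r ‖y‖ ^ (-β))) {r : ℝ} (hr : 0 < r) :
    IntegrableOn (fun t => t ^ (N - 1) * Z t) (Set.Ioc 0 r) := by
  have h1 := (integrable_radial_iff (f := fun t => Z t * max r t ^ (-β))).1 (hint r hr)
  have h2 := (h1.mono_set (s := Set.Ioc 0 r) fun t ht => ht.1).mul_const (r ^ β)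
  refine IntegrableOn.congr_fun h2 (fun t ht => ?_) measurableSet_Ioc
  have : r ^ (-β) * r ^ β = 1 := by rw [← Real.rpow_add hr]; simp
  simp only [max_eq_left ht.2]
  rw [mul_assoc, mul_assoc, this, mul_one]

lemma integrableOn_Ioi_of_green
    (hint : ∀ r > 0, Integrable (fun y : Euc N => Z ‖y‖ * max r ‖y‖ ^ (-β))) {r : ℝ} (hr : 0 < r) :
    IntegrableOn (fun t => t ^ (N - 1) * (Z t * t ^ (-β))) (Set.Ioi r) := by
  have h1 := (integrable_radial_iff (f := fun t => Z t * max r t ^ (-β))).1 (hint r hr)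
  refine (h1.mono_set (Set.Ioi_subset_Ioi hr.le)).congr_fun (fun t (ht : r < t) => ?_)
    measurableSet_Ioi
  simp only [max_eq_right ht.le]

/-- Newton's shell formula: the kernel is r^(-β) on the inner ball and t^(-β) outside it. -/
lemma greenOp_split
    (hint : ∀ r > 0, Integrable (fun y : Euc N => Z ‖y‖ * max r ‖y‖ ^ (-β))) (hβ : 0 < β) {r : ℝ}
    (hr : 0 < r) :
    greenOp β (fun y : Euc N => Z ‖y‖) r =
      β⁻¹ * (r ^ (-β) * (∫ t in (0 : ℝ)..r, t ^ (N - 1) * Z t)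
        + ∫ t in Set.Ioi r, t ^ (N - 1) * (Z t * t ^ (-β))) := by
  have h1 := (integrable_radial_iff (f := fun t => Z t * max r t ^ (-β))).1 (hint r hr)
  rw [greenOp_radial hβ, ← Set.Ioc_union_Ioi_eq_Ioi hr.le,
    setIntegral_union (Set.Ioc_disjoint_Ioi le_rfl) measurableSet_Ioi
      (h1.mono_set Set.Ioc_subset_Ioi_self) (h1.mono_set (Set.Ioi_subset_Ioi hr.le)),
    intervalIntegral.integral_of_le hr.le, ← integral_const_mul]
  congr 2
  · refine setIntegral_congr_fun measurableSet_Ioc fun t ht => ?_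
    simp only [max_eq_left ht.2]
    ring
  · refine setIntegral_congr_fun measurableSet_Ioi fun t (ht : r < t) => ?_
    simp only [max_eq_right ht.le]

lemma hasDerivAt_flux
    (hZ : ContinuousOn Z (Set.Ioi 0))
    (hint : ∀ r > 0, Integrable (fun y : Euc N => Z ‖y‖ * max r ‖y‖ ^ (-β))) {r : ℝ} (hr : 0 < r) :
    HasDerivAt (fun r => ∫ t in (0 : ℝ)..r, t ^ (N - 1) * Z t) (r ^ (N - 1) * Z r) r := by
  have hc : ContinuousOn (fun t => t ^ (N - 1) * Z t) (Set.Ioi 0) := by fun_prop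
  refine intervalIntegral.integral_hasDerivAt_right ?_
    (hc.stronglyMeasurableAtFilter isOpen_Ioi r hr) (hc.continuousAt (Ioi_mem_nhds hr))
  rw [intervalIntegrable_iff_integrableOn_Ioc_of_le hr.le]
  exact integrableOn_Ioc_of_green hint hr

/-- The boundary terms from the inner and outer integrals cancel at t = r, so only the derivative of
the factor r^(-β) survives. -/
lemma hasDerivAt_greenOp
    (hZ : ContinuousOn Z (Set.Ioi 0))
    (hint : ∀ r > 0, Integrable (fun y : Euc N => Z ‖y‖ * max r ‖y‖ ^ (-β))) (hβ : 0 < β) {r : ℝ}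
    (hr : 0 < r) :
    HasDerivAt (greenOp β (fun y : Euc N => Z ‖y‖))
      (-(r ^ (-β - 1) * ∫ t in (0 : ℝ)..r, t ^ (N - 1) * Z t)) r := by
  have hc : ContinuousOn (fun t => t ^ (N - 1) * (Z t * t ^ (-β))) (Set.Ioi 0) := by
    refine ContinuousOn.mul (by fun_prop) (hZ.mul fun t ht => ?_)
    exact (Real.continuousAt_rpow_const _ _ (Or.inl (ne_of_gt ht))).continuousWithinAt
  have h1 := hasDerivAt_flux hZ hint hr
  have h2 : HasDerivAt (fun s => ∫ t in Set.Ioi s, t ^ (N - 1) * (Z t * t ^ (-β)))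
      (-(r ^ (N - 1) * (Z r * r ^ (-β)))) r := by
    have h3 : HasDerivAt (fun s => ∫ t in r..s, t ^ (N - 1) * (Z t * t ^ (-β)))
        (r ^ (N - 1) * (Z r * r ^ (-β))) r :=
      intervalIntegral.integral_hasDerivAt_right (by simp)
        (hc.stronglyMeasurableAtFilter isOpen_Ioi r hr) (hc.continuousAt (Ioi_mem_nhds hr))
    refine (h3.const_sub (∫ t in Set.Ioi r, t ^ (N - 1) * (Z t * t ^ (-β)))).congr_of_eventuallyEq ?_
    filter_upwards [Ioi_mem_nhds hr] with s hs
    rw [← intervalIntegral.integral_interval_add_Ioi (integrableOn_Ioi_of_green hint hr)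
      (integrableOn_Ioi_of_green hint hs)]
    ring
  have h4 := ((((Real.hasDerivAt_rpow_const (p := -β) (Or.inl hr.ne')).mul h1).add h2).const_mul β⁻¹)
  refine (h4.congr_of_eventuallyEq ?_).congr_deriv ?_
  · filter_upwards [Ioi_mem_nhds hr] with s hs using greenOp_split hint hβ hs
  · field_simp
    ring

/-- The vector field `|x|^α ∇ S(Z)` is `fluxCoeff N Z |x|` times `x`. -/
noncomputable def fluxCoeff (N : ℕ) (Z : ℝ → ℝ) (r : ℝ) : ℝ :=
  -((r ^ N)⁻¹ * ∫ t in (0 : ℝ)..r, t ^ (N - 1) * Z t)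

lemma hasDerivAt_greenOp'
    (hZ : ContinuousOn Z (Set.Ioi 0))
    (hint : ∀ r > 0, Integrable (fun y : Euc N => Z ‖y‖ * max r ‖y‖ ^ (-β))) {α : ℝ}
    (hα : β = N - 2 + α) (hβ : 0 < β) {r : ℝ} (hr : 0 < r) :
    HasDerivAt (greenOp β (fun y : Euc N => Z ‖y‖)) (r ^ (1 - α) * fluxCoeff N Z r) r := by
  convert hasDerivAt_greenOp hZ hint hβ hr using 1
  have : r ^ (1 - α) * (r ^ N)⁻¹ = r ^ (-β - 1) := by
    rw [← Real.rpow_natCast, ← Real.rpow_neg hr.le, ← Real.rpow_add hr]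
    congr 1
    rw [hα]; ring
  rw [fluxCoeff, ← this]
  ring

lemma hasDerivAt_fluxCoeff
    (hZ : ContinuousOn Z (Set.Ioi 0))
    (hint : ∀ r > 0, Integrable (fun y : Euc N => Z ‖y‖ * max r ‖y‖ ^ (-β))) {r : ℝ} (hr : 0 < r) :
    HasDerivAt (fluxCoeff N Z) (-(N * fluxCoeff N Z r + Z r) / r) r := by
  have h1 := hasDerivAt_flux hZ hint hr
  have h2 := (((hasDerivAt_pow N r).inv (pow_ne_zero _ hr.ne')).mul h1).neg
  refine h2.congr_deriv ?_
  have e : r ^ N = r * r ^ (N - 1) := by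
    rw [← pow_succ', Nat.sub_add_cancel NeZero.one_le]
  have h0 : r ^ (N - 1) ≠ 0 := pow_ne_zero _ hr.ne'
  simp only [fluxCoeff, Pi.inv_apply]
  rw [e]
  field_simp

lemma contDiffOn_fluxCoeff
    (hint : ∀ r > 0, Integrable (fun y : Euc N => Z ‖y‖ * max r ‖y‖ ^ (-β)))
    (hZs : ContDiffOn ℝ ∞ Z (Set.Ioi 0)) :
    ContDiffOn ℝ ∞ (fluxCoeff N Z) (Set.Ioi 0) := by
  have h : ContDiffOn ℝ ∞ (fun r => ∫ t in (0 : ℝ)..r, t ^ (N - 1) * Z t) (Set.Ioi 0) := by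
    rw [contDiffOn_infty_iff_deriv_of_isOpen isOpen_Ioi]
    refine ⟨fun r hr => (hasDerivAt_flux hZs.continuousOn hint
      hr).differentiableAt.differentiableWithinAt, ?_⟩
    refine ContDiffOn.congr (f := fun r => r ^ (N - 1) * Z r) ?_ fun r hr =>
      (hasDerivAt_flux hZs.continuousOn hint hr).deriv
    exact (contDiff_id.pow _).contDiffOn.mul hZs
  exact (((contDiff_id.pow N).contDiffOn.inv (s := Set.Ioi 0) fun r hr => pow_ne_zero _ (ne_of_gt hr)).mul h).neg

lemma contDiffOn_greenOp
    (hint : ∀ r > 0, Integrable (fun y : Euc N => Z ‖y‖ * max r ‖y‖ ^ (-β)))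
    (hZs : ContDiffOn ℝ ∞ Z (Set.Ioi 0)) (hβ : 0 < β) :
    ContDiffOn ℝ ∞ (greenOp β (fun y : Euc N => Z ‖y‖)) (Set.Ioi 0) := by
  have hd := fun (r : ℝ) (hr : r ∈ Set.Ioi 0) => hasDerivAt_greenOp' (α := β - N + 2)
    hZs.continuousOn hint (by ring) hβ hr
  rw [contDiffOn_infty_iff_deriv_of_isOpen isOpen_Ioi]
  refine ⟨fun r hr => (hd r hr).differentiableAt.differentiableWithinAt, ?_⟩
  refine ContDiffOn.congr ?_ fun r hr => (hd r hr).deriv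
  refine ContDiffOn.mul (fun r hr => ?_) (contDiffOn_fluxCoeff hint hZs)
  exact (contDiffAt_id.rpow_const_of_ne (ne_of_gt hr)).contDiffWithinAt

/-- Together with `weightedLap_comp_norm` this is the statement that the Green operator inverts the
negative weighted Laplacian on radial functions. -/
lemma flux_divergence
    (hint : ∀ r > 0, Integrable (fun y : Euc N => Z ‖y‖ * max r ‖y‖ ^ (-β)))
    (hZ : ContinuousOn Z (Set.Ioi 0)) {r : ℝ} (hr : 0 < r) :
    N * fluxCoeff N Z r + r * deriv (fluxCoeff N Z) r = -Z r := by
  rw [(hasDerivAt_fluxCoeff hZ hint hr).deriv]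
  field_simp
  ring

end RadialGreen

end GreenOp

/-! ### The Green kernel integrated against powers of the norm. -/

section PowerKernel

variable {N : ℕ}

lemma integrable_norm_rpow_mul_max [NeZero N] {a b r : ℝ} (ha : a < N) (hab : N < a + b)
    (hr : 0 < r) : Integrable (fun y : Euc N => ‖y‖ ^ (-a) * max r ‖y‖ ^ (-b)) := by
  rw [← integrableOn_univ, ← Set.union_compl_self (Metric.ball (0 : Euc N) r)]
  refine IntegrableOn.union ?_ ?_
  · refine IntegrableOn.congr_fun ((integrableOn_norm_rpow_ball (s := -a) (by linarith) r).mul_const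
      (r ^ (-b))) (fun y hy => ?_) measurableSet_ball
    simp only [max_eq_left (mem_ball_zero_iff.1 hy).le]
  · refine IntegrableOn.congr_fun (integrableOn_norm_rpow_compl_ball (s := -a + -b) (by linarith) hr)
      (fun y hy => ?_) measurableSet_ball.compl
    have hy : r ≤ ‖y‖ := by simpa using hy
    simp only [max_eq_right hy]
    rw [Real.rpow_add (hr.trans_le hy)]

/-- The integral of `|y|^{-a} max(1, |y|)^{-b}`. -/
noncomputable def powerConst (N : ℕ) (a b : ℝ) : ℝ :=
  ∫ y : Euc N, ‖y‖ ^ (-a) * max 1 ‖y‖ ^ (-b)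

lemma powerConst_nonneg (N : ℕ) (a b : ℝ) : 0 ≤ powerConst N a b :=
  integral_nonneg fun y => by positivity

/-- Substitute y = r z. By this homogeneity the Green operator sends a power of the norm to an
explicit constant times a power. -/
lemma integral_norm_rpow_mul_max (a b : ℝ) {r : ℝ} (hr : 0 < r) :
    ∫ y : Euc N, ‖y‖ ^ (-a) * max r ‖y‖ ^ (-b) = r ^ (N - a - b) * powerConst N a b := by
  have h := Measure.integral_comp_smul (volume : Measure (Euc N))
    (fun y : Euc N => ‖y‖ ^ (-a) * max 1 ‖y‖ ^ (-b)) r⁻¹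
  have e : ∀ x : Euc N, ‖r⁻¹ • x‖ ^ (-a) * max 1 ‖r⁻¹ • x‖ ^ (-b)
      = r ^ (a + b) * (‖x‖ ^ (-a) * max r ‖x‖ ^ (-b)) := fun x => by
    have e1 : max 1 ‖r⁻¹ • x‖ = r⁻¹ * max r ‖x‖ := by
      rw [norm_smul, norm_inv, Real.norm_of_nonneg hr.le, mul_max_of_nonneg _ _ (by positivity),
        inv_mul_cancel₀ hr.ne']
    rw [e1, norm_smul, norm_inv, Real.norm_of_nonneg hr.le,
      Real.mul_rpow (by positivity) (norm_nonneg x),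
      Real.mul_rpow (by positivity) (le_max_of_le_left hr.le), Real.inv_rpow hr.le,
      Real.inv_rpow hr.le, Real.rpow_neg hr.le, Real.rpow_neg hr.le, inv_inv, inv_inv,
      Real.rpow_add hr]
    ring
  simp only [e] at h
  rw [integral_const_mul] at h
  simp only [finrank_euclideanSpace, Fintype.card_fin, inv_pow, inv_inv, smul_eq_mul,
    abs_of_pos (pow_pos hr N)] at h
  have h2 : r ^ ((N : ℝ) - a - b) = r ^ N * r ^ (-(a + b)) := by
    rw [← Real.rpow_natCast, ← Real.rpow_add hr]; congr 1; ring
  rw [h2, powerConst]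
  have h3 : r ^ (-(a + b)) * r ^ (a + b) = 1 := by rw [← Real.rpow_add hr]; simp
  calc _ = (r ^ (-(a + b)) * r ^ (a + b)) * ∫ y : Euc N, ‖y‖ ^ (-a) * max r ‖y‖ ^ (-b) := by
        rw [h3, one_mul]
    _ = r ^ (-(a + b)) * (r ^ (a + b) * ∫ y : Euc N, ‖y‖ ^ (-a) * max r ‖y‖ ^ (-b)) := by ring
    _ = _ := by rw [h]; ring

lemma one_add_rpow_le_max {r b : ℝ} (hr : 0 ≤ r) (hb : 0 ≤ b) :
    (1 + r) ^ (-b) ≤ max 1 r ^ (-b) :=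
  Real.rpow_le_rpow_of_nonpos (by positivity) (max_le (by linarith) (by linarith)) (by linarith)

lemma max_rpow_le_one_add {r b : ℝ} (hr : 0 ≤ r) (hb : 0 ≤ b) :
    max 1 r ^ (-b) ≤ 2 ^ b * (1 + r) ^ (-b) := by
  have : 2 ^ b * (1 + r) ^ (-b) = ((1 + r) / 2) ^ (-b) := by
    rw [Real.div_rpow (by positivity) zero_le_two, Real.rpow_neg zero_le_two]
    field_simp
  rw [this]
  refine Real.rpow_le_rpow_of_nonpos (by positivity) ?_ (by linarith)
  rcases le_total 1 r with h | h
  · rw [max_eq_right h]; linarith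
  · rw [max_eq_left h]; linarith

lemma max_rpow_bound {A x r b : ℝ} (h1 : x ≤ A) (h2 : x ≤ A * r ^ (-b)) :
    x ≤ A * max 1 r ^ (-b) := by
  rcases le_total 1 r with h | h
  · rwa [max_eq_right h]
  · rwa [max_eq_left h, Real.one_rpow, mul_one]

end PowerKernel

/-! ### Pointwise bounds and symmetry of the Green operator. -/

section GreenEstimates

variable {N : ℕ} {β : ℝ}

lemma abs_greenOp_le [NeZero N] (hβ : 0 ≤ β) {F G : Euc N → ℝ} {r : ℝ}
    (hG : Integrable (fun y => G y * max r ‖y‖ ^ (-β))) (h : ∀ᵐ y, |F y| ≤ G y) :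
    |greenOp β F r| ≤ greenOp β G r := by
  have hκ := greenConst_nonneg (N := N) hβ
  rw [greenOp, abs_mul, abs_of_nonneg hκ, greenOp]
  refine mul_le_mul_of_nonneg_left ?_ hκ
  rw [← Real.norm_eq_abs]
  refine norm_integral_le_of_norm_le hG ?_
  filter_upwards [h, ae_ne_zero] with y hy hy0
  have : 0 < max r ‖y‖ := lt_max_of_lt_right (norm_pos_iff.2 hy0)
  rw [norm_mul, Real.norm_of_nonneg (by positivity : 0 ≤ max r ‖y‖ ^ (-β))]
  exact mul_le_mul_of_nonneg_right hy (by positivity)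

lemma greenOp_norm_rpow {a r : ℝ} (hr : 0 < r) :
    greenOp β (fun y : Euc N => ‖y‖ ^ (-a)) r
      = greenConst N β * powerConst N a β * r ^ (N - a - β) := by
  rw [greenOp, integral_norm_rpow_mul_max a β hr]
  ring

lemma greenOp_const_mul (c : ℝ) (F : Euc N → ℝ) (r : ℝ) :
    greenOp β (fun y => c * F y) r = c * greenOp β F r := by
  simp only [greenOp, mul_assoc, integral_const_mul]
  ring

/-- Functions decaying like `|y|^{-β}` at infinity are mapped to functions decaying like
`|y|^{N - 2β}`. -/
lemma exists_greenOp_abs_bound [NeZero N] (hβ : 0 < β) (hβN : β < N) (hN2 : N < 2 * β)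
    {G : Euc N → ℝ}
    {C : ℝ} (hC : 0 ≤ C) (hGm : AEStronglyMeasurable G) (hG : ∀ᵐ y, |G y| ≤ C * max 1 ‖y‖ ^ (-β)) :
    (∀ r, 0 ≤ r → Integrable (fun y => G y * max r ‖y‖ ^ (-β))) ∧
    ∃ A, ∀ r > 0, |greenOp β (fun y => |G y|) r| ≤ A * max 1 r ^ (-(2 * β - N)) := by
  have e1 : ∀ y : Euc N, ‖y‖ ^ (-β) * max 1 ‖y‖ ^ (-β) = max 1 ‖y‖ ^ (-β) * max 0 ‖y‖ ^ (-β) :=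
    fun y => by rw [max_eq_right (norm_nonneg y), mul_comm]
  have i1 : Integrable (fun y : Euc N => (C * max 1 ‖y‖ ^ (-β)) * max 0 ‖y‖ ^ (-β)) := by
    refine ((integrable_norm_rpow_mul_max (b := β) hβN (by linarith) one_pos).const_mul C).congr
      (.of_forall fun y => ?_)
    simp only [e1, mul_assoc]
  have i2 : Integrable (fun y => G y * max 0 ‖y‖ ^ (-β)) := by
    refine i1.mono' (hGm.mul (measurable_max_norm_rpow 0 β).aestronglyMeasurable) ?_
    filter_upwards [hG] with y hy
    rw [norm_mul, Real.norm_of_nonneg (by positivity : 0 ≤ max 0 ‖y‖ ^ (-β))]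
    gcongr
    exact hy
  refine ⟨fun r hr => integrable_mul_max_mono hβ.le i2 hr, ?_⟩
  -- The first constant bounds the potential uniformly, by its value with the kernel at radius 0.
  -- The second gives the decay r^(N - 2β), replacing max(1, |y|)^(-β) by the homogeneous |y|^(-β).
  refine ⟨max (greenConst N β * C * powerConst N β β) (C * (greenConst N β * powerConst N β β)),
    fun r hr => max_rpow_bound ?_ ?_⟩
  · refine le_trans (abs_greenOp_le hβ.le (integrable_mul_max_mono hβ.le i1 hr.le)
      (by simpa using hG)) (le_trans ?_ (le_max_left _ _))
    rw [greenOp, mul_assoc]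
    refine mul_le_mul_of_nonneg_left ?_ (greenConst_nonneg hβ.le)
    rw [powerConst, ← integral_const_mul]
    refine integral_mono_ae (integrable_mul_max_mono hβ.le i1 hr.le)
      ((integrable_norm_rpow_mul_max hβN (by linarith) one_pos).const_mul C) ?_
    filter_upwards [ae_ne_zero] with y hy
    simp only [e1]
    rw [← mul_assoc]
    exact mul_le_mul_of_nonneg_left (max_rpow_neg_le hβ.le hr.le
      (lt_max_of_lt_right (norm_pos_iff.2 hy))) (by positivity)
  · have i3 : Integrable (fun y : Euc N => (C * ‖y‖ ^ (-β)) * max r ‖y‖ ^ (-β)) := by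
      simpa only [mul_assoc] using
        (integrable_norm_rpow_mul_max hβN (by linarith) hr).const_mul C
    refine le_trans (abs_greenOp_le hβ.le i3 ?_) ?_
    · filter_upwards [hG, ae_ne_zero] with y hy hy0
      rw [abs_abs]
      refine hy.trans ?_
      exact mul_le_mul_of_nonneg_left (Real.rpow_le_rpow_of_nonpos (norm_pos_iff.2 hy0)
        (le_max_right _ _) (by linarith)) hC
    · rw [greenOp_const_mul, greenOp_norm_rpow hr, show (N : ℝ) - β - β = -(2 * β - N) by ring,
        ← mul_assoc]
      gcongr
      exact le_max_right _ _

lemma abs_fluxCoeff_le [NeZero N] (hβN : β < N) {Z : ℝ → ℝ} {C : ℝ}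
    (hZ : ∀ t > 0, |Z t| ≤ C * max 1 t ^ (-β)) (hβ : 0 < β) :
    ∃ A, ∀ r > 0, |fluxCoeff N Z r| ≤ A * max 1 r ^ (-β) := by
  have hN : (0 : ℝ) < N := Nat.cast_pos.2 (Nat.pos_of_neZero N)
  have hN1 : 1 ≤ N := NeZero.one_le
  have hC : 0 ≤ C := by
    have := (abs_nonneg _).trans (hZ 1 one_pos)
    simpa using this
  have hσ : 0 < N - β := by linarith
  -- One computation serves both regimes: s = N gives boundedness, and s = N - β, positive because β
  -- < N, gives decay like r^(-β).
  have gen : ∀ s : ℝ, 0 < s → (∀ t > 0, |Z t| ≤ C * t ^ (s - N)) → ∀ r > 0,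
      |fluxCoeff N Z r| ≤ C / s * r ^ (s - N) := by
    intro s hs h r hr
    have h1 : |∫ t in (0 : ℝ)..r, t ^ (N - 1) * Z t| ≤ ∫ t in (0 : ℝ)..r, C * t ^ (s - 1) := by
      rw [← Real.norm_eq_abs]
      refine intervalIntegral.norm_integral_le_of_norm_le hr.le (.of_forall fun t ht => ?_)
        ((intervalIntegral.intervalIntegrable_rpow' (by linarith)).const_mul C)
      have ht0 : 0 < t := ht.1
      rw [norm_mul, norm_pow, Real.norm_of_nonneg ht0.le]
      calc _ ≤ t ^ (N - 1) * (C * t ^ (s - N)) := by gcongr; exact h t ht0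
        _ = _ := by
          rw [← Real.rpow_natCast, Nat.cast_sub hN1, mul_left_comm, ← Real.rpow_add ht0]
          congr 2
          push_cast
          ring
    rw [intervalIntegral.integral_const_mul, integral_rpow (Or.inl (by linarith)),
      sub_add_cancel, Real.zero_rpow hs.ne', sub_zero] at h1
    rw [fluxCoeff, abs_neg, abs_mul, abs_of_nonneg (by positivity)]
    calc _ ≤ (r ^ N)⁻¹ * (C * (r ^ s / s)) := by gcongr
      _ = _ := by rw [Real.rpow_sub hr, Real.rpow_natCast]; ring
  refine ⟨max (C / N) (C / (N - β)), fun r hr => max_rpow_bound ?_ ?_⟩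
  · refine (gen N hN (fun t ht => (hZ t ht).trans ?_) r hr).trans ?_
    · rw [sub_self, Real.rpow_zero]
      gcongr
      exact Real.rpow_le_one_of_one_le_of_nonpos (le_max_left _ _) (by linarith)
    · rw [sub_self, Real.rpow_zero, mul_one]
      exact le_max_left _ _
  · refine (gen (N - β) hσ (fun t ht => (hZ t ht).trans ?_) r hr).trans ?_
    · rw [show (N : ℝ) - β - N = -β by ring]
      exact mul_le_mul_of_nonneg_left (Real.rpow_le_rpow_of_nonpos ht (le_max_right _ _)
        (by linarith)) hC
    · rw [show (N : ℝ) - β - N = -β by ring]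
      gcongr
      exact le_max_right _ _

/-- Symmetry of the Green operator. -/
lemma integral_mul_greenOp_comm {F G : Euc N → ℝ}
    (h : Integrable (fun p : Euc N × Euc N => F p.1 * (G p.2 * max ‖p.1‖ ‖p.2‖ ^ (-β)))
      (volume.prod volume)) :
    ∫ x, F x * greenOp β G ‖x‖ = ∫ x, G x * greenOp β F ‖x‖ := by
  have h1 : ∫ x, F x * greenOp β G ‖x‖
      = greenConst N β * ∫ x, ∫ y, F x * (G y * max ‖x‖ ‖y‖ ^ (-β)) := by
    rw [← integral_const_mul]
    refine integral_congr_ae (.of_forall fun x => ?_)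
    simp only [greenOp, integral_const_mul]
    ring
  have h2 : ∫ x, G x * greenOp β F ‖x‖
      = greenConst N β * ∫ y, ∫ x, F x * (G y * max ‖x‖ ‖y‖ ^ (-β)) := by
    rw [← integral_const_mul]
    refine integral_congr_ae (.of_forall fun y => ?_)
    simp only [greenOp, mul_left_comm (F _) (G _), integral_const_mul]
    simp only [max_comm ‖y‖]
    ring
  rw [h1, h2, integral_integral_swap h]

lemma measurable_kernel : Measurable (fun p : Euc N × Euc N => max ‖p.1‖ ‖p.2‖ ^ (-β)) :=
  (measurable_fst.norm.max measurable_snd.norm).pow_const _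

/-- On the support of G the kernel is at most max(a, |x|)^(-β), which no longer depends on the
second variable, so the double integral is dominated by a product. -/
lemma integrable_prod_of_support [NeZero N] (hβ : 0 ≤ β) {F G : Euc N → ℝ} {a : ℝ} (ha : 0 < a)
    (hF : Integrable (fun y => F y * max a ‖y‖ ^ (-β))) (hG : Integrable G)
    (hG0 : ∀ y, ‖y‖ < a → G y = 0) :
    Integrable (fun p : Euc N × Euc N => F p.1 * (G p.2 * max ‖p.1‖ ‖p.2‖ ^ (-β)))
      (volume.prod volume) := by
  have hFm := aestronglyMeasurable_of_mul_max hF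
  refine (hF.mul_prod hG).mono (hFm.comp_fst.mul
    (hG.1.comp_snd.mul measurable_kernel.aestronglyMeasurable)) (.of_forall fun p => ?_)
  by_cases h : ‖p.2‖ < a
  · simp [hG0 _ h]
  · have hp : 0 < max ‖p.1‖ ‖p.2‖ := lt_max_of_lt_right (ha.trans_le (not_lt.1 h))
    have hp' : 0 < max a ‖p.1‖ := lt_max_of_lt_left ha
    simp only [norm_mul]
    rw [Real.norm_of_nonneg (by positivity : 0 ≤ max ‖p.1‖ ‖p.2‖ ^ (-β)),
      Real.norm_of_nonneg (by positivity : 0 ≤ max a ‖p.1‖ ^ (-β)), mul_assoc,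
      mul_comm (max a ‖p.1‖ ^ (-β))]
    refine mul_le_mul_of_nonneg_left (mul_le_mul_of_nonneg_left ?_ (norm_nonneg _)) (norm_nonneg _)
    refine Real.rpow_le_rpow_of_nonpos hp' ?_ (by linarith)
    rw [max_comm]
    exact max_le_max_left _ (not_lt.1 h)

/-- Tonelli: the inner integral of the absolute value is, up to the positive Green constant, the
potential of |G|. -/
lemma integrable_prod_of_greenOp_abs [NeZero N] (hβ : 0 < β) {F G : Euc N → ℝ}
    (hF : AEStronglyMeasurable F)
    (hG : AEStronglyMeasurable G) (hGi : ∀ r > 0, Integrable (fun y => G y * max r ‖y‖ ^ (-β)))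
    (hFG : Integrable (fun x => F x * greenOp β (fun y => |G y|) ‖x‖)) :
    Integrable (fun p : Euc N × Euc N => F p.1 * (G p.2 * max ‖p.1‖ ‖p.2‖ ^ (-β)))
      (volume.prod volume) := by
  refine (integrable_prod_iff (hF.comp_fst.mul
    (hG.comp_snd.mul measurable_kernel.aestronglyMeasurable))).2 ⟨?_, ?_⟩
  · filter_upwards [ae_ne_zero] with x hx
    exact (hGi _ (norm_pos_iff.2 hx)).const_mul (F x)
  · refine (hFG.norm.const_mul (greenConst N β)⁻¹).congr (.of_forall fun x => ?_)
    have hκ := greenConst_pos (N := N) hβ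
    have e : ∀ y : Euc N, ‖F x * (G y * max ‖x‖ ‖y‖ ^ (-β))‖
        = ‖F x‖ * (|G y| * max ‖x‖ ‖y‖ ^ (-β)) := fun y => by
      rw [norm_mul, norm_mul, Real.norm_of_nonneg (by positivity : 0 ≤ max ‖x‖ ‖y‖ ^ (-β))]
      rfl
    simp only [Pi.mul_apply, e, integral_const_mul]
    have h0 : 0 ≤ ∫ y : Euc N, |G y| * max ‖x‖ ‖y‖ ^ (-β) := integral_nonneg fun y => by positivity
    rw [greenOp, norm_mul, norm_mul, Real.norm_of_nonneg hκ.le, Real.norm_of_nonneg h0]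
    field_simp

end GreenEstimates

/-! ### Green potentials of L² functions. -/

section GreenLTwo

variable {N : ℕ} {β : ℝ}

lemma integral_abs_mul_le_sqrt {X : Type*} [MeasurableSpace X] {μ : Measure X} {f g : X → ℝ}
    (hf : MemLp f 2 μ) (hg : MemLp g 2 μ) :
    ∫ x, |f x| * |g x| ∂μ ≤ √(∫ x, f x ^ 2 ∂μ) * √(∫ x, g x ^ 2 ∂μ) := by
  have := integral_mul_norm_le_Lp_mul_Lq (μ := μ) (f := f) (g := g) Real.HolderConjugate.two_two
    (by simpa using hf) (by simpa using hg)
  simpa [Real.sqrt_eq_rpow] using this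

lemma memLp_two_max_rpow [NeZero N] (hN2 : N < 2 * β) {r : ℝ} (hr : 0 < r) :
    MemLp (fun y : Euc N => max r ‖y‖ ^ (-β)) 2 := by
  rw [memLp_two_iff_integrable_sq (measurable_max_norm_rpow r β).aestronglyMeasurable]
  have hN : (0 : ℝ) < N := Nat.cast_pos.2 (Nat.pos_of_neZero N)
  refine (integrable_norm_rpow_mul_max (N := N) (a := 0) (b := 2 * β) hN (by linarith) hr).congr
    (.of_forall fun y => ?_)
  simp only [neg_zero, Real.rpow_zero, one_mul]
  rw [← Real.rpow_mul_natCast (le_max_of_le_left hr.le)]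
  congr 1
  push_cast
  ring

lemma integral_max_rpow_sq {r : ℝ} (hr : 0 < r) :
    ∫ y : Euc N, (max r ‖y‖ ^ (-β)) ^ 2 = r ^ (N - 2 * β) * powerConst N 0 (2 * β) := by
  have h := integral_norm_rpow_mul_max (N := N) 0 (2 * β) hr
  rw [sub_zero] at h
  rw [← h]
  refine integral_congr_ae (.of_forall fun y => ?_)
  simp only [neg_zero, Real.rpow_zero, one_mul]
  rw [← Real.rpow_mul_natCast (le_max_of_le_left hr.le)]
  congr 1
  push_cast
  ring

lemma integrable_mul_max_of_memLp [NeZero N] (hN2 : N < 2 * β) {w : Euc N → ℝ} (hw : MemLp w 2)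
    {r : ℝ}
    (hr : 0 < r) : Integrable (fun y => w y * max r ‖y‖ ^ (-β)) :=
  hw.integrable_mul (memLp_two_max_rpow hN2 hr)

/-- Cauchy-Schwarz against the kernel, which is square integrable because N < 2β; by scaling its L²
norm is a multiple of r^(N/2 - β). -/
lemma abs_greenOp_le_of_memLp [NeZero N] (hβ : 0 ≤ β) (hN2 : N < 2 * β) {w : Euc N → ℝ}
    (hw : MemLp w 2)
    {r : ℝ} (hr : 0 < r) : |greenOp β w r| ≤
      greenConst N β * (√(∫ y, w y ^ 2) * √(powerConst N 0 (2 * β))) * r ^ (N / 2 - β) := by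
  rw [greenOp, abs_mul, abs_of_nonneg (greenConst_nonneg hβ), mul_assoc]
  refine mul_le_mul_of_nonneg_left ?_ (greenConst_nonneg hβ)
  rw [← Real.norm_eq_abs]
  refine (norm_integral_le_integral_norm _).trans ?_
  simp only [norm_mul]
  refine (integral_abs_mul_le_sqrt hw (memLp_two_max_rpow hN2 hr)).trans (le_of_eq ?_)
  rw [integral_max_rpow_sq hr, Real.sqrt_mul (by positivity), mul_assoc, mul_comm √(powerConst _ _ _)]
  congr 2
  rw [Real.sqrt_eq_rpow, ← Real.rpow_mul hr.le]
  congr 1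
  ring

lemma tendsto_integral_indicator_ball_sq [NeZero N] {w : Euc N → ℝ} (hw : MemLp w 2) :
    Tendsto (fun n : ℕ => ∫ y, (Metric.ball (0 : Euc N) (1 / ((n : ℝ) + 1))).indicator w y ^ 2)
      atTop (𝓝 0) := by
  have h2 := (memLp_two_iff_integrable_sq hw.1).1 hw
  rw [← integral_zero (Euc N) ℝ (μ := volume)]
  refine tendsto_integral_of_dominated_convergence _ (fun n =>
    ((hw.1.indicator measurableSet_ball).pow 2)) h2 (fun n => .of_forall fun y => ?_) ?_
  · rw [Real.norm_of_nonneg (sq_nonneg _)]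
    by_cases hy : y ∈ Metric.ball (0 : Euc N) (1 / ((n : ℝ) + 1))
    · rw [Set.indicator_of_mem hy]
    · rw [Set.indicator_of_notMem hy]
      simpa using sq_nonneg (w y)
  · filter_upwards [ae_ne_zero] with y hy
    refine tendsto_const_nhds.congr' ?_
    have := (tendsto_one_div_add_atTop_nhds_zero_nat (𝕜 := ℝ)).eventually_lt_const
      (norm_pos_iff.2 hy)
    filter_upwards [this] with n hn
    rw [Set.indicator_of_notMem (by simpa using hn.le)]
    simp

/-- The Green operator applied to an `L²` function is `o(r^{N/2 - β})` at the origin. -/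
lemma greenOp_isLittleO [NeZero N] (hβ : 0 < β) (hN2 : N < 2 * β) {w : Euc N → ℝ} (hw : MemLp w 2)
    {ε : ℝ} (hε : 0 < ε) :
    ∃ δ > 0, ∀ r, 0 < r → r < δ → |greenOp β w r| ≤ ε * r ^ (N / 2 - β) := by
  set K := greenConst N β * √(powerConst N 0 (2 * β)) with hK
  have hK0 : 0 ≤ K := mul_nonneg (greenConst_nonneg hβ.le) (Real.sqrt_nonneg _)
  have h1 : Tendsto (fun n : ℕ => K * √(∫ y, (Metric.ball (0 : Euc N) (1 / ((n : ℝ) + 1))).indicator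
      w y ^ 2)) atTop (𝓝 0) := by
    have := ((Real.continuous_sqrt.tendsto 0).comp
      (tendsto_integral_indicator_ball_sq hw)).const_mul K
    simpa using this
  obtain ⟨n, hn⟩ := (h1.eventually_lt_const (half_pos hε)).exists
  set δ := 1 / ((n : ℝ) + 1)
  have hδ : 0 < δ := by positivity
  -- Near the origin w has small L² norm, hence a small constant in the r^(N/2 - β) bound. The far
  -- part has a bounded potential, negligible against r^(N/2 - β) as r → 0.
  set w1 := (Metric.ball (0 : Euc N) δ).indicator w
  set w2 := (Metric.ball (0 : Euc N) δ)ᶜ.indicator w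
  have hw1 : MemLp w1 2 := hw.indicator measurableSet_ball
  have hw2 : MemLp w2 2 := hw.indicator measurableSet_ball.compl
  have hsum : ∀ y, w y = w1 y + w2 y := fun y => by
    by_cases hy : y ∈ Metric.ball (0 : Euc N) δ <;> simp [w1, w2, hy]
  set M := greenConst N β * ∫ y, |w2 y| * max δ ‖y‖ ^ (-β) with hM
  have hM0 : 0 ≤ M := mul_nonneg (greenConst_nonneg hβ.le)
    (integral_nonneg fun y => mul_nonneg (abs_nonneg _)
      (Real.rpow_nonneg (le_max_of_le_left hδ.le) _))
  have hb : β - N / 2 > 0 := by linarith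
  have h2 : Tendsto (fun r : ℝ => M * r ^ (β - N / 2)) (𝓝 0) (𝓝 0) := by
    have := ((Real.continuousAt_rpow_const 0 (β - N / 2) (Or.inr hb.le)).tendsto).const_mul M
    simpa [Real.zero_rpow hb.ne'] using this
  obtain ⟨δ', hδ', h3⟩ := Metric.eventually_nhds_iff.1 (h2.eventually_lt_const (half_pos hε))
  refine ⟨min δ δ', lt_min hδ hδ', fun r hr hrδ => ?_⟩
  have e : greenOp β w r = greenOp β w1 r + greenOp β w2 r := by
    simp only [greenOp, ← mul_add]
    rw [← integral_add (integrable_mul_max_of_memLp hN2 hw1 hr)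
      (integrable_mul_max_of_memLp hN2 hw2 hr)]
    simp only [← add_mul, ← hsum]
  have b1 : |greenOp β w1 r| ≤ ε / 2 * r ^ (N / 2 - β) := by
    refine (abs_greenOp_le_of_memLp hβ.le hN2 hw1 hr).trans ?_
    gcongr
    refine le_trans (le_of_eq ?_) hn.le
    rw [hK]; ring
  have b2 : |greenOp β w2 r| ≤ M := by
    rw [greenOp, abs_mul, abs_of_nonneg (greenConst_nonneg hβ.le), hM]
    refine mul_le_mul_of_nonneg_left ?_ (greenConst_nonneg hβ.le)
    rw [← Real.norm_eq_abs]
    refine norm_integral_le_of_norm_le ?_ (.of_forall fun y => ?_)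
    · refine (integrable_mul_max_of_memLp hN2 hw2 hδ).norm.congr (.of_forall fun y => ?_)
      have : 0 ≤ max δ ‖y‖ ^ (-β) := Real.rpow_nonneg (le_max_of_le_left hδ.le) _
      simp only [norm_mul, Real.norm_of_nonneg this]
      rfl
    · by_cases hy : ‖y‖ < δ
      · simp [w2, hy]
      · have hy : δ ≤ ‖y‖ := not_lt.1 hy
        have : r ≤ ‖y‖ := (hrδ.le.trans (min_le_left _ _)).trans hy
        rw [max_eq_right hy, max_eq_right this, norm_mul,
          Real.norm_of_nonneg (by positivity : 0 ≤ ‖y‖ ^ (-β))]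
        rfl
  have b3 : M ≤ ε / 2 * r ^ (N / 2 - β) := by
    have := h3 (y := r) (by rw [Real.dist_0_eq_abs, abs_of_pos hr]; exact hrδ.trans_le (min_le_right _ _))
    have e2 : r ^ (β - N / 2) * r ^ (N / 2 - β) = 1 := by rw [← Real.rpow_add hr]; simp
    calc M = (M * r ^ (β - N / 2)) * r ^ (N / 2 - β) := by rw [mul_assoc, e2, mul_one]
      _ ≤ _ := by gcongr
  calc |greenOp β w r| ≤ |greenOp β w1 r| + |greenOp β w2 r| := by rw [e]; exact abs_add_le _ _
    _ ≤ ε / 2 * r ^ (N / 2 - β) + ε / 2 * r ^ (N / 2 - β) := add_le_add b1 (b2.trans b3)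
    _ = _ := by ring

end GreenLTwo

/-! ### Radial functions are determined by radial tests. -/

section RadialFundamental

variable {N : ℕ}

/-- The fundamental lemma of the calculus of variations for radial functions. -/
lemma ae_eq_zero_of_radial_tests [NeZero N] {G : ℝ → ℝ}
    (hG : LocallyIntegrable (fun x : Euc N => G ‖x‖))
    (h : ∀ ζ : ℝ → ℝ, ContDiff ℝ ∞ ζ → HasCompactSupport ζ → tsupport ζ ⊆ Set.Ioi 0 →
      ∫ x : Euc N, G ‖x‖ * ζ ‖x‖ = 0) : ∀ᵐ x : Euc N, G ‖x‖ = 0 := by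
  have : Nonempty (Fin N) := ⟨0⟩
  have hloc : LocallyIntegrableOn (fun t => t ^ (N - 1) * G t) (Set.Ioi 0) := by
    intro t ht
    have h1 : IntegrableOn (fun x : Euc N => G ‖x‖) (Metric.ball 0 (t + 1)) :=
      (hG.integrableOn_isCompact (isCompact_closedBall 0 (t + 1))).mono_set
        Metric.ball_subset_closedBall
    rw [integrableOn_fun_norm_addHaar] at h1
    refine ⟨Set.Ioo 0 (t + 1), ?_, by simpa using h1⟩
    exact mem_nhdsWithin.2 ⟨Set.Iio (t + 1), isOpen_Iio, by simp, fun s hs => ⟨hs.2, hs.1⟩⟩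
  have h1 : ∀ᵐ t : ℝ, t ∈ Set.Ioi 0 → t ^ (N - 1) * G t = 0 := by
    refine isOpen_Ioi.ae_eq_zero_of_integral_contDiff_smul_eq_zero hloc fun ζ h1 h2 h3 => ?_
    have h4 := h ζ h1 h2 h3
    rw [integral_fun_norm_addHaar volume (fun t => G t * ζ t)] at h4
    simp only [finrank_euclideanSpace, Fintype.card_fin, nsmul_eq_mul, smul_eq_mul,
      mul_eq_zero, Nat.cast_eq_zero, NeZero.ne N, volume_real_ball_pos.ne', false_or] at h4
    rw [← h4, ← setIntegral_eq_integral_of_forall_compl_eq_zero (s := Set.Ioi 0)]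
    · congr 1
      ext t
      rw [smul_eq_mul]
      ring
    · intro t ht
      have : ζ t = 0 := image_eq_zero_of_notMem_tsupport fun hh => ht (h3 hh)
      simp [this]
  -- The vanishing holds for almost every radius. To obtain it for almost every point, enclose the
  -- exceptional radii in a measurable null set and compute the integral of its indicator in polar
  -- coordinates.
  obtain ⟨T, hT, hTm, hT0⟩ := exists_measurable_superset_of_null (ae_iff.1 h1)
  set f : ℝ → ℝ := T.indicator fun _ => 1
  have hz : (fun t => t ^ (N - 1) * f t) =ᵐ[volume.restrict (Set.Ioi 0)] 0 := by
    refine ae_restrict_of_ae ?_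
    have : ∀ᵐ t : ℝ, t ∉ T := measure_eq_zero_iff_ae_notMem.1 hT0
    filter_upwards [this] with t ht
    simp [f, ht]
  have hi : Integrable (fun x : Euc N => f ‖x‖) :=
    integrable_radial_iff.2 ((integrable_zero ℝ ℝ _).congr hz.symm)
  have hI : ∫ x : Euc N, f ‖x‖ = 0 := by
    rw [integral_fun_norm_addHaar volume f]
    simp only [finrank_euclideanSpace, Fintype.card_fin, smul_eq_mul]
    rw [integral_congr_ae hz]
    simp
  rw [integral_eq_zero_iff_of_nonneg (fun x => Set.indicator_nonneg (fun _ _ => zero_le_one) _) hi]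
    at hI
  filter_upwards [hI, ae_ne_zero] with x hx hx0
  by_contra hne
  have hpos : 0 < ‖x‖ := norm_pos_iff.2 hx0
  have : ‖x‖ ∈ T := hT fun hh => hne (by simpa [hx0] using hh hpos)
  simp [this] at hx

end RadialFundamental

/-! ### Green potentials of radial test functions supported away from the origin. -/

section RadialTests

variable {N : ℕ} {α β : ℝ} {ζ : ℝ → ℝ}

lemma exists_support_bounds (hζ : ContDiff ℝ ∞ ζ) (hc : HasCompactSupport ζ)
    (hs : tsupport ζ ⊆ Set.Ioi 0) :
    ∃ a b M : ℝ, 0 < a ∧ 0 < b ∧ 0 ≤ M ∧ (∀ t, t < a → ζ t = 0) ∧ (∀ t, b < t → ζ t = 0) ∧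
      ∀ t, |ζ t| ≤ M := by
  obtain ⟨M, hM⟩ := hc.exists_bound_of_continuous hζ.continuous
  have hM0 : 0 ≤ M := (norm_nonneg _).trans (hM 0)
  rcases (tsupport ζ).eq_empty_or_nonempty with h | h
  · have hz : ∀ t, ζ t = 0 := fun t => image_eq_zero_of_notMem_tsupport (by simp [h])
    exact ⟨1, 1, M, one_pos, one_pos, hM0, fun t _ => hz t, fun t _ => hz t, hM⟩
  · obtain ⟨a, ha⟩ := hc.isCompact.exists_isLeast h
    obtain ⟨b, hb⟩ := hc.isCompact.exists_isGreatest h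
    refine ⟨a, b, M, hs ha.1, hs hb.1, hM0, fun t ht => ?_, fun t ht => ?_, hM⟩
    · exact image_eq_zero_of_notMem_tsupport fun hh => (ha.2 hh).not_gt ht
    · exact image_eq_zero_of_notMem_tsupport fun hh => (hb.2 hh).not_gt ht

lemma isTestFun_radial (hζ : ContDiff ℝ ∞ ζ) (hc : HasCompactSupport ζ)
    (hs : tsupport ζ ⊆ Set.Ioi 0) : IsTestFun (fun x : Euc N => ζ ‖x‖) := by
  obtain ⟨a, b, M, ha, hb, hM, h1, h2, h3⟩ := exists_support_bounds hζ hc hs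
  exact isTestFun_comp_norm (b := b + 1) ha hζ.contDiffOn (fun r _ hr => h1 r hr)
    fun r hr => h2 r (by linarith)

lemma exists_radialTest_decay (β : ℝ) (hζ : ContDiff ℝ ∞ ζ) (hc : HasCompactSupport ζ)
    (hs : tsupport ζ ⊆ Set.Ioi 0) : ∃ C, 0 ≤ C ∧ ∀ t, |ζ t| ≤ C * max 1 t ^ (-β) := by
  obtain ⟨a, b, M, ha, hb, hM, h1, h2, h3⟩ := exists_support_bounds hζ hc hs
  refine ⟨M * max 1 b ^ |β|, by positivity, fun t => ?_⟩
  by_cases ht : b < t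
  · rw [h2 t ht, abs_zero]
    positivity
  · have e : 1 ≤ max 1 b ^ |β| * max 1 t ^ (-β) := by
      have h4 : max 1 t ^ β ≤ max 1 b ^ |β| :=
        (Real.rpow_le_rpow_of_exponent_le (le_max_left _ _) (le_abs_self β)).trans
          (Real.rpow_le_rpow (by positivity) (max_le_max_left _ (not_lt.1 ht)) (abs_nonneg _))
      rw [Real.rpow_neg (by positivity), ← div_eq_mul_inv, one_le_div (by positivity)]
      exact h4
    calc |ζ t| ≤ M := h3 t
      _ ≤ M * (max 1 b ^ |β| * max 1 t ^ (-β)) := le_mul_of_one_le_right hM e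
      _ = _ := by ring

/-- Properties of the Green potential of a radial test function supported away from the origin. -/
structure GreenTest (N : ℕ) (α : ℝ) (ζ η : ℝ → ℝ) : Prop where
  smooth : ContDiffOn ℝ ∞ η (Set.Ioi 0)
  decay : ∃ C, 0 ≤ C ∧ ∀ r > 0, |η r| ≤ C * max 1 r ^ (-(N - 2 + α))
  const : ∃ a > 0, ∀ r, 0 ≤ r → r < a → η r = η 0
  lap : ∀ x : Euc N, x ≠ 0 → weightedLap α (fun y => η ‖y‖) x = -ζ ‖x‖

/-- For r below the support of ζ the kernel max(r, |y|)^(-β) equals |y|^(-β) on that support, so the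
potential is constant near the origin and hence smooth there as a function on ℝ^N. Its decay r^(-β)
comes from the bound of the kernel by r^(-β) and integrability of ζ. -/
lemma greenTest_greenOp [NeZero N] (hα : (4 - (N : ℝ)) / 2 < α) (hα2 : α < 2) (hζ : ContDiff ℝ ∞ ζ)
    (hc : HasCompactSupport ζ) (hs : tsupport ζ ⊆ Set.Ioi 0) :
    GreenTest N α ζ (greenOp (N - 2 + α) (fun y : Euc N => ζ ‖y‖)) := by
  obtain ⟨a, b, M, ha, hb, hM, h1, h2, h3⟩ := exists_support_bounds hζ hc hs
  have hβ : 0 < (N : ℝ) - 2 + α := by linarith [(Nat.cast_nonneg N : (0 : ℝ) ≤ N)]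
  obtain ⟨C, hC0, hC⟩ := exists_radialTest_decay (N - 2 + α) hζ hc hs
  have htest := isTestFun_radial (N := N) hζ hc hs
  have hGm : AEStronglyMeasurable (fun y : Euc N => ζ ‖y‖) := htest.1.continuous.aestronglyMeasurable
  have hζi : Integrable (fun y : Euc N => ζ ‖y‖) :=
    htest.1.continuous.integrable_of_hasCompactSupport htest.2
  obtain ⟨hint, A, hA⟩ := exists_greenOp_abs_bound hβ (by linarith) (by linarith) hC0 hGm
    (.of_forall fun y => hC ‖y‖)
  have hint' := fun r (hr : (0 : ℝ) < r) => hint r hr.le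
  refine ⟨contDiffOn_greenOp hint' hζ.contDiffOn hβ, ?_, ⟨a, ha, fun r hr hra => ?_⟩,
    fun x hx => ?_⟩
  · have hA0 : 0 ≤ A := by simpa using (abs_nonneg _).trans (hA 1 one_pos)
    refine ⟨max A (greenConst N (N - 2 + α) * ∫ y : Euc N, |ζ ‖y‖|),
      hA0.trans (le_max_left _ _), fun r hr => ?_⟩
    have e0 : |greenOp (N - 2 + α) (fun y : Euc N => ζ ‖y‖) r|
        ≤ greenOp (N - 2 + α) (fun y : Euc N => |ζ ‖y‖|) r := by
      refine abs_greenOp_le hβ.le ?_ (.of_forall fun y => le_rfl)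
      refine (hint r hr.le).norm.congr (.of_forall fun y => ?_)
      have : 0 ≤ max r ‖y‖ ^ (-((N : ℝ) - 2 + α)) := Real.rpow_nonneg (le_max_of_le_left hr.le) _
      simp only [norm_mul, Real.norm_of_nonneg this]
      rfl
    refine max_rpow_bound ?_ ?_
    · refine e0.trans ((le_abs_self _).trans ((hA r hr).trans ?_))
      refine (mul_le_of_le_one_right hA0 ?_).trans (le_max_left _ _)
      exact Real.rpow_le_one_of_one_le_of_nonpos (le_max_left _ _) (by linarith)
    · refine e0.trans ?_
      have hk : 0 ≤ greenConst N ((N : ℝ) - 2 + α) := greenConst_nonneg hβ.le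
      calc _ ≤ greenConst N (N - 2 + α) * ((∫ y : Euc N, |ζ ‖y‖|) * r ^ (-((N : ℝ) - 2 + α))) := by
            rw [greenOp, ← integral_mul_const]
            refine mul_le_mul_of_nonneg_left ?_ hk
            refine integral_mono_of_nonneg (.of_forall fun y => ?_) (hζi.abs.mul_const _)
              (.of_forall fun y => ?_)
            · exact mul_nonneg (abs_nonneg _) (Real.rpow_nonneg (le_max_of_le_left hr.le) _)
            · exact mul_le_mul_of_nonneg_left (Real.rpow_le_rpow_of_nonpos hr (le_max_left _ _)
                (by linarith)) (abs_nonneg _)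
        _ = (greenConst N (N - 2 + α) * ∫ y : Euc N, |ζ ‖y‖|) * r ^ (-((N : ℝ) - 2 + α)) := by ring
        _ ≤ _ := by
          gcongr
          exact le_max_right _ _
  · simp only [greenOp]
    congr 1
    refine integral_congr_ae (.of_forall fun y => ?_)
    by_cases hy : ‖y‖ < a
    · simp [h1 _ hy]
    · simp only
      rw [max_eq_right (hra.le.trans (not_lt.1 hy)), max_eq_right (norm_nonneg y)]
  · have hx0 : 0 < ‖x‖ := norm_pos_iff.2 hx
    rw [weightedLap_comp_norm hx (fun r hr => hasDerivAt_greenOp' hζ.continuous.continuousOn hint'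
      rfl hβ hr) (hasDerivAt_fluxCoeff hζ.continuous.continuousOn hint' hx0)]
    field_simp
    ring

end RadialTests

/-! ### Radial elements of the energy space as Green potentials. -/

section Duality

variable {N : ℕ} {α : ℝ} {ζ η : ℝ → ℝ} {u w : Euc N → ℝ}

lemma memLp_two_of_decay [NeZero N] (hα : (4 - (N : ℝ)) / 2 < α) {η : ℝ → ℝ}
    (hs : ContinuousOn η (Set.Ioi 0)) {C : ℝ}
    (hd : ∀ r > 0, |η r| ≤ C * max 1 r ^ (-(N - 2 + α))) :
    MemLp (fun x : Euc N => η ‖x‖) 2 := by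
  have hm : AEStronglyMeasurable (fun x : Euc N => η ‖x‖) := by
    have h1 : ContinuousOn (fun x : Euc N => η ‖x‖) {0}ᶜ :=
      hs.comp (t := Set.Ioi 0) continuous_norm.continuousOn fun x hx => norm_pos_iff.2 hx
    have := h1.aestronglyMeasurable (μ := volume) (measurableSet_singleton _).compl
    rwa [Measure.restrict_eq_self_of_ae_mem] at this
    filter_upwards [ae_ne_zero] with x hx using hx
  refine ((memLp_two_max_rpow (N := N) (β := N - 2 + α) (by linarith) one_pos).const_mul C).mono'
    hm ?_
  filter_upwards [ae_ne_zero] with x hx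
  exact hd _ (norm_pos_iff.2 hx)

lemma tendsto_integral_mul_of_locL1 {φ : ℕ → Euc N → ℝ} (hφ : ∀ n, Continuous (φ n))
    (hu : LocallyIntegrable u)
    (h : ∀ K : Set (Euc N), IsCompact K →
      Tendsto (fun n => eLpNorm (φ n - u) 1 (volume.restrict K)) atTop (𝓝 0))
    {f : Euc N → ℝ} (hf : Continuous f) (hc : HasCompactSupport f) :
    Tendsto (fun n => ∫ x, f x * φ n x) atTop (𝓝 (∫ x, f x * u x)) := by
  obtain ⟨M, hM⟩ := hc.exists_bound_of_continuous hf
  refine tendsto_integral_of_L1' _ (hf.aestronglyMeasurable.mul hu.aestronglyMeasurable)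
    (.of_forall fun n => (hf.mul (hφ n)).integrable_of_hasCompactSupport hc.mul_right) ?_
  have h1 := ENNReal.Tendsto.const_mul (a := ENNReal.ofReal M) (h _ hc.isCompact)
    (Or.inr ENNReal.ofReal_ne_top)
  rw [mul_zero] at h1
  refine tendsto_of_tendsto_of_tendsto_of_le_of_le tendsto_const_nhds h1 (fun _ => zero_le)
    fun n => ?_
  rw [← eLpNorm_restrict_eq_of_support_subset (s := tsupport f)]
  · refine eLpNorm_le_mul_eLpNorm_of_ae_le_mul (.of_forall fun x => ?_) 1
    change ‖f x * φ n x - f x * u x‖ ≤ M * ‖φ n x - u x‖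
    rw [← mul_sub, norm_mul]
    exact mul_le_mul_of_nonneg_right (hM x) (norm_nonneg _)
  · intro x hx
    by_contra hxs
    exact hx (by simp [image_eq_zero_of_notMem_tsupport hxs])

/-- For the approximating test functions this is symmetry of the weighted Laplacian, η being
constant near the origin. The left side passes to the limit by L¹_loc convergence, as ζ(|x|) has
compact support, and the right side by L² convergence, as η(|x|) is in L². -/
lemma integral_mul_energyLimit [NeZero N] (hα : (4 - (N : ℝ)) / 2 < α) (hu : IsEnergyLimit α u w)
    (hζ : ContDiff ℝ ∞ ζ) (hc : HasCompactSupport ζ) (hs : tsupport ζ ⊆ Set.Ioi 0)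
    (hη : GreenTest N α ζ η) :
    ∫ x, ζ ‖x‖ * u x = -∫ x, w x * η ‖x‖ := by
  obtain ⟨hul, hw, φ, hφ, hφw, hφu⟩ := hu
  obtain ⟨C, hC0, hC⟩ := hη.decay
  obtain ⟨a, ha, hconst⟩ := hη.const
  have htest := isTestFun_radial (N := N) hζ hc hs
  have hmem := memLp_two_of_decay hα hη.smooth.continuousOn hC
  have h1 := tendsto_integral_mul_of_locL1 (fun n => (hφ n).1.1.continuous) hul hφu
    htest.1.continuous htest.2
  have h2 := tendsto_integral_mul_of_eLpNorm_two hmem hw (fun n => (hφ n).2) hφw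
  have h3 : ∀ n, ∫ x, ζ ‖x‖ * φ n x = -∫ x, η ‖x‖ * weightedLap α (φ n) x := by
    intro n
    rw [← weightedLap_symm_of_const (α := α) (c := η 0) (B := max C |η 0|)
      (η := fun x => η ‖x‖) (by linarith [(Nat.cast_nonneg N : (0 : ℝ) ≤ N)])
      (hφ n).1 (contDiff_comp_norm ha hη.smooth hconst), ← integral_neg]
    · refine integral_congr_ae ?_
      filter_upwards [ae_ne_zero] with x hx
      rw [hη.lap x hx]
      ring
    · filter_upwards [Metric.ball_mem_nhds (0 : Euc N) ha] with x hx
      exact hconst _ (norm_nonneg x) (by simpa using hx)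
    · intro x
      by_cases hx : x = 0
      · simp [hx]
      · refine (hC _ (norm_pos_iff.2 hx)).trans ((mul_le_of_le_one_right hC0 ?_).trans
          (le_max_left _ _))
        exact Real.rpow_le_one_of_one_le_of_nonpos (le_max_left _ _)
          (by linarith [(Nat.cast_nonneg N : (0 : ℝ) ≤ N)])
  simp only [h3] at h1
  rw [tendsto_nhds_unique h1 h2.neg]
  simp only [mul_comm]

lemma locallyIntegrable_of_rpow_bound [NeZero N] {F : Euc N → ℝ} (hm : AEStronglyMeasurable F)
    {C s : ℝ}
    (hs : -(N : ℝ) < s) (h : ∀ᵐ x, |F x| ≤ C * ‖x‖ ^ s) : LocallyIntegrable F := by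
  rw [locallyIntegrable_iff]
  intro K hK
  obtain ⟨R, hR⟩ := hK.isBounded.subset_ball 0
  refine IntegrableOn.mono_set ?_ hR
  exact ((integrableOn_norm_rpow_ball hs R).const_mul C).mono' hm.restrict (ae_restrict_of_ae h)

lemma aestronglyMeasurable_comp_norm [NeZero N] {h : ℝ → ℝ} (hs : ContinuousOn h (Set.Ioi 0)) :
    AEStronglyMeasurable (fun x : Euc N => h ‖x‖) := by
  have h1 : ContinuousOn (fun x : Euc N => h ‖x‖) {0}ᶜ :=
    hs.comp (t := Set.Ioi 0) continuous_norm.continuousOn fun x hx => norm_pos_iff.2 hx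
  have := h1.aestronglyMeasurable (μ := volume) (measurableSet_singleton _).compl
  rwa [Measure.restrict_eq_self_of_ae_mem] at this
  filter_upwards [ae_ne_zero] with x hx using hx

lemma continuousOn_greenOp_Ioi [NeZero N] {β : ℝ} (hβ : 0 ≤ β) {F : Euc N → ℝ}
    (hF : ∀ r > 0, Integrable (fun y => F y * max r ‖y‖ ^ (-β))) :
    ContinuousOn (greenOp β F) (Set.Ioi 0) := fun r hr =>
  (((continuousOn_greenOp hβ (hF (r / 2) (half_pos hr))) r
    (Set.mem_Ici.2 (half_le_self (le_of_lt (Set.mem_Ioi.1 hr))))).continuousAt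
    (Ici_mem_nhds (half_lt_self hr))).continuousWithinAt

/-- A radial function of the energy space is the Green potential of its weighted Laplacian. -/
lemma energyLimit_eq_greenOp [NeZero N] (hα : (4 - (N : ℝ)) / 2 < α) (hα2 : α < 2)
    (hu : IsEnergyLimit α u w)
    {g : ℝ → ℝ} (hg : u =ᵐ[volume] fun x => g ‖x‖) :
    u =ᵐ[volume] fun x => -greenOp (N - 2 + α) w ‖x‖ := by
  have hN : (0 : ℝ) < N := Nat.cast_pos.2 (Nat.pos_of_neZero N)
  have hβ : 0 < (N : ℝ) - 2 + α := by linarith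
  have hN2 : (N : ℝ) < 2 * (N - 2 + α) := by linarith
  have hint := fun r (hr : (0 : ℝ) < r) => integrable_mul_max_of_memLp hN2 hu.2.1 hr
  have hGm : AEStronglyMeasurable (fun x : Euc N => greenOp (N - 2 + α) w ‖x‖) :=
    aestronglyMeasurable_comp_norm (continuousOn_greenOp_Ioi hβ.le hint)
  have hGl : LocallyIntegrable (fun x : Euc N => greenOp (N - 2 + α) w ‖x‖) := by
    refine locallyIntegrable_of_rpow_bound hGm (s := N / 2 - (N - 2 + α)) (by linarith) ?_
      (C := greenConst N (N - 2 + α) *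
        (√(∫ y, w y ^ 2) * √(powerConst N 0 (2 * (N - 2 + α)))))
    filter_upwards [ae_ne_zero] with x hx
    exact abs_greenOp_le_of_memLp hβ.le hN2 hu.2.1 (norm_pos_iff.2 hx)
  have hgl : LocallyIntegrable (fun x : Euc N => g ‖x‖) := by
    refine fun x => ?_
    obtain ⟨s, hs, h⟩ := hu.1 x
    exact ⟨s, hs, h.congr (ae_restrict_of_ae hg)⟩
  have key : ∀ᵐ x : Euc N, g ‖x‖ + greenOp (N - 2 + α) w ‖x‖ = 0 := by
    refine ae_eq_zero_of_radial_tests (G := fun r => g r + greenOp (N - 2 + α) w r)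
      (hgl.add hGl) fun ζ hζ hc hs => ?_
    have htest := isTestFun_radial (N := N) hζ hc hs
    obtain ⟨a, b, M, ha, -, -, h1, -, -⟩ := exists_support_bounds hζ hc hs
    have e1 := integral_mul_energyLimit hα hu hζ hc hs (greenTest_greenOp hα hα2 hζ hc hs)
    -- Symmetry moves the Green operator from ζ onto w, so that u and -S w have the same integrals
    -- against ζ.
    rw [integral_mul_greenOp_comm (integrable_prod_of_support hβ.le ha (hint a ha)
      (htest.1.continuous.integrable_of_hasCompactSupport htest.2) fun y hy => h1 _ hy)] at e1
    have e2 : ∫ x, ζ ‖x‖ * u x = ∫ x : Euc N, ζ ‖x‖ * g ‖x‖ := by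
      refine integral_congr_ae ?_
      filter_upwards [hg] with x hx
      rw [hx]
    have i1 : Integrable (fun x : Euc N => ζ ‖x‖ * g ‖x‖) :=
      hgl.integrable_smul_left_of_hasCompactSupport htest.1.continuous htest.2
    have i2 : Integrable (fun x : Euc N => ζ ‖x‖ * greenOp (N - 2 + α) w ‖x‖) :=
      hGl.integrable_smul_left_of_hasCompactSupport htest.1.continuous htest.2
    rw [e2] at e1
    have e3 : ∀ x : Euc N, (g ‖x‖ + greenOp (N - 2 + α) w ‖x‖) * ζ ‖x‖
        = ζ ‖x‖ * g ‖x‖ + ζ ‖x‖ * greenOp (N - 2 + α) w ‖x‖ := fun x => by ring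
    simp only [e3]
    rw [integral_add i1 i2, e1]
    ring
  filter_upwards [hg, key] with x h1 h2
  rw [h1]
  linarith

end Duality

/-! ### The critical nonlinearity and its scaling. -/

section Nonlinearity

/-- The nonlinearity `t ↦ |t|^{p-2} t`, with `p` the critical exponent. -/
noncomputable def critFun (N : ℕ) (α t : ℝ) : ℝ := |t| ^ (critExp N α - 2) * t

variable {N : ℕ} {α : ℝ}

/-- In the form (p - 2)γ = 2σ this is criticality: a function of size r^(-γ) gives the coefficient
|u|^(p-2) the size r^(-2σ). -/
lemma critExp_sub_two (hα : (4 - (N : ℝ)) / 2 < α) :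
    critExp N α - 2 = (2 * (2 - α)) / ((N : ℝ) - 2 + α - N / 2) := by
  have h1 : (N : ℝ) - 4 + 2 * α ≠ 0 := by linarith
  have h2 : (N : ℝ) - 2 + α - N / 2 ≠ 0 := by intro h; apply h1; linarith
  rw [critExp]
  rw [div_sub' h1, div_eq_div_iff h1 h2]
  ring

lemma critExp_sub_two_pos (hα : (4 - (N : ℝ)) / 2 < α) (hα2 : α < 2) : 0 < critExp N α - 2 := by
  rw [critExp_sub_two hα]
  have h1 : 0 < (N : ℝ) - 2 + α - N / 2 := by linarith
  have h2 : 0 < 2 - α := by linarith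
  positivity

lemma abs_critFun (t : ℝ) : |critFun N α t| = |t| ^ (critExp N α - 2) * |t| := by
  rw [critFun, abs_mul, abs_of_nonneg (by positivity : 0 ≤ |t| ^ (critExp N α - 2))]

lemma measurable_critFun : Measurable (critFun N α) := by
  unfold critFun
  fun_prop

/-- With γ = N - 2 + α - N/2 and σ = 2 - α, the new exponent is (p - 1)γ = 2σ + γ = N/2 + σ. -/
lemma abs_critFun_le (hα : (4 - (N : ℝ)) / 2 < α) (hα2 : α < 2) {K r t : ℝ} (hr : 0 < r)
    (h : |t| ≤ K * r ^ ((N : ℝ) / 2 - (N - 2 + α))) :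
    |critFun N α t| ≤ (K ^ (critExp N α - 2) * K) * r ^ (-((N : ℝ) / 2 + (2 - α))) := by
  have hK : 0 ≤ K := by
    have := (abs_nonneg _).trans h
    exact nonneg_of_mul_nonneg_left this (by positivity)
  have hp := critExp_sub_two_pos hα hα2
  have h1 : (N : ℝ) - 2 + α - N / 2 ≠ 0 := by
    have : 0 < (N : ℝ) - 2 + α - N / 2 := by linarith
    exact this.ne'
  rw [abs_critFun]
  calc |t| ^ (critExp N α - 2) * |t|
      ≤ (K * r ^ ((N : ℝ) / 2 - (N - 2 + α))) ^ (critExp N α - 2)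
          * (K * r ^ ((N : ℝ) / 2 - (N - 2 + α))) := by gcongr
    _ = (K ^ (critExp N α - 2) * K) * (r ^ (((N : ℝ) / 2 - (N - 2 + α)) * (critExp N α - 2))
          * r ^ ((N : ℝ) / 2 - (N - 2 + α))) := by
        rw [Real.mul_rpow hK (by positivity), ← Real.rpow_mul hr.le]
        ring
    _ = _ := by
        rw [← Real.rpow_add hr, critExp_sub_two hα]
        congr 2
        have e : ((N : ℝ) / 2 - (N - 2 + α)) * (2 * (2 - α) / (N - 2 + α - N / 2))
            = -(2 * (2 - α)) := by
          rw [show (N : ℝ) / 2 - (N - 2 + α) = -(N - 2 + α - N / 2) by ring, neg_mul,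
            mul_div_cancel₀ _ h1]
        rw [e]
        ring

end Nonlinearity

/-! ### Weak solutions solve the double Green equation. -/

section Representation

variable {N : ℕ} {α : ℝ} {u w : Euc N → ℝ}

/-- Each application of the Green operator lowers the order of singularity s by N - β, provided N -
β < s < N. -/
lemma abs_greenOp_le_of_rpow [NeZero N] {β s K r : ℝ} (hβ : 0 ≤ β) (hs : s < N) (hsβ : N < s + β)
    {F : Euc N → ℝ} (h : ∀ᵐ y, |F y| ≤ K * ‖y‖ ^ (-s)) (hr : 0 < r) :
    |greenOp β F r| ≤ K * (greenConst N β * powerConst N s β) * r ^ (N - s - β) := by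
  refine (abs_greenOp_le hβ ?_ h).trans (le_of_eq ?_)
  · simpa only [mul_assoc] using (integrable_norm_rpow_mul_max hs hsβ hr).const_mul K
  · rw [greenOp_const_mul, greenOp_norm_rpow hr]
    ring

lemma integrable_mul_max_of_rpow [NeZero N] {β s K r : ℝ} (hs : s < N) (hsβ : N < s + β)
    {F : Euc N → ℝ} (hm : AEStronglyMeasurable F) (h : ∀ᵐ y, |F y| ≤ K * ‖y‖ ^ (-s))
    (hr : 0 < r) : Integrable (fun y => F y * max r ‖y‖ ^ (-β)) := by
  refine ((integrable_norm_rpow_mul_max (b := β) hs hsβ hr).const_mul K).mono'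
    (hm.mul (measurable_max_norm_rpow r β).aestronglyMeasurable) ?_
  filter_upwards [h] with y hy
  have h0 : 0 ≤ max r ‖y‖ ^ (-β) := Real.rpow_nonneg (le_max_of_le_left hr.le) _
  rw [norm_mul, Real.norm_of_nonneg h0, ← mul_assoc]
  exact mul_le_mul_of_nonneg_right hy h0

/-- The weak equation tested against the double Green potential of a radial test function. -/
lemma integral_mul_doubleGreen [NeZero N] (hα : (4 - (N : ℝ)) / 2 < α) (hα2 : α < 2)
    (hw : MemLp w 2)
    {F : Euc N → ℝ} {K : ℝ} (hFm : AEStronglyMeasurable F)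
    (hF : ∀ᵐ y, |F y| ≤ K * ‖y‖ ^ (-((N : ℝ) / 2 + (2 - α))))
    (heq : ∀ ψ : Euc N → ℝ, IsTestFun ψ → ∫ x, w x * weightedLap α ψ x = ∫ x, F x * ψ x)
    {η : ℝ → ℝ} (hη : ContinuousOn η (Set.Ioi 0)) (hηs : ContDiffOn ℝ ∞ η (Set.Ioi 0)) {C : ℝ}
    (hC0 : 0 ≤ C) (hC : ∀ r > 0, |η r| ≤ C * max 1 r ^ (-((N : ℝ) - 2 + α))) :
    -∫ x, w x * η ‖x‖ = ∫ x : Euc N, η ‖x‖ * greenOp (N - 2 + α) F ‖x‖ := by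
  have hN : (0 : ℝ) < N := Nat.cast_pos.2 (Nat.pos_of_neZero N)
  have hβ : 0 < (N : ℝ) - 2 + α := by linarith
  have hβN : (N : ℝ) - 2 + α < N := by linarith
  have hN2 : (N : ℝ) < 2 * (N - 2 + α) := by linarith
  have hηm := aestronglyMeasurable_comp_norm (N := N) hη
  have hηb : ∀ᵐ y : Euc N, |η ‖y‖| ≤ C * max 1 ‖y‖ ^ (-((N : ℝ) - 2 + α)) := by
    filter_upwards [ae_ne_zero] with y hy using hC _ (norm_pos_iff.2 hy)
  obtain ⟨hint0, A, hA⟩ := exists_greenOp_abs_bound hβ hβN hN2 hC0 hηm hηb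
  have hint := fun r (hr : (0 : ℝ) < r) => hint0 r hr.le
  have hQs := contDiffOn_fluxCoeff hint hηs
  obtain ⟨B, hB⟩ := abs_fluxCoeff_le (N := N) hβN hC hβ
  have hdiv := fun r (hr : (0 : ℝ) < r) => flux_divergence hint hη hr
  have conv : ∀ {D x r : ℝ}, 0 < r → 0 ≤ x → x ≤ D * max 1 r ^ (-((N : ℝ) - 2 + α)) →
      D ≤ max B C → x ≤ (max B C * 2 ^ ((N : ℝ) - 2 + α)) * (1 + r) ^ (-((N : ℝ) - 2 + α)) := by
    intro D x r hr hx0 hx hD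
    calc x ≤ D * max 1 r ^ (-((N : ℝ) - 2 + α)) := hx
      _ ≤ max B C * max 1 r ^ (-((N : ℝ) - 2 + α)) := by gcongr
      _ ≤ max B C * (2 ^ ((N : ℝ) - 2 + α) * (1 + r) ^ (-((N : ℝ) - 2 + α))) :=
        mul_le_mul_of_nonneg_left (max_rpow_le_one_add hr.le hβ.le) (le_max_of_le_right hC0)
      _ = _ := by ring
  have hQ1 : ∀ r > 0, |fluxCoeff N η r| ≤ (max B C * 2 ^ ((N : ℝ) - 2 + α))
      * (1 + r) ^ (-((N : ℝ) - 2 + α)) := fun r hr =>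
    conv hr (abs_nonneg _) (hB r hr) (le_max_left _ _)
  have hQ2 : ∀ r > 0, |N * fluxCoeff N η r + r * deriv (fluxCoeff N η) r|
      ≤ (max B C * 2 ^ ((N : ℝ) - 2 + α)) * (1 + r) ^ (-((N : ℝ) - 2 + α)) := fun r hr => by
    rw [hdiv r hr, abs_neg]
    exact conv hr (abs_nonneg _) (hC r hr) (le_max_right _ _)
  have hη2 := memLp_two_of_decay hα hη hC
  -- The potential S η need not have compact support, so the weak equation is tested with its
  -- truncated profiles, whose weighted Laplacians tend to -η in L².
  have lim1 := tendsto_integral_mul_of_eLpNorm_two hw (b := fun n =>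
      weightedLap α (fun y : Euc N => truncProfile α (fluxCoeff N η) n ‖y‖))
    (a := fun x => N * fluxCoeff N η ‖x‖ + ‖x‖ * deriv (fluxCoeff N η) ‖x‖) (by
      refine hη2.neg.ae_eq ?_
      filter_upwards [ae_ne_zero] with x hx
      exact (hdiv _ (norm_pos_iff.2 hx)).symm)
    (fun n => memLp_two_weightedLap hα (isTestFun_truncProfile hQs n))
    (tendsto_weightedLap_truncProfile hα hQs hQ1 hQ2)
  have e1 : ∫ x : Euc N, w x * (N * fluxCoeff N η ‖x‖ + ‖x‖ * deriv (fluxCoeff N η) ‖x‖)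
      = -∫ x, w x * η ‖x‖ := by
    rw [← integral_neg]
    refine integral_congr_ae ?_
    filter_upwards [ae_ne_zero] with x hx
    rw [hdiv _ (norm_pos_iff.2 hx)]
    ring
  obtain ⟨C', hC'⟩ := exists_truncProfile_bound hα hα2 hQ1
  have hC'0 : 0 ≤ C' := by
    have := (abs_nonneg _).trans (hC' 0 0 le_rfl)
    simpa using this
  have hK : ∀ x : Euc N, x ≠ 0 → |F x| ≤ K * ‖x‖ ^ (-((N : ℝ) / 2 + (2 - α))) → 0 ≤ K :=
    fun x hx h => nonneg_of_mul_nonneg_left ((abs_nonneg _).trans h)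
      (Real.rpow_pos_of_pos (norm_pos_iff.2 hx) _)
  -- Both exponent conditions reduce to 2 - α < N/2: one gives integrability of F times a bounded
  -- function at the origin, the other gives integrability at infinity thanks to the decay of S η.
  have hdom := integrable_norm_rpow_mul_max (N := N) (a := (N : ℝ) / 2 + (2 - α))
    (b := N - 4 + 2 * α) (by linarith) (by linarith) one_pos
  have lim2 : Tendsto (fun n => ∫ x : Euc N, F x * truncProfile α (fluxCoeff N η) n ‖x‖) atTop
      (𝓝 (∫ x, F x * greenOp (N - 2 + α) (fun y : Euc N => η ‖y‖) ‖x‖)) := by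
    refine tendsto_integral_of_dominated_convergence _ (fun n => hFm.mul
      (isTestFun_truncProfile hQs n).1.continuous.aestronglyMeasurable)
      (hdom.const_mul (K * C')) (fun n => ?_) ?_
    · filter_upwards [hF, ae_ne_zero] with x hx hx0
      have hK0 := hK x hx0 hx
      rw [norm_mul]
      calc _ ≤ (K * ‖x‖ ^ (-((N : ℝ) / 2 + (2 - α)))) * (C' * max 1 ‖x‖ ^ (-((N : ℝ) - 4 + 2 * α))) := by
            refine mul_le_mul hx ((hC' n _ (norm_nonneg x)).trans ?_) (norm_nonneg _) (by positivity)
            exact mul_le_mul_of_nonneg_left (one_add_rpow_le_max (norm_nonneg x) (by linarith)) hC'0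
        _ = _ := by ring
    · filter_upwards [ae_ne_zero] with x hx
      exact (tendsto_truncProfile hα hα2 hQs hQ1 (fun r hr => hasDerivAt_greenOp' hη hint rfl hβ hr)
        (tendsto_greenOp_atTop hβ (hint 1 one_pos)) (norm_pos_iff.2 hx)).const_mul _
  have e2 : ∀ n, ∫ x, w x * weightedLap α (fun y : Euc N => truncProfile α (fluxCoeff N η) n ‖y‖) x
      = ∫ x : Euc N, F x * truncProfile α (fluxCoeff N η) n ‖x‖ := fun n =>
    heq _ (isTestFun_truncProfile hQs n)
  simp only [e2] at lim1
  rw [← e1, tendsto_nhds_unique lim1 lim2]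
  refine integral_mul_greenOp_comm (integrable_prod_of_greenOp_abs hβ hFm hηm hint ?_)
  have hgm : AEStronglyMeasurable
      (fun x : Euc N => greenOp (N - 2 + α) (fun y : Euc N => |η ‖y‖|) ‖x‖) := by
    refine aestronglyMeasurable_comp_norm (continuousOn_greenOp_Ioi hβ.le fun r hr => ?_)
    refine (hint r hr).norm.congr (.of_forall fun y => ?_)
    have : 0 ≤ max r ‖y‖ ^ (-((N : ℝ) - 2 + α)) :=
      Real.rpow_nonneg (le_max_of_le_left (le_of_lt hr)) _
    simp only [norm_mul, Real.norm_of_nonneg this]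
    rfl
  refine (hdom.const_mul (K * A)).mono' (hFm.mul hgm) ?_
  filter_upwards [hF, ae_ne_zero] with x hx hx0
  have hK0 := hK x hx0 hx
  rw [norm_mul]
  calc _ ≤ (K * ‖x‖ ^ (-((N : ℝ) / 2 + (2 - α)))) * (A * max 1 ‖x‖ ^ (-((N : ℝ) - 4 + 2 * α))) := by
        refine mul_le_mul hx ((hA _ (norm_pos_iff.2 hx0)).trans (le_of_eq ?_)) (norm_nonneg _)
          (by positivity)
        congr 2
        ring
    _ = _ := by ring

/-- A radial weak solution is a double Green potential of its nonlinearity. -/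
lemma solution_eq_greenOp [NeZero N] (hα : (4 - (N : ℝ)) / 2 < α) (hα2 : α < 2)
    (hu : IsEnergyLimit α u w)
    (heq : ∀ ψ : Euc N → ℝ, IsTestFun ψ →
      ∫ x, w x * weightedLap α ψ x = ∫ x, critPower α u x * ψ x)
    {g : ℝ → ℝ} (hg : u =ᵐ[volume] fun x => g ‖x‖) {K : ℝ}
    (hF : ∀ᵐ y, |critPower α u y| ≤ K * ‖y‖ ^ (-((N : ℝ) / 2 + (2 - α)))) :
    u =ᵐ[volume] fun x => greenOp (N - 2 + α)
      (fun y : Euc N => greenOp (N - 2 + α) (critPower α u) ‖y‖) ‖x‖ := by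
  have hN : (0 : ℝ) < N := Nat.cast_pos.2 (Nat.pos_of_neZero N)
  have hβ : 0 < (N : ℝ) - 2 + α := by linarith
  have hFm : AEStronglyMeasurable (critPower α u) :=
    (measurable_critFun.comp_aemeasurable hu.1.aestronglyMeasurable.aemeasurable).aestronglyMeasurable
  set F := critPower α u with hFdef
  have hint1 := fun r (hr : (0 : ℝ) < r) => integrable_mul_max_of_rpow (β := (N : ℝ) - 2 + α)
    (by linarith) (by linarith) hFm hF hr
  have hVm : AEStronglyMeasurable (fun y : Euc N => greenOp (N - 2 + α) F ‖y‖) :=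
    aestronglyMeasurable_comp_norm (continuousOn_greenOp_Ioi hβ.le hint1)
  have hV : ∀ᵐ y : Euc N, |greenOp (N - 2 + α) F ‖y‖| ≤
      (K * (greenConst N (N - 2 + α) * powerConst N (N / 2 + (2 - α)) (N - 2 + α)))
        * ‖y‖ ^ (-((N : ℝ) / 2)) := by
    filter_upwards [ae_ne_zero] with y hy
    refine (abs_greenOp_le_of_rpow hβ.le (by linarith) (by linarith) hF
      (norm_pos_iff.2 hy)).trans (le_of_eq ?_)
    congr 2
    ring
  have hint2 := fun r (hr : (0 : ℝ) < r) => integrable_mul_max_of_rpow (β := (N : ℝ) - 2 + α)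
    (by linarith) (by linarith) hVm hV hr
  have hUm : AEStronglyMeasurable (fun x : Euc N => greenOp (N - 2 + α)
      (fun y : Euc N => greenOp (N - 2 + α) F ‖y‖) ‖x‖) :=
    aestronglyMeasurable_comp_norm (continuousOn_greenOp_Ioi hβ.le hint2)
  have hUl : LocallyIntegrable (fun x : Euc N => greenOp (N - 2 + α)
      (fun y : Euc N => greenOp (N - 2 + α) F ‖y‖) ‖x‖) := by
    refine locallyIntegrable_of_rpow_bound hUm (s := (N : ℝ) - N / 2 - (N - 2 + α)) (by linarith)
      (C := (K * (greenConst N (N - 2 + α) * powerConst N (N / 2 + (2 - α)) (N - 2 + α)))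
        * (greenConst N (N - 2 + α) * powerConst N (N / 2) (N - 2 + α))) ?_
    filter_upwards [ae_ne_zero] with y hy
    exact abs_greenOp_le_of_rpow hβ.le (by linarith) (by linarith) hV (norm_pos_iff.2 hy)
  have hgl : LocallyIntegrable (fun x : Euc N => g ‖x‖) := by
    refine fun x => ?_
    obtain ⟨s, hs, h⟩ := hu.1 x
    exact ⟨s, hs, h.congr (ae_restrict_of_ae hg)⟩
  have key : ∀ᵐ x : Euc N, g ‖x‖ - greenOp (N - 2 + α)
      (fun y : Euc N => greenOp (N - 2 + α) F ‖y‖) ‖x‖ = 0 := by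
    refine ae_eq_zero_of_radial_tests (G := fun r => g r - greenOp (N - 2 + α)
      (fun y : Euc N => greenOp (N - 2 + α) F ‖y‖) r) (hgl.sub hUl) fun ζ hζ hc hs => ?_
    have htest := isTestFun_radial (N := N) hζ hc hs
    obtain ⟨a, b, M, ha, -, -, h1, -, -⟩ := exists_support_bounds hζ hc hs
    have hη := greenTest_greenOp (N := N) hα hα2 hζ hc hs
    obtain ⟨C, hC0, hC⟩ := hη.decay
    have e1 := integral_mul_energyLimit hα hu hζ hc hs hη
    rw [integral_mul_doubleGreen hα hα2 hu.2.1 hFm hF heq hη.smooth.continuousOn hη.smooth hC0 hC]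
      at e1
    -- With η = S ζ and F the nonlinearity, the integral of ζ u equals that of η S F, and by
    -- symmetry that of ζ S S F.
    have e4 := integral_mul_greenOp_comm (integrable_prod_of_support hβ.le ha (hint2 a ha)
      (htest.1.continuous.integrable_of_hasCompactSupport htest.2) fun y hy => h1 _ hy)
    have e5 : ∫ x : Euc N, greenOp (N - 2 + α) (fun y : Euc N => ζ ‖y‖) ‖x‖
          * greenOp (N - 2 + α) F ‖x‖
        = ∫ x : Euc N, greenOp (N - 2 + α) F ‖x‖
          * greenOp (N - 2 + α) (fun y : Euc N => ζ ‖y‖) ‖x‖ := by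
      simp only [mul_comm]
    rw [e5, e4] at e1
    have e2 : ∫ x, ζ ‖x‖ * u x = ∫ x : Euc N, ζ ‖x‖ * g ‖x‖ := by
      refine integral_congr_ae ?_
      filter_upwards [hg] with x hx
      rw [hx]
    have i1 : Integrable (fun x : Euc N => ζ ‖x‖ * g ‖x‖) :=
      hgl.integrable_smul_left_of_hasCompactSupport htest.1.continuous htest.2
    have i2 : Integrable (fun x : Euc N => ζ ‖x‖ * greenOp (N - 2 + α)
        (fun y : Euc N => greenOp (N - 2 + α) F ‖y‖) ‖x‖) :=
      hUl.integrable_smul_left_of_hasCompactSupport htest.1.continuous htest.2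
    rw [e2] at e1
    have e3 : ∀ x : Euc N, (g ‖x‖ - greenOp (N - 2 + α)
          (fun y : Euc N => greenOp (N - 2 + α) F ‖y‖) ‖x‖) * ζ ‖x‖
        = ζ ‖x‖ * g ‖x‖ - ζ ‖x‖ * greenOp (N - 2 + α)
          (fun y : Euc N => greenOp (N - 2 + α) F ‖y‖) ‖x‖ := fun x => by ring
    simp only [e3]
    rw [integral_sub i1 i2, e1, sub_self]
  filter_upwards [hg, key] with x h1 h2
  rw [h1]
  linarith

end Representation

/-! ### Removing the singularity at the origin. -/

section Regularity

variable {N : ℕ} {β : ℝ}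

/-- The kernels with radius δ and radius 0 agree outside the ball of radius δ; inside it the assumed
power bound is integrable against |y|^(-β). -/
lemma integrable_mul_max_zero [NeZero N] {s K δ : ℝ} {F : Euc N → ℝ}
    (hF : Integrable (fun y => F y * max δ ‖y‖ ^ (-β)))
    (h : ∀ y, 0 < ‖y‖ → ‖y‖ < δ → |F y| ≤ K * ‖y‖ ^ (-s)) (hs : s + β < N) :
    Integrable (fun y => F y * max 0 ‖y‖ ^ (-β)) := by
  have hm := aestronglyMeasurable_of_mul_max hF
  have h1 : Integrable ((Metric.ball (0 : Euc N) δ).indicator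
      fun y => K * ‖y‖ ^ (-s - β)) :=
    IntegrableOn.integrable_indicator (Integrable.const_mul
      (integrableOn_norm_rpow_ball (s := -s - β) (by linarith) δ) K) measurableSet_ball
  refine (hF.norm.add h1).mono' (hm.mul (measurable_max_norm_rpow 0 β).aestronglyMeasurable) ?_
  filter_upwards [ae_ne_zero] with y hy
  have h0 : 0 < ‖y‖ := norm_pos_iff.2 hy
  simp only [Pi.add_apply, norm_mul, max_eq_right h0.le]
  rcases lt_or_ge ‖y‖ δ with hlt | hge
  · rw [Set.indicator_of_mem (by simpa using hlt), Real.norm_of_nonneg (by positivity : 0 ≤ ‖y‖ ^ (-β))]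
    have := mul_le_mul_of_nonneg_right (h y h0 hlt) (by positivity : 0 ≤ ‖y‖ ^ (-β))
    rw [mul_assoc, ← Real.rpow_add h0, ← sub_eq_add_neg] at this
    refine this.trans (le_add_of_nonneg_left (by positivity))
  · rw [max_eq_right hge, Set.indicator_of_notMem (by simpa using hge), add_zero]

lemma integrable_abs_mul_max {δ : ℝ} {F : Euc N → ℝ}
    (hF : Integrable (fun y => F y * max δ ‖y‖ ^ (-β))) :
    Integrable (fun y => |F y| * max δ ‖y‖ ^ (-β)) := by
  refine hF.norm.congr (.of_forall fun y => ?_)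
  have : 0 ≤ max δ ‖y‖ ^ (-β) := Real.rpow_nonneg (le_max_of_le_right (norm_nonneg y)) _
  simp only [norm_mul, Real.norm_of_nonneg this, Real.norm_eq_abs]

/-- A bound of `F` by powers near the origin passes to its Green potential, up to a constant. -/
lemma abs_greenOp_le_of_near [NeZero N] (hβ : 0 ≤ β) {s t a b δ r : ℝ} {F : Euc N → ℝ}
    (hs : s < N) (hsβ : N < s + β) (ht : t < N) (htβ : N < t + β) (ha : 0 ≤ a) (hb : 0 ≤ b)
    (hF : Integrable (fun y => F y * max δ ‖y‖ ^ (-β)))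
    (h : ∀ y, 0 < ‖y‖ → ‖y‖ < δ → |F y| ≤ a * ‖y‖ ^ (-s) + b * ‖y‖ ^ (-t)) (hr : 0 < r) :
    |greenOp β F r| ≤ a * (greenConst N β * powerConst N s β) * r ^ (N - s - β)
      + b * (greenConst N β * powerConst N t β) * r ^ (N - t - β)
      + greenOp β (fun y => |F y|) δ := by
  have i1 := (integrable_norm_rpow_mul_max hs hsβ hr).const_mul a
  have i2 := (integrable_norm_rpow_mul_max ht htβ hr).const_mul b
  have i3 := integrable_abs_mul_max hF
  have i123 := (i1.add i2).add i3
  have key : |∫ y, F y * max r ‖y‖ ^ (-β)| ≤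
      a * (r ^ (N - s - β) * powerConst N s β) + b * (r ^ (N - t - β) * powerConst N t β)
        + ∫ y, |F y| * max δ ‖y‖ ^ (-β) := by
    rw [← integral_norm_rpow_mul_max s β hr, ← integral_norm_rpow_mul_max t β hr,
      ← integral_const_mul, ← integral_const_mul, ← integral_add i1 i2]
    have e := integral_add (i1.add i2) i3
    simp only [Pi.add_apply] at e
    rw [← e, ← Real.norm_eq_abs]
    refine norm_integral_le_of_norm_le i123 ?_
    filter_upwards [ae_ne_zero] with y hy
    have h0 : 0 < ‖y‖ := norm_pos_iff.2 hy
    have hk : 0 ≤ max r ‖y‖ ^ (-β) := by positivity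
    have hk' : 0 ≤ max δ ‖y‖ ^ (-β) := Real.rpow_nonneg (le_max_of_le_right (norm_nonneg y)) _
    rw [norm_mul, Real.norm_of_nonneg hk, Real.norm_eq_abs]
    rcases lt_or_ge ‖y‖ δ with hlt | hge
    · have := mul_le_mul_of_nonneg_right (h y h0 hlt) hk
      rw [add_mul, mul_assoc, mul_assoc] at this
      exact this.trans (le_add_of_nonneg_right (by positivity))
    · have : max r ‖y‖ ^ (-β) ≤ max δ ‖y‖ ^ (-β) := by
        rw [max_eq_right hge]
        exact Real.rpow_le_rpow_of_nonpos h0 (le_max_right _ _) (by linarith)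
      have := mul_le_mul_of_nonneg_left this (abs_nonneg (F y))
      exact this.trans (le_add_of_nonneg_left (by positivity))
  unfold greenOp
  rw [abs_mul, abs_of_nonneg (greenConst_nonneg hβ)]
  refine (mul_le_mul_of_nonneg_left key (greenConst_nonneg hβ)).trans (le_of_eq ?_)
  ring

/-- A pair `(g, v)` of radial profiles that solves the system `g = S v`, `v = S (|g|^{p-2} g)` and
is regular at the origin. -/
structure IsRegularProfile (N : ℕ) (α : ℝ) (g v : ℝ → ℝ) : Prop where
  eq_left : ∀ r, g r = greenOp (N - 2 + α) (fun y : Euc N => v ‖y‖) r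
  eq_right : ∀ r, v r = greenOp (N - 2 + α) (fun y : Euc N => critFun N α (g ‖y‖)) r
  int_left : Integrable (fun y : Euc N => v ‖y‖ * max 0 ‖y‖ ^ (-((N : ℝ) - 2 + α)))
  int_right : Integrable
    (fun y : Euc N => critFun N α (g ‖y‖) * max 0 ‖y‖ ^ (-((N : ℝ) - 2 + α)))

variable {α : ℝ}

/-- A radial solution that is `o(r^{-γ})` at the origin is less singular than `r^{-γ}` there. -/
lemma exists_improved_bound [NeZero N] (hα : (4 - (N : ℝ)) / 2 < α) (hα2 : α < 2) {g v : ℝ → ℝ}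
    (hg : ∀ r, g r = greenOp (N - 2 + α) (fun y : Euc N => v ‖y‖) r)
    (hv : ∀ r, v r = greenOp (N - 2 + α) (fun y : Euc N => critFun N α (g ‖y‖)) r)
    (hF : ∀ r > 0, Integrable
      (fun y : Euc N => critFun N α (g ‖y‖) * max r ‖y‖ ^ (-((N : ℝ) - 2 + α))))
    (hV : ∀ r > 0, Integrable (fun y : Euc N => v ‖y‖ * max r ‖y‖ ^ (-((N : ℝ) - 2 + α))))
    {C : ℝ} (hC : ∀ r > 0, |g r| ≤ C * r ^ ((N : ℝ) / 2 - (N - 2 + α)))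
    (ho : ∀ ε > 0, ∃ δ > 0, ∀ r, 0 < r → r < δ → |g r| ≤ ε * r ^ ((N : ℝ) / 2 - (N - 2 + α)))
    {θ : ℝ} (hθ : 0 < θ) (hθγ : θ < (N : ℝ) - 2 + α - N / 2) :
    ∃ D, ∃ δ > 0, ∀ r, 0 < r → r < δ → |g r| ≤ D * r ^ (-θ) := by
  have hN : (0 : ℝ) < N := Nat.cast_pos.2 (Nat.pos_of_neZero N)
  have hp := critExp_sub_two_pos hα hα2
  have hpeq := critExp_sub_two hα
  obtain ⟨β, hβdef⟩ : ∃ β, β = (N : ℝ) - 2 + α := ⟨_, rfl⟩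
  obtain ⟨γ, hγdef⟩ : ∃ γ, γ = β - N / 2 := ⟨_, rfl⟩
  obtain ⟨σ, hσdef⟩ : ∃ σ, σ = 2 - α := ⟨_, rfl⟩
  have hσ : 0 < σ := by linarith
  have hγ : 0 < γ := by linarith
  have hβ : 0 < β := by linarith
  rw [show (N : ℝ) / 2 - (N - 2 + α) = -γ by linarith] at *
  simp only [← hβdef] at hg hv hF hV hpeq hθγ
  rw [← hγdef] at hpeq hθγ
  rw [← hσdef] at hpeq
  have hC0 : 0 ≤ C := by simpa using (abs_nonneg _).trans (hC 1 one_pos)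
  set k : ℝ → ℝ := fun s => greenConst N β * powerConst N s β with hk
  have hk0 : ∀ s, 0 ≤ k s := fun s => mul_nonneg (greenConst_nonneg hβ.le) (powerConst_nonneg _ _ _)
  -- The number m exceeds both products of constants that arise when the Green operator is applied
  -- twice, to the r^(-γ) part and to the r^(-θ) part; with e m = 1/2 each part is at least halved.
  obtain ⟨m, hm⟩ : ∃ m, m = k (2 * σ + γ) * k (σ + γ) + k (2 * σ + θ) * k (σ + θ) + 1 := ⟨_, rfl⟩
  have hm0 : 0 < m := by
    have := mul_nonneg (hk0 (2 * σ + γ)) (hk0 (σ + γ))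
    have := mul_nonneg (hk0 (2 * σ + θ)) (hk0 (σ + θ))
    linarith
  obtain ⟨e, he⟩ : ∃ e, e = 1 / (2 * m) := ⟨_, rfl⟩
  have he0 : 0 < e := by rw [he]; positivity
  have hem : e * m = 1 / 2 := by rw [he]; field_simp
  have he1 : e * k (2 * σ + γ) * k (σ + γ) ≤ 1 / 2 := by
    rw [← hem, mul_assoc]
    have := mul_nonneg (hk0 (2 * σ + θ)) (hk0 (σ + θ))
    exact mul_le_mul_of_nonneg_left (by linarith) he0.le
  have he2 : e * k (2 * σ + θ) * k (σ + θ) ≤ 1 / 2 := by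
    rw [← hem, mul_assoc]
    have := mul_nonneg (hk0 (2 * σ + γ)) (hk0 (σ + γ))
    exact mul_le_mul_of_nonneg_left (by linarith) he0.le
  -- The smallness is the (p - 2)-th root of e, so that |g|^(p-2) ≤ e r^(-2σ) for r < δ.
  obtain ⟨δ, hδ, hsmall⟩ := ho (e ^ (1 / (critExp N α - 2))) (by positivity)
  have hf : ∀ r, 0 < r → r < δ → |critFun N α (g r)| ≤ e * r ^ (-(2 * σ)) * |g r| := by
    intro r hr hrδ
    rw [abs_critFun]
    refine mul_le_mul_of_nonneg_right ?_ (abs_nonneg _)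
    calc |g r| ^ (critExp N α - 2) ≤ (e ^ (1 / (critExp N α - 2)) * r ^ (-γ)) ^ (critExp N α - 2) :=
          Real.rpow_le_rpow (abs_nonneg _) (hsmall r hr hrδ) hp.le
      _ = e * r ^ (-(2 * σ)) := by
          rw [Real.mul_rpow (by positivity) (by positivity), ← Real.rpow_mul he0.le,
            one_div_mul_cancel hp.ne', Real.rpow_one, ← Real.rpow_mul hr.le, hpeq, neg_mul,
            mul_div_cancel₀ _ hγ.ne']
  set B₁ := greenOp β (fun y : Euc N => |critFun N α (g ‖y‖)|) δ with hB₁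
  set B₂ := greenOp β (fun y : Euc N => |v ‖y‖|) δ with hB₂
  have hBnn : ∀ G : Euc N → ℝ, 0 ≤ greenOp β (fun y => |G y|) δ := fun G =>
    mul_nonneg (greenConst_nonneg hβ.le) (integral_nonneg fun y => mul_nonneg (abs_nonneg _)
      (Real.rpow_nonneg (le_max_of_le_right (norm_nonneg y)) _))
  have hB₁0 : 0 ≤ B₁ := hBnn _
  have hB₂0 : 0 ≤ B₂ := hBnn _
  -- D reproduces itself in the iteration: half of it absorbs the contribution of the r^(-θ) part,
  -- the other half that of the regions |y| ≥ δ, whose bounded potentials are dominated by multiples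
  -- of r^(-θ) for r < δ.
  obtain ⟨D, hD⟩ : ∃ D, D = 2 * (B₁ * δ ^ (σ + θ) * k (σ + θ) + B₂ * δ ^ θ) := ⟨_, rfl⟩
  have hD0 : 0 ≤ D := by
    rw [hD]
    have := hk0 (σ + θ)
    positivity
  have step : ∀ A, 0 ≤ A → (∀ r, 0 < r → r < δ → |g r| ≤ A * r ^ (-γ) + D * r ^ (-θ)) →
      ∀ r, 0 < r → r < δ → |g r| ≤ A / 2 * r ^ (-γ) + D * r ^ (-θ) := by
    intro A hA hgA
    have b1 : ∀ y : Euc N, 0 < ‖y‖ → ‖y‖ < δ → |critFun N α (g ‖y‖)|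
        ≤ (e * A) * ‖y‖ ^ (-(2 * σ + γ)) + (e * D) * ‖y‖ ^ (-(2 * σ + θ)) := by
      intro y h0 h1
      refine (hf _ h0 h1).trans ((mul_le_mul_of_nonneg_left (hgA _ h0 h1) (by positivity)).trans
        (le_of_eq ?_))
      rw [neg_add, neg_add, Real.rpow_add h0, Real.rpow_add h0]
      ring
    have b2 : ∀ r, 0 < r → |v r| ≤ (e * A) * k (2 * σ + γ) * r ^ (-(σ + γ))
        + (e * D) * k (2 * σ + θ) * r ^ (-(σ + θ)) + B₁ := by
      intro r hr
      have := abs_greenOp_le_of_near hβ.le (by linarith) (by linarith) (by linarith) (by linarith)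
        (by positivity) (by positivity) (hF δ hδ) b1 hr
      rw [← hv, show (N : ℝ) - (2 * σ + γ) - β = -(σ + γ) by linarith,
        show (N : ℝ) - (2 * σ + θ) - β = -(σ + θ) by linarith] at this
      exact this
    have b3 : ∀ y : Euc N, 0 < ‖y‖ → ‖y‖ < δ → |v ‖y‖| ≤ (e * A * k (2 * σ + γ)) *
        ‖y‖ ^ (-(σ + γ)) + (e * D * k (2 * σ + θ) + B₁ * δ ^ (σ + θ)) * ‖y‖ ^ (-(σ + θ)) := by
      intro y h0 h1
      have h2 : 1 ≤ δ ^ (σ + θ) * ‖y‖ ^ (-(σ + θ)) := by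
        rw [Real.rpow_neg h0.le, ← div_eq_mul_inv, ← Real.div_rpow hδ.le h0.le]
        exact Real.one_le_rpow ((one_le_div h0).2 h1.le) (by positivity)
      have h3 := mul_le_mul_of_nonneg_left h2 hB₁0
      have h4 := b2 _ h0
      linarith
    intro r hr hrδ
    have h1 := abs_greenOp_le_of_near hβ.le (s := σ + γ) (t := σ + θ) (by linarith) (by linarith)
      (by linarith) (by linarith) (mul_nonneg (mul_nonneg he0.le hA) (hk0 _))
      (add_nonneg (mul_nonneg (mul_nonneg he0.le hD0) (hk0 _)) (by positivity)) (hV δ hδ) b3 hr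
    rw [← hg, show (N : ℝ) - (σ + γ) - β = -γ by linarith,
      show (N : ℝ) - (σ + θ) - β = -θ by linarith] at h1
    have h2 : 1 ≤ δ ^ θ * r ^ (-θ) := by
      rw [Real.rpow_neg hr.le, ← div_eq_mul_inv, ← Real.div_rpow hδ.le hr.le]
      exact Real.one_le_rpow ((one_le_div hr).2 hrδ.le) hθ.le
    have h3 := mul_le_mul_of_nonneg_left h2 hB₂0
    have h4 : e * A * k (2 * σ + γ) * k (σ + γ) ≤ A / 2 := by
      have := mul_le_mul_of_nonneg_left he1 hA
      linarith
    have h5 : (e * D * k (2 * σ + θ) + B₁ * δ ^ (σ + θ)) * k (σ + θ) + B₂ * δ ^ θ ≤ D := by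
      have := mul_le_mul_of_nonneg_left he2 hD0
      rw [add_mul]
      linarith
    have h6 := mul_le_mul_of_nonneg_right h4 (by positivity : 0 ≤ r ^ (-γ))
    have h7 := mul_le_mul_of_nonneg_right h5 (by positivity : 0 ≤ r ^ (-θ))
    refine h1.trans ?_
    change e * A * k (2 * σ + γ) * k (σ + γ) * r ^ (-γ)
      + (e * D * k (2 * σ + θ) + B₁ * δ ^ (σ + θ)) * k (σ + θ) * r ^ (-θ) + B₂ ≤ _
    linarith
  have hall : ∀ n : ℕ, ∀ r, 0 < r → r < δ → |g r| ≤ C / 2 ^ n * r ^ (-γ) + D * r ^ (-θ) := by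
    intro n
    induction n with
    | zero =>
      intro r hr _
      have := hC r hr
      simp only [pow_zero, div_one]
      have : 0 ≤ D * r ^ (-θ) := by positivity
      linarith
    | succ n ih =>
      have := step _ (by positivity) ih
      simpa only [pow_succ, div_div] using this
  refine ⟨D, δ, hδ, fun r hr hrδ => ?_⟩
  have lim : Tendsto (fun n : ℕ => C / 2 ^ n * r ^ (-γ) + D * r ^ (-θ)) atTop
      (𝓝 (0 * r ^ (-γ) + D * r ^ (-θ))) := by
    refine (Tendsto.mul_const _ ?_).add_const _
    exact tendsto_const_nhds.div_atTop (tendsto_pow_atTop_atTop_of_one_lt one_lt_two)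
  rw [zero_mul, zero_add] at lim
  exact ge_of_tendsto' lim fun n => hall n r hr hrδ

/-- Regularity at the origin of radial solutions of the integral system. -/
lemma isRegularProfile_of_isLittleO [NeZero N] (hα : (4 - (N : ℝ)) / 2 < α) (hα2 : α < 2)
    {g v : ℝ → ℝ}
    (hg : ∀ r, g r = greenOp (N - 2 + α) (fun y : Euc N => v ‖y‖) r)
    (hv : ∀ r, v r = greenOp (N - 2 + α) (fun y : Euc N => critFun N α (g ‖y‖)) r)
    (hF : ∀ r > 0, Integrable
      (fun y : Euc N => critFun N α (g ‖y‖) * max r ‖y‖ ^ (-((N : ℝ) - 2 + α))))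
    (hV : ∀ r > 0, Integrable (fun y : Euc N => v ‖y‖ * max r ‖y‖ ^ (-((N : ℝ) - 2 + α))))
    {C : ℝ} (hC : ∀ r > 0, |g r| ≤ C * r ^ ((N : ℝ) / 2 - (N - 2 + α)))
    (ho : ∀ ε > 0, ∃ δ > 0, ∀ r, 0 < r → r < δ → |g r| ≤ ε * r ^ ((N : ℝ) / 2 - (N - 2 + α))) :
    IsRegularProfile N α g v := by
  have hp := critExp_sub_two_pos hα hα2
  have hγ : 0 < (N : ℝ) - 2 + α - N / 2 := by linarith
  have hσ : 0 < 2 - α := by linarith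
  -- The last condition is (p - 1)θ + (N - 2 + α) < N, which makes the nonlinearity integrable
  -- against |y|^(-(N-2+α)) at the origin.
  obtain ⟨θ, hθ, hθγ, hθσ⟩ : ∃ θ, 0 < θ ∧ θ < (N : ℝ) - 2 + α - N / 2
      ∧ θ * (critExp N α - 1) < 2 - α := by
    refine ⟨min (((N : ℝ) - 2 + α - N / 2) / 2) ((2 - α) / (2 * (critExp N α - 1))),
      lt_min (by positivity) (div_pos hσ (by linarith)),
      (min_le_left _ _).trans_lt (by linarith), ?_⟩
    have h1 : 0 < critExp N α - 1 := by linarith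
    calc _ ≤ (2 - α) / (2 * (critExp N α - 1)) * (critExp N α - 1) :=
          mul_le_mul_of_nonneg_right (min_le_right _ _) h1.le
      _ = (2 - α) / 2 := by field_simp
      _ < 2 - α := by linarith
  obtain ⟨D, δ, hδ, hD⟩ := exists_improved_bound hα hα2 hg hv hF hV hC ho hθ hθγ
  have hint : Integrable
      (fun y : Euc N => critFun N α (g ‖y‖) * max 0 ‖y‖ ^ (-((N : ℝ) - 2 + α))) := by
    refine integrable_mul_max_zero (K := D ^ (critExp N α - 2) * D)
      (s := θ * (critExp N α - 1)) (hF δ hδ) (fun y h0 h1 => ?_) (by linarith)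
    have h2 := hD _ h0 h1
    have hD0 : 0 ≤ D := nonneg_of_mul_nonneg_left ((abs_nonneg _).trans h2) (by positivity)
    rw [abs_critFun]
    calc _ ≤ (D * ‖y‖ ^ (-θ)) ^ (critExp N α - 2) * (D * ‖y‖ ^ (-θ)) := by gcongr
      _ = (D ^ (critExp N α - 2) * D) * (‖y‖ ^ (-θ * (critExp N α - 2)) * ‖y‖ ^ (-θ)) := by
          rw [Real.mul_rpow hD0 (by positivity), ← Real.rpow_mul h0.le]
          ring
      _ = _ := by
          rw [← Real.rpow_add h0]
          congr 2
          ring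
  have hβ : 0 ≤ (N : ℝ) - 2 + α := by
    have : (0 : ℝ) ≤ N := Nat.cast_nonneg N
    linarith
  -- Once the nonlinearity has a finite potential at 0, v is bounded, and a bounded function is
  -- integrable against |y|^(-β) near 0 because β < N.
  refine ⟨hg, hv, integrable_mul_max_zero (s := 0)
    (K := greenOp (N - 2 + α) (fun y : Euc N => |critFun N α (g ‖y‖)|) 0) (hV δ hδ)
    (fun y h0 _ => ?_) (by linarith), hint⟩
  simp only [neg_zero, Real.rpow_zero, mul_one]
  rw [hv]
  unfold greenOp
  rw [abs_mul, abs_of_nonneg (greenConst_nonneg hβ)]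
  refine mul_le_mul_of_nonneg_left ?_ (greenConst_nonneg hβ)
  rw [← Real.norm_eq_abs]
  refine norm_integral_le_of_norm_le (integrable_abs_mul_max hint) ?_
  filter_upwards [greenOp_bound_aux hβ h0.le (F := fun y : Euc N => critFun N α (g ‖y‖))]
    with z hz
  refine hz.trans (le_of_eq ?_)
  rw [norm_mul, Real.norm_of_nonneg (Real.rpow_nonneg (le_max_left _ _) _), Real.norm_eq_abs]

end Regularity

/-! ### Monotonicity and local Lipschitz bounds of the nonlinearity. -/

section Nonlinearity

variable {N : ℕ} {α : ℝ}

lemma critFun_neg (t : ℝ) : critFun N α (-t) = -critFun N α t := by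
  simp [critFun]

lemma critFun_zero : critFun N α 0 = 0 := by simp [critFun]

lemma critFun_monotone (hα : (4 - (N : ℝ)) / 2 < α) (hα2 : α < 2) : Monotone (critFun N α) := by
  have hp := critExp_sub_two_pos hα hα2
  refine monotone_of_odd_of_monotoneOn_nonneg critFun_neg fun a ha b hb hab => ?_
  have ha : 0 ≤ a := ha
  have hb : 0 ≤ b := hb
  simp only [critFun, abs_of_nonneg ha, abs_of_nonneg hb]
  gcongr

/-- Bernoulli's inequality at a/b: the power t^(p-1) is convex and lies above its tangent at b. -/
lemma critFun_sub_le (hα : (4 - (N : ℝ)) / 2 < α) (hα2 : α < 2) {a b M : ℝ} (ha : 0 ≤ a)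
    (hab : a ≤ b) (hM : b ≤ M) :
    critFun N α b - critFun N α a ≤ (critExp N α - 1) * M ^ (critExp N α - 2) * (b - a) := by
  have hp := critExp_sub_two_pos hα hα2
  have hb : 0 ≤ b := ha.trans hab
  rcases hb.eq_or_lt with h | hb
  · have : a = 0 := by linarith
    simp [this, ← h]
  have e : ∀ t : ℝ, 0 ≤ t → critFun N α t = t ^ (critExp N α - 1) := fun t ht => by
    rw [critFun, abs_of_nonneg ht, show critExp N α - 1 = critExp N α - 2 + 1 by ring,
      Real.rpow_add_one' ht (by linarith)]
  have h1 := one_add_mul_self_le_rpow_one_add (s := a / b - 1) (p := critExp N α - 1)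
    (by have : 0 ≤ a / b := by positivity
        linarith) (by linarith)
  rw [show 1 + (a / b - 1) = a / b by ring, Real.div_rpow ha hb.le] at h1
  have h2 := mul_le_mul_of_nonneg_right h1 (by positivity : 0 ≤ b ^ (critExp N α - 1))
  rw [div_mul_cancel₀ _ (by positivity)] at h2
  have h3 : b ^ (critExp N α - 1) = b ^ (critExp N α - 2) * b := by
    rw [show critExp N α - 1 = critExp N α - 2 + 1 by ring, Real.rpow_add_one hb.ne']
  have h4 : (1 + (critExp N α - 1) * (a / b - 1)) * b ^ (critExp N α - 1)
      = b ^ (critExp N α - 1) + (critExp N α - 1) * b ^ (critExp N α - 2) * (a - b) := by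
    rw [h3]
    field_simp
  rw [h4] at h2
  rw [e a ha, e b hb.le]
  have h5 : b ^ (critExp N α - 2) ≤ M ^ (critExp N α - 2) := by gcongr
  have h6 : (critExp N α - 1) * b ^ (critExp N α - 2) * (b - a)
      ≤ (critExp N α - 1) * M ^ (critExp N α - 2) * (b - a) := by
    have : 0 ≤ critExp N α - 1 := by linarith
    have : 0 ≤ b - a := by linarith
    gcongr
  linarith

lemma abs_critFun_sub_le (hα : (4 - (N : ℝ)) / 2 < α) (hα2 : α < 2) {a b M : ℝ} (ha : |a| ≤ M)
    (hb : |b| ≤ M) :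
    |critFun N α a - critFun N α b| ≤ (critExp N α - 1) * M ^ (critExp N α - 2) * |a - b| := by
  wlog hab : b ≤ a generalizing a b
  · rw [abs_sub_comm, abs_sub_comm a]
    exact this hb ha (le_of_not_ge hab)
  have hm := critFun_monotone hα hα2
  rw [abs_of_nonneg (sub_nonneg.2 (hm hab)), abs_of_nonneg (sub_nonneg.2 hab)]
  rw [abs_le] at ha hb
  rcases le_total 0 b with h0 | h0
  · exact critFun_sub_le hα hα2 h0 hab ha.2
  rcases le_total a 0 with h1 | h1
  · have := critFun_sub_le hα hα2 (neg_nonneg.2 h1) (neg_le_neg hab) (show -b ≤ M by linarith)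
    rw [critFun_neg, critFun_neg] at this
    linarith
  -- For opposite signs, compare each value with the common value 0 at the origin and add.
  · have h2 := critFun_sub_le hα hα2 le_rfl h1 ha.2
    have h3 := critFun_sub_le hα hα2 le_rfl (neg_nonneg.2 h0) (show -b ≤ M by linarith)
    rw [critFun_zero] at h2 h3
    rw [critFun_neg] at h3
    linarith

end Nonlinearity

/-! ### Comparing a Green potential with its value at the origin. -/

section Comparison

variable {N : ℕ} {α β : ℝ}

/-- The kernels at r and at 0 coincide for |y| ≥ r, so only the sign of F inside the ball matters.
This locality lets the comparison be continued outward from the origin. -/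
lemma greenOp_le_zero_of_nonneg [NeZero N] (hβ : 0 ≤ β) {F : Euc N → ℝ}
    (hF : Integrable (fun y => F y * max 0 ‖y‖ ^ (-β))) {r : ℝ} (hr : 0 ≤ r)
    (h : ∀ y, 0 < ‖y‖ → ‖y‖ < r → 0 ≤ F y) : greenOp β F r ≤ greenOp β F 0 := by
  refine mul_le_mul_of_nonneg_left ?_ (greenConst_nonneg hβ)
  refine integral_mono_ae (integrable_mul_max_mono hβ hF hr) hF ?_
  filter_upwards [ae_ne_zero] with y hy
  have h0 : 0 < ‖y‖ := norm_pos_iff.2 hy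
  rcases lt_or_ge ‖y‖ r with hlt | hge
  · exact mul_le_mul_of_nonneg_left (max_rpow_neg_le hβ hr (lt_max_of_lt_right h0)) (h y h0 hlt)
  · simp only [max_eq_right hge, max_eq_right h0.le, le_refl]

lemma greenOp_sub {F G : Euc N → ℝ} {r : ℝ} (hF : Integrable (fun y => F y * max r ‖y‖ ^ (-β)))
    (hG : Integrable (fun y => G y * max r ‖y‖ ^ (-β))) :
    greenOp β (fun y => F y - G y) r = greenOp β F r - greenOp β G r := by
  simp only [greenOp, sub_mul]
  rw [integral_sub hF hG, mul_sub]

/-- The Green potential of `exp (Λ |y|^σ)` restricted to a ball, at the origin. -/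
lemma integral_exp_ball [NeZero N] (hβ : 0 < β) (hβN : β < N) {Λ r : ℝ} (hΛ : 0 < Λ) (hr : 0 ≤ r) :
    Integrable (fun y : Euc N => (Set.Iio r).indicator (fun t => Real.exp (Λ * t ^ (N - β))) ‖y‖
      * max 0 ‖y‖ ^ (-β)) ∧
    greenOp β (fun y : Euc N =>
      (Set.Iio r).indicator (fun t => Real.exp (Λ * t ^ (N - β))) ‖y‖) 0
      ≤ (β * ((N - β) * Λ))⁻¹ * Real.exp (Λ * r ^ (N - β)) := by
  have hσ : 0 < (N : ℝ) - β := by linarith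
  set m : ℝ → ℝ := fun t => Real.exp (Λ * t ^ (N - β)) with hm
  have hd : ∀ t, 0 < t → HasDerivAt (fun t => m t / ((N - β) * Λ)) (t ^ ((N : ℝ) - β - 1) * m t) t := by
    intro t ht
    have h1 := (((Real.hasDerivAt_rpow_const (p := (N : ℝ) - β) (Or.inl ht.ne')).const_mul
      Λ).exp).div_const ((N - β) * Λ)
    refine h1.congr_deriv ?_
    have := hσ.ne'
    change _ = t ^ ((N : ℝ) - β - 1) * Real.exp (Λ * t ^ ((N : ℝ) - β))
    rw [div_eq_iff (mul_pos hσ hΛ).ne']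
    ring
  have hc : Continuous fun t => m t := by
    simp only [hm]
    exact Real.continuous_exp.comp (continuous_const.mul (Real.continuous_rpow_const hσ.le))
  have hi : IntervalIntegrable (fun t => t ^ ((N : ℝ) - β - 1) * m t) volume 0 r :=
    (intervalIntegral.intervalIntegrable_rpow' (by linarith)).mul_continuousOn hc.continuousOn
  have hFTC := intervalIntegral.integral_eq_sub_of_hasDerivAt_of_le hr
    (hc.div_const ((N - β) * Λ)).continuousOn (fun t ht => hd t ht.1) hi
  have hset : (Set.Ioo 0 r : Set ℝ) = Set.Iio r ∩ Set.Ioi 0 := by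
    ext; simp [and_comm]
  have hpow : ∀ t, 0 < t → t ^ (N - 1) * (m t * max 0 t ^ (-β)) = t ^ ((N : ℝ) - β - 1) * m t := by
    intro t ht
    have hN : 1 ≤ N := Nat.pos_of_neZero N
    rw [max_eq_right ht.le, ← Real.rpow_natCast, mul_comm (m t), ← mul_assoc, ← Real.rpow_add ht,
      Nat.cast_sub hN]
    congr 2
    push_cast
    ring
  have hind : Set.EqOn (fun t => t ^ (N - 1) * ((Set.Iio r).indicator m t * max 0 t ^ (-β)))
      ((Set.Iio r).indicator fun t => t ^ ((N : ℝ) - β - 1) * m t) (Set.Ioi 0) := by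
    intro t ht
    by_cases h : t ∈ Set.Iio r
    · simp only [Set.indicator_of_mem h]
      exact hpow t ht
    · simp only [Set.indicator_of_notMem h, zero_mul, mul_zero]
  have hon : IntegrableOn (fun t => t ^ ((N : ℝ) - β - 1) * m t) (Set.Ioo 0 r) :=
    ((intervalIntegrable_iff_integrableOn_Ioc_of_le hr).1 hi).mono_set Set.Ioo_subset_Ioc_self
  constructor
  · rw [integrable_radial_iff (f := fun t => (Set.Iio r).indicator m t * max 0 t ^ (-β))]
    refine IntegrableOn.congr_fun ?_ hind.symm measurableSet_Ioi
    rw [IntegrableOn, integrable_indicator_iff measurableSet_Iio, IntegrableOn,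
      Measure.restrict_restrict measurableSet_Iio, ← hset]
    exact hon
  · rw [greenOp_radial hβ, setIntegral_congr_fun measurableSet_Ioi hind,
      integral_indicator measurableSet_Iio, Measure.restrict_restrict measurableSet_Iio, ← hset,
      ← integral_Ioc_eq_integral_Ioo, ← intervalIntegral.integral_of_le hr, hFTC, mul_inv,
      mul_assoc]
    refine mul_le_mul_of_nonneg_left ?_ (by positivity)
    rw [div_eq_inv_mul, div_eq_inv_mul]
    have : 0 ≤ ((N - β) * Λ)⁻¹ * m 0 := by positivity
    linarith

/-- The exponential weight yields the factor 1/Λ, which can be made as small as desired; this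
replaces a Gronwall lemma for the singular kernel. -/
lemma abs_greenOp_sub_le [NeZero N] (hβ : 0 < β) (hβN : β < N) {F : Euc N → ℝ}
    (hF : Integrable (fun y => F y * max 0 ‖y‖ ^ (-β))) {M Λ r : ℝ} (hΛ : 0 < Λ) (hr : 0 ≤ r)
    (h : ∀ y, 0 < ‖y‖ → ‖y‖ < r → |F y| ≤ M * Real.exp (Λ * ‖y‖ ^ (N - β))) (hM : 0 ≤ M) :
    |greenOp β F r - greenOp β F 0|
      ≤ M * ((β * ((N - β) * Λ))⁻¹ * Real.exp (Λ * r ^ (N - β))) := by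
  obtain ⟨h1, h2⟩ := integral_exp_ball (N := N) hβ hβN hΛ hr
  refine le_trans ?_ (mul_le_mul_of_nonneg_left h2 hM)
  unfold greenOp
  rw [← mul_sub, abs_mul, abs_of_nonneg (greenConst_nonneg hβ.le), mul_left_comm,
    ← integral_const_mul, ← integral_sub (integrable_mul_max_mono hβ.le hF hr) hF,
    ← Real.norm_eq_abs]
  refine mul_le_mul_of_nonneg_left ?_ (greenConst_nonneg hβ.le)
  refine norm_integral_le_of_norm_le (h1.const_mul M) ?_
  filter_upwards [ae_ne_zero] with y hy
  have h0 : 0 < ‖y‖ := norm_pos_iff.2 hy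
  rcases lt_or_ge ‖y‖ r with hlt | hge
  · have h3 : 0 ≤ max r ‖y‖ ^ (-β) := Real.rpow_nonneg (le_max_of_le_left hr) _
    have h4 := max_rpow_neg_le hβ.le hr (lt_max_of_lt_right h0 : (0 : ℝ) < max 0 ‖y‖)
    rw [Set.indicator_of_mem (Set.mem_Iio.2 hlt), ← mul_sub, norm_mul, Real.norm_eq_abs,
      Real.norm_eq_abs, ← mul_assoc]
    refine mul_le_mul (h y h0 hlt) ?_ (abs_nonneg _) (by positivity)
    rw [abs_le]
    constructor <;> linarith
  · rw [Set.indicator_of_notMem (by simpa using hge), max_eq_right hge, max_eq_right h0.le]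
    simp

end Comparison

/-! ### Uniqueness of regular profiles with given value at the origin. -/

namespace IsRegularProfile

variable {N : ℕ} {α : ℝ} {g v G V : ℝ → ℝ}

lemma exponent_pos (hα : (4 - (N : ℝ)) / 2 < α) (hα2 : α < 2) : 0 < (N : ℝ) - 2 + α := by
  have : (0 : ℝ) ≤ N := Nat.cast_nonneg N
  linarith

lemma continuousOn_left [NeZero N] (hα : (4 - (N : ℝ)) / 2 < α) (hα2 : α < 2)
    (P : IsRegularProfile N α g v) :
    ContinuousOn g (Set.Ici 0) := by
  rw [funext P.eq_left]
  exact continuousOn_greenOp (exponent_pos hα hα2).le P.int_left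

lemma continuousOn_right [NeZero N] (hα : (4 - (N : ℝ)) / 2 < α) (hα2 : α < 2)
    (P : IsRegularProfile N α g v) : ContinuousOn v (Set.Ici 0) := by
  rw [funext P.eq_right]
  exact continuousOn_greenOp (exponent_pos hα hα2).le P.int_right

lemma tendsto_right [NeZero N] (hα : (4 - (N : ℝ)) / 2 < α) (hα2 : α < 2)
    (P : IsRegularProfile N α g v) :
    Tendsto v atTop (𝓝 0) := by
  rw [funext P.eq_right]
  exact tendsto_greenOp_atTop (exponent_pos hα hα2) P.int_right

lemma greenOp_sub_left [NeZero N] (hα : (4 - (N : ℝ)) / 2 < α) (hα2 : α < 2)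
    (P : IsRegularProfile N α g v)
    (Q : IsRegularProfile N α G V) {r : ℝ} (hr : 0 ≤ r) :
    greenOp (N - 2 + α) (fun y : Euc N => v ‖y‖ - V ‖y‖) r = g r - G r := by
  have hβ := (exponent_pos hα hα2).le
  rw [greenOp_sub (integrable_mul_max_mono hβ P.int_left hr)
    (integrable_mul_max_mono hβ Q.int_left hr), ← P.eq_left, ← Q.eq_left]

lemma greenOp_sub_right [NeZero N] (hα : (4 - (N : ℝ)) / 2 < α) (hα2 : α < 2)
    (P : IsRegularProfile N α g v)
    (Q : IsRegularProfile N α G V) {r : ℝ} (hr : 0 ≤ r) :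
    greenOp (N - 2 + α) (fun y : Euc N => critFun N α (g ‖y‖) - critFun N α (G ‖y‖)) r
      = v r - V r := by
  have hβ := (exponent_pos hα hα2).le
  rw [greenOp_sub (integrable_mul_max_mono hβ P.int_right hr)
    (integrable_mul_max_mono hβ Q.int_right hr), ← P.eq_right, ← Q.eq_right]

lemma integrable_sub_left (P : IsRegularProfile N α g v) (Q : IsRegularProfile N α G V) :
    Integrable (fun y : Euc N => (v ‖y‖ - V ‖y‖) * max 0 ‖y‖ ^ (-((N : ℝ) - 2 + α))) := by
  simp only [sub_mul]
  exact P.int_left.sub Q.int_left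

lemma integrable_sub_right (P : IsRegularProfile N α g v) (Q : IsRegularProfile N α G V) :
    Integrable (fun y : Euc N => (critFun N α (g ‖y‖) - critFun N α (G ‖y‖))
      * max 0 ‖y‖ ^ (-((N : ℝ) - 2 + α))) := by
  simp only [sub_mul]
  exact P.int_right.sub Q.int_right

/-- As long as `v ≤ V`, the difference `v - V` stays below its value at the origin. -/
lemma sub_le_sub_zero [NeZero N] (hα : (4 - (N : ℝ)) / 2 < α) (hα2 : α < 2)
    (P : IsRegularProfile N α g v)
    (Q : IsRegularProfile N α G V) (h0 : g 0 = G 0) {r : ℝ} (hr : 0 ≤ r)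
    (h : ∀ s, 0 ≤ s → s < r → v s ≤ V s) : v r - V r ≤ v 0 - V 0 := by
  have hβ := (exponent_pos hα hα2).le
  have h1 : ∀ s, 0 ≤ s → s ≤ r → G s ≤ g s := by
    intro s hs hsr
    have := greenOp_le_zero_of_nonneg hβ (Q.integrable_sub_left P) hs fun y _ hy =>
      sub_nonneg.2 (h _ (norm_nonneg y) (hy.trans_le hsr))
    rw [greenOp_sub_left hα hα2 Q P hs, greenOp_sub_left hα hα2 Q P le_rfl] at this
    linarith
  have := greenOp_le_zero_of_nonneg hβ (P.integrable_sub_right Q) hr fun y _ hy =>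
    sub_nonneg.2 (critFun_monotone hα hα2 (h1 _ (norm_nonneg y) hy.le))
  rwa [greenOp_sub_right hα hα2 P Q hr, greenOp_sub_right hα hα2 P Q le_rfl] at this

/-- While v ≤ V, the difference v - V stays below v(0) - V(0) < 0, so there is no first radius at
which v catches up with V. The gap then persists to infinity, where both functions vanish. -/
lemma not_lt_right_zero [NeZero N] (hα : (4 - (N : ℝ)) / 2 < α) (hα2 : α < 2)
    (P : IsRegularProfile N α g v)
    (Q : IsRegularProfile N α G V) (h0 : g 0 = G 0) : ¬ v 0 < V 0 := by
  intro hlt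
  have hneg : ∀ r, 0 ≤ r → v r < V r := by
    by_contra! hcon
    obtain ⟨r₁, hr₁, hr₁'⟩ := hcon
    have hc : ContinuousOn (fun r => v r - V r) (Set.Icc 0 r₁) :=
      ((P.continuousOn_right hα hα2).sub (Q.continuousOn_right hα hα2)).mono fun x hx => hx.1
    have hK : IsCompact (Set.Icc 0 r₁ ∩ (fun r => v r - V r) ⁻¹' Set.Ici 0) :=
      isCompact_Icc.of_isClosed_subset (hc.preimage_isClosed_of_isClosed isClosed_Icc isClosed_Ici)
        Set.inter_subset_left
    obtain ⟨r₀, ⟨hr₀, hr₀'⟩, hleast⟩ := hK.exists_isLeast ⟨r₁, ⟨hr₁, le_rfl⟩, sub_nonneg.2 hr₁'⟩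
    have := P.sub_le_sub_zero hα hα2 Q h0 hr₀.1 fun s hs hsr => by
      by_contra! hs'
      exact absurd (hleast ⟨⟨hs, hsr.le.trans hr₀.2⟩, sub_nonneg.2 hs'.le⟩) (not_le.2 hsr)
    have h2 : 0 ≤ v r₀ - V r₀ := hr₀'
    linarith
  have hle : ∀ r, 0 ≤ r → v r - V r ≤ v 0 - V 0 := fun r hr =>
    P.sub_le_sub_zero hα hα2 Q h0 hr fun s hs _ => (hneg s hs).le
  have hlim := (P.tendsto_right hα hα2).sub (Q.tendsto_right hα hα2)
  have := le_of_tendsto hlim ((eventually_ge_atTop 0).mono hle)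
  linarith

/-- A contraction argument on [0, R] in the weighted norm with weight exp(-Λ r^σ). The weighted
maximum M of |g - G| + |v - V| satisfies M ≤ M/2, hence is zero. -/
lemma eq_of_eq_zero [NeZero N] (hα : (4 - (N : ℝ)) / 2 < α) (hα2 : α < 2)
    (P : IsRegularProfile N α g v)
    (Q : IsRegularProfile N α G V) (h0 : g 0 = G 0) (h0' : v 0 = V 0) {R : ℝ} (hR : 0 ≤ R) :
    g R = G R := by
  have hβ := exponent_pos hα hα2
  have hβN : (N : ℝ) - 2 + α < N := by linarith
  have hp := critExp_sub_two_pos hα hα2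
  have hsub : Set.Icc 0 R ⊆ Set.Ici 0 := fun x hx => hx.1
  have hcg := (P.continuousOn_left hα hα2).mono hsub
  have hcG := (Q.continuousOn_left hα hα2).mono hsub
  have hcv := (P.continuousOn_right hα hα2).mono hsub
  have hcV := (Q.continuousOn_right hα hα2).mono hsub
  obtain ⟨A, hA⟩ := isCompact_Icc.exists_bound_of_continuousOn hcg
  obtain ⟨B, hB⟩ := isCompact_Icc.exists_bound_of_continuousOn hcG
  set L := (critExp N α - 1) * (max A B) ^ (critExp N α - 2) with hL
  have hL0 : 0 ≤ L := by
    have h1 : 0 ≤ A := (norm_nonneg _).trans (hA 0 ⟨le_rfl, hR⟩)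
    have : 0 ≤ critExp N α - 1 := by linarith
    have : 0 ≤ max A B := le_max_of_le_left h1
    positivity
  set σ := (N : ℝ) - (N - 2 + α) with hσ
  have hσ0 : 0 < σ := by linarith
  -- The linear equation contributes the factor 1 and the nonlinear one its Lipschitz constant L; Λ
  -- makes their combined effect exactly 1/2.
  obtain ⟨Λ, hΛ, hΛL⟩ : ∃ Λ, 0 < Λ ∧ (L + 1) * ((N - 2 + α) * (σ * Λ))⁻¹ = 1 / 2 := by
    refine ⟨2 * (L + 1) / ((N - 2 + α) * σ), by positivity, ?_⟩
    field_simp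
  have hcφ : ContinuousOn (fun r => Real.exp (-(Λ * r ^ σ)) * (|g r - G r| + |v r - V r|))
      (Set.Icc 0 R) := by
    refine ContinuousOn.mul ?_ ((hcg.sub hcG).abs.add (hcv.sub hcV).abs)
    exact (Real.continuous_exp.comp (continuous_const.mul
      (Real.continuous_rpow_const hσ0.le)).neg).continuousOn
  obtain ⟨r, hr, hmax⟩ := isCompact_Icc.exists_isMaxOn ⟨0, le_rfl, hR⟩ hcφ
  set M := Real.exp (-(Λ * r ^ σ)) * (|g r - G r| + |v r - V r|) with hM
  have hM0 : 0 ≤ M := by positivity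
  have hbound : ∀ s, 0 ≤ s → s ≤ R → |g s - G s| + |v s - V s| ≤ M * Real.exp (Λ * s ^ σ) := by
    intro s hs hsR
    have := mul_le_mul_of_nonneg_right (hmax ⟨hs, hsR⟩) (Real.exp_nonneg (Λ * s ^ σ))
    change _ ≤ M * _ at this
    rwa [mul_right_comm, ← Real.exp_add, neg_add_cancel, Real.exp_zero, one_mul] at this
  have e1 := abs_greenOp_sub_le hβ hβN (P.integrable_sub_left Q) hΛ hr.1 (M := M)
    (fun y _ hy => by
      have := hbound ‖y‖ (norm_nonneg y) (hy.le.trans hr.2)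
      have h2 := abs_nonneg (g ‖y‖ - G ‖y‖)
      linarith) hM0
  have e2 := abs_greenOp_sub_le hβ hβN (P.integrable_sub_right Q) hΛ hr.1 (M := L * M)
    (fun y _ hy => by
      have hy' : ‖y‖ ∈ Set.Icc 0 R := ⟨norm_nonneg y, hy.le.trans hr.2⟩
      refine (abs_critFun_sub_le hα hα2 ((hA _ hy').trans (le_max_left A B))
        ((hB _ hy').trans (le_max_right A B))).trans ?_
      rw [mul_assoc L]
      refine mul_le_mul_of_nonneg_left ?_ hL0
      have := hbound ‖y‖ hy'.1 hy'.2
      have h2 := abs_nonneg (v ‖y‖ - V ‖y‖)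
      linarith) (mul_nonneg hL0 hM0)
  rw [greenOp_sub_left hα hα2 P Q hr.1, greenOp_sub_left hα hα2 P Q le_rfl, h0, sub_self,
    sub_zero] at e1
  rw [greenOp_sub_right hα hα2 P Q hr.1, greenOp_sub_right hα hα2 P Q le_rfl, h0', sub_self,
    sub_zero] at e2
  have hkey : M ≤ M / 2 := by
    have h3 : |g r - G r| + |v r - V r| ≤ M / 2 * Real.exp (Λ * r ^ σ) := by
      refine (add_le_add e1 e2).trans (le_of_eq ?_)
      rw [div_eq_mul_one_div M 2, ← hΛL]
      ring
    have := mul_le_mul_of_nonneg_left h3 (Real.exp_nonneg (-(Λ * r ^ σ)))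
    rwa [mul_left_comm, ← Real.exp_add, neg_add_cancel, Real.exp_zero, mul_one] at this
  have hM1 : M = 0 := by linarith
  have := hbound R hR le_rfl
  rw [hM1, zero_mul] at this
  have h1 := abs_nonneg (g R - G R)
  have h2 := abs_nonneg (v R - V R)
  exact sub_eq_zero.1 (abs_eq_zero.1 (by linarith))

/-- A regular profile is determined by the value of `g` at the origin. -/
lemma unique [NeZero N] (hα : (4 - (N : ℝ)) / 2 < α) (hα2 : α < 2) (P : IsRegularProfile N α g v)
    (Q : IsRegularProfile N α G V) (h0 : g 0 = G 0) {r : ℝ} (hr : 0 ≤ r) : g r = G r :=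
  P.eq_of_eq_zero hα hα2 Q h0 (le_antisymm (not_lt.1 (Q.not_lt_right_zero hα hα2 P h0.symm))
    (not_lt.1 (P.not_lt_right_zero hα hα2 Q h0))) hr

lemma zero : IsRegularProfile N α (fun _ => 0) fun _ => 0 where
  eq_left r := by simp [greenOp]
  eq_right r := by simp [greenOp, critFun_zero]
  int_left := by simp
  int_right := by simp [critFun_zero]

end IsRegularProfile

/-! ### From energy solutions to regular profiles. -/

section Representation

variable {N : ℕ} {α : ℝ} {u : Euc N → ℝ}

lemma greenOp_congr_ae {β : ℝ} {F G : Euc N → ℝ}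
    (h : F =ᵐ[volume] G) : greenOp β F = greenOp β G := by
  funext r
  unfold greenOp
  congr 1
  exact integral_congr_ae (h.mono fun y hy => by simp only [hy])

lemma eqOn_Ioi_of_ae_eq_comp_norm [NeZero N] {g h : ℝ → ℝ} (hg : ContinuousOn g (Set.Ioi 0))
    (hh : ContinuousOn h (Set.Ioi 0)) (hgh : ∀ᵐ x : Euc N, g ‖x‖ = h ‖x‖) :
    Set.EqOn g h (Set.Ioi 0) := by
  have h1 : Set.EqOn (fun x : Euc N => g ‖x‖) (fun x => h ‖x‖) {0}ᶜ := by
    refine Measure.eqOn_open_of_ae_eq (μ := volume) (ae_restrict_of_ae hgh)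
      isOpen_compl_singleton ?_ ?_
    · exact hg.comp continuous_norm.continuousOn fun x hx => norm_pos_iff.2 hx
    · exact hh.comp continuous_norm.continuousOn fun x hx => norm_pos_iff.2 hx
  intro r hr
  have hr' : (0 : ℝ) < r := hr
  have hn : ‖(EuclideanSpace.single 0 r : Euc N)‖ = r := by
    rw [PiLp.norm_single, Real.norm_of_nonneg hr'.le]
  have := h1 (x := EuclideanSpace.single 0 r) (by
    rw [Set.mem_compl_iff, Set.mem_singleton_iff, ← norm_eq_zero, hn]
    exact hr'.ne')
  simpa only [hn] using this

/-- Radial energy solutions have regular profiles. -/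
lemma exists_isRegularProfile [NeZero N] (hα : (4 - (N : ℝ)) / 2 < α) (hα2 : α < 2)
    (hu : IsEnergySolution α u) (hr : IsRadial u) :
    ∃ g v, IsRegularProfile N α g v ∧ u =ᵐ[volume] fun x => g ‖x‖ := by
  have hβ := IsRegularProfile.exponent_pos hα hα2
  have hN : (0 : ℝ) < N := Nat.cast_pos.2 (Nat.pos_of_neZero N)
  have hN2 : (N : ℝ) < 2 * (N - 2 + α) := by linarith
  obtain ⟨-, w, hw, heq⟩ := hu
  obtain ⟨g₀, -, hg₀⟩ := hr
  have hrep := energyLimit_eq_greenOp hα hα2 hw hg₀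
  obtain ⟨K, hK⟩ : ∃ K, ∀ r > 0, |greenOp (N - 2 + α) w r| ≤ K * r ^ ((N : ℝ) / 2 - (N - 2 + α)) :=
    ⟨_, fun r hr => abs_greenOp_le_of_memLp hβ.le hN2 hw.2.1 hr⟩
  have hcont : ContinuousOn (fun r => -greenOp (N - 2 + α) w r) (Set.Ioi 0) :=
    (continuousOn_greenOp_Ioi hβ.le fun r hr => integrable_mul_max_of_memLp hN2 hw.2.1 hr).neg
  have hub : ∀ᵐ y, |critPower α u y| ≤ (K ^ (critExp N α - 2) * K)
      * ‖y‖ ^ (-((N : ℝ) / 2 + (2 - α))) := by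
    filter_upwards [hrep, ae_ne_zero] with y hy hy0
    refine abs_critFun_le hα hα2 (norm_pos_iff.2 hy0) ?_
    rw [hy, abs_neg]
    exact hK _ (norm_pos_iff.2 hy0)
  have hm : AEStronglyMeasurable (critPower α u) :=
    (measurable_critFun.comp_aemeasurable hw.1.aestronglyMeasurable.aemeasurable).aestronglyMeasurable
  have hint1 := fun r (hr : (0 : ℝ) < r) => integrable_mul_max_of_rpow (β := (N : ℝ) - 2 + α)
    (by linarith) (by linarith) hm hub hr
  obtain ⟨v, hv⟩ : ∃ v, v = greenOp (N - 2 + α) (critPower α u) := ⟨_, rfl⟩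
  obtain ⟨g, hg⟩ : ∃ g, g = greenOp (N - 2 + α) (fun y : Euc N => v ‖y‖) := ⟨_, rfl⟩
  have hug : u =ᵐ[volume] fun x => g ‖x‖ := by
    rw [hg, hv]
    exact solution_eq_greenOp hα hα2 hw heq hg₀ hub
  have hvm : AEStronglyMeasurable (fun y : Euc N => v ‖y‖) :=
    aestronglyMeasurable_comp_norm (hv ▸ continuousOn_greenOp_Ioi hβ.le hint1)
  obtain ⟨K', hvb⟩ : ∃ K', ∀ᵐ y : Euc N, |v ‖y‖| ≤ K' * ‖y‖ ^ (-((N : ℝ) / 2)) := by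
    refine ⟨(K ^ (critExp N α - 2) * K) * (greenConst N (N - 2 + α)
      * powerConst N (N / 2 + (2 - α)) (N - 2 + α)), ?_⟩
    filter_upwards [ae_ne_zero] with y hy
    rw [hv]
    refine (abs_greenOp_le_of_rpow hβ.le (by linarith) (by linarith) hub
      (norm_pos_iff.2 hy)).trans (le_of_eq ?_)
    congr 2
    ring
  have hint2 := fun r (hr : (0 : ℝ) < r) => integrable_mul_max_of_rpow (β := (N : ℝ) - 2 + α)
    (by linarith) (by linarith) hvm hvb hr
  have hgc : ContinuousOn g (Set.Ioi 0) := hg ▸ continuousOn_greenOp_Ioi hβ.le hint2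
  -- The double potential g and the potential -S w agree at every positive radius by continuity, so
  -- g inherits the pointwise bound and the little-o estimate that come from w in L².
  have hpt : Set.EqOn g (fun r => -greenOp (N - 2 + α) w r) (Set.Ioi 0) :=
    eqOn_Ioi_of_ae_eq_comp_norm (N := N) hgc hcont (by
      filter_upwards [hug, hrep] with x h1 h2
      rw [← h1, h2])
  have hcp : critPower α u =ᵐ[volume] fun y => critFun N α (g ‖y‖) := by
    filter_upwards [hug] with y hy
    simp only [critPower, critFun, hy]
  refine ⟨g, v, isRegularProfile_of_isLittleO hα hα2 (fun r => by rw [hg]) (fun r => ?_)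
    (fun r hr => ?_) hint2 (C := K) (fun r hr => ?_) (fun ε hε => ?_), hug⟩
  · rw [hv, greenOp_congr_ae hcp]
  · exact (hint1 r hr).congr (hcp.mono fun y hy => by simp only [hy])
  · rw [hpt hr, abs_neg]
    exact hK r hr
  · obtain ⟨δ, hδ, h⟩ := greenOp_isLittleO hβ hN2 hw.2.1 hε
    refine ⟨δ, hδ, fun r hr hrδ => ?_⟩
    rw [hpt hr, abs_neg]
    exact h r hr hrδ

end Representation

/-! ### A criterion for membership in the energy space. -/

section RadialFlux

/-- The profile `h` vanishes at infinity, and the flux `r^{α-1} h'(r)` of `h` is a smooth function `Q`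
that decays like `r^{-(N-2+α)}` together with `N Q + r Q'`, the weighted Laplacian of `h(|x|)`. -/
structure HasRadialFlux (N : ℕ) (α : ℝ) (h Q : ℝ → ℝ) : Prop where
  smooth : ContDiffOn ℝ ∞ Q (Set.Ioi 0)
  bound : ∃ C, (∀ r > 0, |Q r| ≤ C * (1 + r) ^ (-((N : ℝ) - 2 + α))) ∧
    ∀ r > 0, |N * Q r + r * deriv Q r| ≤ C * (1 + r) ^ (-((N : ℝ) - 2 + α))
  deriv_eq : ∀ r > 0, HasDerivAt h (r ^ (1 - α) * Q r) r
  tendsto : Tendsto h atTop (𝓝 0)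

namespace HasRadialFlux

variable {N : ℕ} {α : ℝ} {h Q : ℝ → ℝ}

lemma continuousOn_lap (H : HasRadialFlux N α h Q) :
    ContinuousOn (fun r => N * Q r + r * deriv Q r) (Set.Ioi 0) := by
  have h1 := H.smooth.continuousOn
  have h2 := H.smooth.continuousOn_deriv_of_isOpen isOpen_Ioi (by simp)
  fun_prop

lemma memLp_lap [NeZero N] (hα : (4 - (N : ℝ)) / 2 < α) (H : HasRadialFlux N α h Q) :
    MemLp (fun x : Euc N => N * Q ‖x‖ + ‖x‖ * deriv Q ‖x‖) 2 := by
  obtain ⟨C, -, hC⟩ := H.bound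
  refine ((memLp_two_one_add_norm (N := N) (b := N - 2 + α) (by linarith)).const_mul C).mono'
    (aestronglyMeasurable_comp_norm H.continuousOn_lap) ?_
  filter_upwards [ae_ne_zero] with x hx using hC _ (norm_pos_iff.2 hx)

/-- Radial profiles with decaying flux belong to the energy space. -/
lemma isEnergyLimit [NeZero N] (hα : (4 - (N : ℝ)) / 2 < α) (hα2 : α < 2)
    (H : HasRadialFlux N α h Q) :
    IsEnergyLimit α (fun x : Euc N => h ‖x‖)
      fun x => N * Q ‖x‖ + ‖x‖ * deriv Q ‖x‖ := by
  obtain ⟨C, hC, hC'⟩ := H.bound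
  obtain ⟨B, hB⟩ := exists_truncProfile_bound hα hα2 hC
  have hB0 : 0 ≤ B := by simpa using (abs_nonneg _).trans (hB 0 0 le_rfl)
  have hB1 : ∀ n r, 0 ≤ r → |truncProfile α Q n r| ≤ B := fun n r hr =>
    (hB n r hr).trans (mul_le_of_le_one_right hB0
      (Real.rpow_le_one_of_one_le_of_nonpos (by linarith) (by linarith)))
  have hlim : ∀ x : Euc N, x ≠ 0 → Tendsto (fun n => truncProfile α Q n ‖x‖) atTop (𝓝 (h ‖x‖)) :=
    fun x hx => tendsto_truncProfile hα hα2 H.smooth hC H.deriv_eq H.tendsto (norm_pos_iff.2 hx)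
  have hhB : ∀ x : Euc N, x ≠ 0 → |h ‖x‖| ≤ B := fun x hx =>
    le_of_tendsto' (hlim x hx).abs fun n => hB1 n _ (norm_nonneg x)
  have hm : AEStronglyMeasurable (fun x : Euc N => h ‖x‖) :=
    aestronglyMeasurable_comp_norm fun r hr => (H.deriv_eq r hr).continuousAt.continuousWithinAt
  refine ⟨?_, H.memLp_lap hα, fun n x => truncProfile α Q n ‖x‖, fun n =>
    ⟨isTestFun_truncProfile H.smooth n,
      memLp_two_weightedLap hα (isTestFun_truncProfile H.smooth n)⟩,
    tendsto_weightedLap_truncProfile hα H.smooth hC hC', fun K hK => ?_⟩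
  · refine locallyIntegrable_of_rpow_bound hm (C := B) (s := 0)
      (by simpa using Nat.pos_of_neZero N) ?_
    filter_upwards [ae_ne_zero] with x hx
    simpa using hhB x hx
  · have : IsFiniteMeasure ((volume : Measure (Euc N)).restrict K) :=
      ⟨by simpa using hK.measure_lt_top⟩
    have hmn : ∀ n, AEStronglyMeasurable
        ((fun x : Euc N => truncProfile α Q n ‖x‖) - fun x => h ‖x‖) (volume.restrict K) := fun n =>
      ((isTestFun_truncProfile H.smooth n).1.continuous.aestronglyMeasurable.sub hm).restrict
    -- On a compact set, convergence in L² of the uniformly bounded profiles implies convergence in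
    -- L¹.
    have h2 : Tendsto (fun n => eLpNorm ((fun x : Euc N => truncProfile α Q n ‖x‖)
        - fun x => h ‖x‖) 2 (volume.restrict K)) atTop (𝓝 0) := by
      refine tendsto_eLpNorm_two_zero_of_dominated hmn (memLp_const (2 * B)) (fun n => ?_) ?_
      · filter_upwards [ae_restrict_of_ae ae_ne_zero] with x hx
        have h3 := hB1 n _ (norm_nonneg x)
        have h4 := hhB x hx
        simp only [Pi.sub_apply]
        linarith [abs_sub (truncProfile α Q n ‖x‖) (h ‖x‖)]
      · filter_upwards [ae_restrict_of_ae ae_ne_zero] with x hx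
        simpa using (hlim x hx).sub_const (h ‖x‖)
    have h5 := ENNReal.Tendsto.mul_const (b := (volume.restrict K) Set.univ
      ^ (1 / (1 : ENNReal).toReal - 1 / (2 : ENNReal).toReal)) h2 (Or.inr
        (ENNReal.rpow_ne_top_of_nonneg (by norm_num) (measure_ne_top _ _)))
    rw [zero_mul] at h5
    exact tendsto_of_tendsto_of_tendsto_of_le_of_le tendsto_const_nhds h5 (fun _ => bot_le)
      fun n => eLpNorm_le_eLpNorm_mul_rpow_measure_univ (by norm_num) (hmn n)

/-- Radial profiles with decaying flux have their pointwise weighted Laplacian as a weak one. -/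
lemma integral_mul_weightedLap [NeZero N] (hα : (4 - (N : ℝ)) / 2 < α) (hα2 : α < 2)
    (H : HasRadialFlux N α h Q) {ψ : Euc N → ℝ} (hψ : IsTestFun ψ) :
    ∫ x : Euc N, h ‖x‖ * weightedLap α ψ x
      = ∫ x : Euc N, (N * Q ‖x‖ + ‖x‖ * deriv Q ‖x‖) * ψ x := by
  obtain ⟨C, hC, hC'⟩ := H.bound
  obtain ⟨B, hB⟩ := exists_truncProfile_bound hα hα2 hC
  have hB0 : 0 ≤ B := by simpa using (abs_nonneg _).trans (hB 0 0 le_rfl)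
  have hB1 : ∀ n r, 0 ≤ r → |truncProfile α Q n r| ≤ B := fun n r hr =>
    (hB n r hr).trans (mul_le_of_le_one_right hB0
      (Real.rpow_le_one_of_one_le_of_nonpos (by linarith) (by linarith)))
  have hα' : 2 - (N : ℝ) < α := by
    have : (0 : ℝ) ≤ N := Nat.cast_nonneg N
    linarith
  have lim1 := tendsto_integral_mul_of_eLpNorm_two (hψ.1.continuous.memLp_of_hasCompactSupport hψ.2)
    (H.memLp_lap hα) (fun n => memLp_two_weightedLap hα (isTestFun_truncProfile H.smooth n))
    (tendsto_weightedLap_truncProfile hα H.smooth hC hC')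
  have lim2 : Tendsto (fun n => ∫ x : Euc N, truncProfile α Q n ‖x‖ * weightedLap α ψ x) atTop
      (𝓝 (∫ x : Euc N, h ‖x‖ * weightedLap α ψ x)) := by
    have hi := integrable_weightedLap hα' hψ
    refine tendsto_integral_of_dominated_convergence _ (fun n =>
      (isTestFun_truncProfile H.smooth n).1.continuous.aestronglyMeasurable.mul hi.1)
      (hi.norm.const_mul B) (fun n => .of_forall fun x => ?_) ?_
    · rw [norm_mul]
      exact mul_le_mul_of_nonneg_right (hB1 n _ (norm_nonneg x)) (norm_nonneg _)
    · filter_upwards [ae_ne_zero] with x hx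
      exact (tendsto_truncProfile hα hα2 H.smooth hC H.deriv_eq H.tendsto
        (norm_pos_iff.2 hx)).mul_const _
  have e : ∀ n, ∫ x, ψ x * weightedLap α (fun y : Euc N => truncProfile α Q n ‖y‖) x
      = ∫ x : Euc N, truncProfile α Q n ‖x‖ * weightedLap α ψ x := fun n => by
    refine weightedLap_symm_of_const hα' hψ (isTestFun_truncProfile H.smooth n).1
      (c := truncProfile α Q n 0) ?_ (B := B) fun x => hB1 n _ (norm_nonneg x)
    filter_upwards [Metric.ball_mem_nhds (0 : Euc N) (Real.exp_pos (-(2 * ((n : ℝ) + 1))))] with x hx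
    exact truncProfile_of_lt H.smooth (norm_nonneg x) (by simpa using hx)
  simp only [e] at lim1
  rw [tendsto_nhds_unique lim2 lim1]
  simp only [mul_comm]

end HasRadialFlux

end RadialFlux

/-! ### Calculus of the powers (1 + q r^σ)^(-c). -/

section BubbleProfile

/-- `(1 + q r^σ)^{-c}`. -/
noncomputable def bubblePow (q σ c r : ℝ) : ℝ := (1 + q * r ^ σ) ^ (-c)

variable {q σ : ℝ}

lemma one_le_bubbleBase (hq : 0 < q) {r : ℝ} (hr : 0 ≤ r) : 1 ≤ 1 + q * r ^ σ :=
  le_add_of_nonneg_right (by positivity)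

lemma bubblePow_pos (hq : 0 < q) (c : ℝ) {r : ℝ} (hr : 0 ≤ r) : 0 < bubblePow q σ c r :=
  Real.rpow_pos_of_pos (zero_lt_one.trans_le (one_le_bubbleBase hq hr)) _

lemma hasDerivAt_bubblePow (hq : 0 < q) (c : ℝ) {r : ℝ} (hr : 0 < r) :
    HasDerivAt (bubblePow q σ c) (r ^ (σ - 1) * (-(c * q * σ) * bubblePow q σ (c + 1) r)) r := by
  have h1 := (((Real.hasDerivAt_rpow_const (p := σ) (Or.inl hr.ne')).const_mul q).const_add
    1).rpow_const (p := -c)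
    (Or.inl (zero_lt_one.trans_le (one_le_bubbleBase (σ := σ) hq hr.le)).ne')
  refine h1.congr_deriv ?_
  rw [bubblePow, show -(c + 1) = -c - 1 by ring]
  ring

/-- This eliminates the explicit powers of r, so that weighted Laplacians of these functions stay in
their span. -/
lemma mul_rpow_mul_bubblePow (hq : 0 < q) (c : ℝ) {r : ℝ} (hr : 0 ≤ r) :
    q * r ^ σ * bubblePow q σ (c + 1) r = bubblePow q σ c r - bubblePow q σ (c + 1) r := by
  have h0 := zero_lt_one.trans_le (one_le_bubbleBase (σ := σ) hq hr)
  have : bubblePow q σ c r = bubblePow q σ (c + 1) r * (1 + q * r ^ σ) := by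
    rw [bubblePow, bubblePow, ← Real.rpow_add_one h0.ne']
    congr 1
    ring
  rw [this]
  ring

lemma bubblePow_anti (hq : 0 < q) {c c' : ℝ} (h : c ≤ c') {r : ℝ} (hr : 0 ≤ r) :
    bubblePow q σ c' r ≤ bubblePow q σ c r :=
  Real.rpow_le_rpow_of_exponent_le (one_le_bubbleBase hq hr) (by linarith)

lemma exists_bubblePow_le (hq : 0 < q) (hσ : 0 < σ) {c : ℝ} (hc : 0 ≤ c) :
    ∃ C, 0 ≤ C ∧ ∀ r, 0 ≤ r → bubblePow q σ c r ≤ C * (1 + r) ^ (-(c * σ)) := by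
  obtain ⟨K, hK, hK'⟩ : ∃ K : ℝ, 0 < K ∧ ∀ r, 0 ≤ r → (1 + r) ^ σ ≤ K * (1 + q * r ^ σ) := by
    refine ⟨2 ^ σ * (1 + q⁻¹), by positivity, fun r hr => ?_⟩
    have h1 : (1 + r) ^ σ ≤ 2 ^ σ * (1 + r ^ σ) := by
      rcases le_total r 1 with h | h
      · calc (1 + r) ^ σ ≤ 2 ^ σ := by gcongr; linarith
          _ ≤ _ := le_mul_of_one_le_right (by positivity) (le_add_of_nonneg_right (by positivity))
      · calc (1 + r) ^ σ ≤ (2 * r) ^ σ := by gcongr; linarith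
          _ = 2 ^ σ * r ^ σ := Real.mul_rpow zero_le_two hr
          _ ≤ _ := by gcongr; linarith
    refine h1.trans ?_
    rw [mul_assoc]
    refine mul_le_mul_of_nonneg_left ?_ (by positivity)
    have h2 : 0 ≤ r ^ σ := by positivity
    have h3 : (1 + q⁻¹) * (1 + q * r ^ σ) = 1 + r ^ σ + q⁻¹ + q * r ^ σ := by
      field_simp
      ring
    rw [h3]
    have : 0 ≤ q⁻¹ + q * r ^ σ := by positivity
    linarith
  refine ⟨K ^ c, by positivity, fun r hr => ?_⟩
  have h0 := zero_lt_one.trans_le (one_le_bubbleBase (σ := σ) hq hr)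
  have h1 : (0 : ℝ) < 1 + r := by linarith
  have h2 : ((1 + r) ^ σ) ^ c ≤ (K * (1 + q * r ^ σ)) ^ c := by
    have := hK' r hr
    gcongr
  rw [Real.mul_rpow hK.le h0.le, ← Real.rpow_mul h1.le] at h2
  rw [bubblePow, Real.rpow_neg h0.le, Real.rpow_neg h1.le, ← div_eq_mul_inv, mul_comm c,
    inv_le_comm₀ (by positivity) (by positivity), inv_div, div_le_iff₀ (by positivity)]
  linarith

lemma tendsto_bubblePow (hq : 0 < q) (hσ : 0 < σ) {c : ℝ} (hc : 0 < c) :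
    Tendsto (bubblePow q σ c) atTop (𝓝 0) :=
  (tendsto_rpow_neg_atTop hc).comp
    (tendsto_atTop_add_const_left _ _ ((tendsto_rpow_atTop hσ).const_mul_atTop hq))

lemma contDiffOn_bubblePow (hq : 0 < q) (c : ℝ) :
    ContDiffOn ℝ ∞ (bubblePow q σ c) (Set.Ioi 0) := by
  intro r hr
  have hr : 0 < r := hr
  refine ContDiffAt.contDiffWithinAt ?_
  refine ContDiffAt.rpow_const_of_ne ?_ (zero_lt_one.trans_le (one_le_bubbleBase hq hr.le)).ne'
  exact contDiffAt_const.add (contDiffAt_const.mul (Real.contDiffAt_rpow_const_of_ne hr.ne'))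

/-- Two terms with consecutive exponents are allowed because the weighted Laplacian of the bubble
has this shape and must be fed into the operator again. -/
lemma lap_bubblePow (hq : 0 < q) (M c a a' : ℝ) {r : ℝ} (hr : 0 < r) :
    M * (-(q * σ) * (a * c * bubblePow q σ (c + 1) r
        + a' * (c + 1) * bubblePow q σ (c + 2) r))
      + r * deriv (fun r => -(q * σ) * (a * c * bubblePow q σ (c + 1) r
        + a' * (c + 1) * bubblePow q σ (c + 2) r)) r
      = -(q * σ) * (a * c * ((M - (c + 1) * σ) * bubblePow q σ (c + 1) r
            + (c + 1) * σ * bubblePow q σ (c + 2) r)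
          + a' * (c + 1) * ((M - (c + 2) * σ) * bubblePow q σ (c + 2) r
            + (c + 2) * σ * bubblePow q σ (c + 3) r)) := by
  have d1 := hasDerivAt_bubblePow (σ := σ) hq (c + 1) hr
  have d2 := hasDerivAt_bubblePow (σ := σ) hq (c + 2) hr
  have d3 : HasDerivAt (fun r => -(q * σ) * (a * c * bubblePow q σ (c + 1) r
      + a' * (c + 1) * bubblePow q σ (c + 2) r)) _ r :=
    ((d1.const_mul (a * c)).add (d2.const_mul (a' * (c + 1)))).const_mul (-(q * σ))
  rw [d3.deriv, show c + 1 + 1 = c + 2 by ring, show c + 2 + 1 = c + 3 by ring]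
  have e1 := mul_rpow_mul_bubblePow (σ := σ) hq (c + 1) hr.le
  have e2 := mul_rpow_mul_bubblePow (σ := σ) hq (c + 2) hr.le
  rw [show c + 1 + 1 = c + 2 by ring] at e1
  rw [show c + 2 + 1 = c + 3 by ring] at e2
  have e3 : r * r ^ (σ - 1) = r ^ σ := by
    rw [mul_comm, ← Real.rpow_add_one hr.ne']
    congr 1
    ring
  linear_combination (q * σ * (a * c)) * ((c + 1) * σ) * e1
    + (q * σ * (a' * (c + 1))) * ((c + 2) * σ) * e2
    + (q * σ * (a * c * (c + 1) * q * σ * bubblePow q σ (c + 2) r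
      + a' * (c + 1) * (c + 2) * q * σ * bubblePow q σ (c + 3) r)) * e3

/-- The slowest term in the flux and in its divergence has exponent c + 1 and decays like
r^(-(c+1)(2-α)); `hcN` says that this is fast enough. -/
lemma hasRadialFlux_bubblePow {N : ℕ} {α : ℝ} (hα2 : α < 2) (hq : 0 < q) {c : ℝ}
    (hc : 0 < c) (hcN : (N : ℝ) - 2 + α ≤ (c + 1) * (2 - α)) (a a' : ℝ) :
    HasRadialFlux N α (fun r => a * bubblePow q (2 - α) c r + a' * bubblePow q (2 - α) (c + 1) r)
      fun r => -(q * (2 - α)) * (a * c * bubblePow q (2 - α) (c + 1) r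
        + a' * (c + 1) * bubblePow q (2 - α) (c + 2) r) := by
  have hσ : 0 < 2 - α := by linarith
  obtain ⟨C, hC0, hC⟩ := exists_bubblePow_le hq hσ (by linarith : 0 ≤ c + 1)
  have hE : ∀ (k c' r : ℝ), c + 1 ≤ c' → 0 < r →
      |k * bubblePow q (2 - α) c' r| ≤ |k| * C * (1 + r) ^ (-((N : ℝ) - 2 + α)) := by
    intro k c' r hcc hr
    rw [abs_mul, abs_of_pos (bubblePow_pos hq c' hr.le), mul_assoc]
    refine mul_le_mul_of_nonneg_left ((bubblePow_anti hq hcc hr.le).trans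
      ((hC r hr.le).trans (mul_le_mul_of_nonneg_left ?_ hC0))) (abs_nonneg k)
    exact Real.rpow_le_rpow_of_exponent_le (by linarith) (by linarith)
  have hsum : ∀ k₁ k₂ k₃ : ℝ, ∃ D, ∀ r > 0, |k₁ * bubblePow q (2 - α) (c + 1) r
      + k₂ * bubblePow q (2 - α) (c + 2) r + k₃ * bubblePow q (2 - α) (c + 3) r|
        ≤ D * (1 + r) ^ (-((N : ℝ) - 2 + α)) := by
    intro k₁ k₂ k₃
    refine ⟨|k₁| * C + |k₂| * C + |k₃| * C, fun r hr => ?_⟩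
    refine (abs_add_three _ _ _).trans ?_
    have h1 := hE k₁ (c + 1) r le_rfl hr
    have h2 := hE k₂ (c + 2) r (by linarith) hr
    have h3 := hE k₃ (c + 3) r (by linarith) hr
    linarith
  refine ⟨?_, ?_, fun r hr => ?_, ?_⟩
  · exact contDiffOn_const.mul ((contDiffOn_const.mul (contDiffOn_bubblePow hq _)).add
      (contDiffOn_const.mul (contDiffOn_bubblePow hq _)))
  · obtain ⟨D₁, h₁⟩ := hsum (-(q * (2 - α)) * (a * c)) (-(q * (2 - α)) * (a' * (c + 1))) 0
    obtain ⟨D₂, h₂⟩ := hsum (-(q * (2 - α)) * (a * c * (N - (c + 1) * (2 - α))))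
      (-(q * (2 - α)) * (a * c * ((c + 1) * (2 - α))
        + a' * (c + 1) * (N - (c + 2) * (2 - α))))
      (-(q * (2 - α)) * (a' * (c + 1) * ((c + 2) * (2 - α))))
    refine ⟨max D₁ D₂, fun r hr => ?_, fun r hr => ?_⟩
    · refine le_trans (le_of_eq ?_) ((h₁ r hr).trans (mul_le_mul_of_nonneg_right (le_max_left _ _)
        (by positivity)))
      congr 1
      ring
    · rw [lap_bubblePow hq _ _ _ _ hr]
      refine le_trans (le_of_eq ?_) ((h₂ r hr).trans (mul_le_mul_of_nonneg_right (le_max_right _ _)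
        (by positivity)))
      congr 1
      ring
  · have := ((hasDerivAt_bubblePow (σ := 2 - α) hq c hr).const_mul a).add
      ((hasDerivAt_bubblePow (σ := 2 - α) hq (c + 1) hr).const_mul a')
    refine this.congr_deriv ?_
    rw [show c + 1 + 1 = c + 2 by ring, show 2 - α - 1 = 1 - α by ring]
    ring
  · simpa using ((tendsto_bubblePow hq hσ hc).const_mul a).add
      ((tendsto_bubblePow hq hσ (by linarith : 0 < c + 1)).const_mul a')

end BubbleProfile

/-! ### Invariance of solutions under sign change and almost everywhere equality. -/

section SolutionSymmetries

variable {N : ℕ} {α : ℝ} {u u' w : Euc N → ℝ}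

lemma weightedLap_neg (α : ℝ) (φ : Euc N → ℝ) : weightedLap α (-φ) = -weightedLap α φ := by
  have h1 : (fun y => ‖y‖ ^ α • gradient (-φ) y) = -fun y => ‖y‖ ^ α • gradient φ y := by
    funext y
    have : gradient (-φ) y = -gradient φ y := by
      simp only [gradient]
      rw [fderiv_neg, map_neg]
    simp only [this, smul_neg, Pi.neg_apply]
  funext x
  simp only [weightedLap, euclDiv, h1, Pi.neg_apply]
  rw [fderiv_neg]
  simp

lemma isTestFun_neg {φ : Euc N → ℝ} (hφ : IsTestFun φ) : IsTestFun (-φ) :=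
  ⟨hφ.1.neg, hφ.2.neg⟩

lemma IsEnergyLimit.neg (hu : IsEnergyLimit α u w) : IsEnergyLimit α (-u) (-w) := by
  obtain ⟨h1, h2, φ, h3, h4, h5⟩ := hu
  refine ⟨h1.neg, h2.neg, fun n => -φ n, fun n => ⟨isTestFun_neg (h3 n).1, ?_⟩, ?_, fun K hK => ?_⟩
  · rw [weightedLap_neg]
    exact (h3 n).2.neg
  · refine h4.congr fun n => ?_
    rw [weightedLap_neg, ← eLpNorm_neg]
    congr 1
    ext x
    simp only [Pi.neg_apply, Pi.sub_apply]
    ring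
  · refine (h5 K hK).congr fun n => ?_
    rw [← eLpNorm_neg]
    congr 1
    ext x
    simp only [Pi.neg_apply, Pi.sub_apply]
    ring

lemma IsEnergyLimit.congr (hu : IsEnergyLimit α u w) (h : u =ᵐ[volume] u') :
    IsEnergyLimit α u' w := by
  obtain ⟨h1, h2, φ, h3, h4, h5⟩ := hu
  refine ⟨fun x => ?_, h2, φ, h3, h4, fun K hK => (h5 K hK).congr fun n => ?_⟩
  · obtain ⟨s, hs, h'⟩ := h1 x
    exact ⟨s, hs, h'.congr (ae_restrict_of_ae h)⟩
  · exact eLpNorm_congr_ae (EventuallyEq.rfl.sub (ae_restrict_of_ae h))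

lemma critPower_neg : critPower α (-u) = -critPower α u := by
  funext x
  simp [critPower]

lemma critPower_congr (h : u =ᵐ[volume] u') : critPower α u =ᵐ[volume] critPower α u' := by
  filter_upwards [h] with x hx
  simp only [critPower, hx]

lemma IsNontrivialRadialSolution.neg (hu : IsNontrivialRadialSolution α u) :
    IsNontrivialRadialSolution α (-u) := by
  obtain ⟨⟨w₀, h0⟩, ⟨h1, w, h2, h3⟩, ⟨g, hg, hug⟩, h4⟩ := hu
  refine ⟨⟨-w₀, h0.neg⟩, ⟨critPower_neg (u := u) ▸ h1.neg, -w, h2.neg, fun ψ hψ => ?_⟩,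
    ⟨-g, hg.neg, ?_⟩, fun h => h4 ?_⟩
  · rw [critPower_neg]
    simp only [Pi.neg_apply, neg_mul, integral_neg, h3 ψ hψ]
  · filter_upwards [hug] with x hx
    simp [hx]
  · filter_upwards [h] with x hx
    simpa using hx

lemma IsNontrivialRadialSolution.congr (hu : IsNontrivialRadialSolution α u)
    (h : u =ᵐ[volume] u') : IsNontrivialRadialSolution α u' := by
  obtain ⟨⟨w₀, h0⟩, ⟨h1, w, h2, h3⟩, ⟨g, hg, hug⟩, h4⟩ := hu
  refine ⟨⟨w₀, h0.congr h⟩, ⟨fun x => ?_, w, h2.congr h, fun ψ hψ => ?_⟩, ⟨g, hg, h.symm.trans hug⟩,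
    fun h' => h4 (h.trans h')⟩
  · obtain ⟨s, hs, h'⟩ := h1 x
    exact ⟨s, hs, h'.congr (ae_restrict_of_ae (critPower_congr h))⟩
  · rw [h3 ψ hψ]
    exact integral_congr_ae ((critPower_congr h).mul EventuallyEq.rfl)

end SolutionSymmetries

/-! ### The bubbles solve the equation. -/

section Bubble

variable {N : ℕ} {α t : ℝ}

/-- The value of the bubble at the origin. -/
noncomputable def bubbleHeight (N : ℕ) (α t : ℝ) : ℝ :=
  bubbleConst N α * t ^ (((N : ℝ) - 4 + 2 * α) / 2)

lemma bubble_eq (t : ℝ) (ht : 0 < t) (x : Euc N) : bubble N α t x = bubbleHeight N α t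
    * bubblePow (t ^ (2 - α)) (2 - α) (((N : ℝ) - 4 + 2 * α) / (2 - α)) ‖x‖ := by
  have := zero_lt_one.trans_le (one_le_bubbleBase (σ := 2 - α)
    (Real.rpow_pos_of_pos ht (2 - α)) (norm_nonneg x))
  rw [bubble, bubbleHeight, bubblePow, Real.rpow_neg this.le, div_eq_mul_inv]

lemma bubbleConst_pos [NeZero N] (hα : (4 - (N : ℝ)) / 2 < α)
    (hα2 : α < 2) : 0 < bubbleConst N α := by
  have hN : (0 : ℝ) < N := Nat.cast_pos.2 (Nat.pos_of_neZero N)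
  have h1 : 0 < (N : ℝ) - 4 + 2 * α := by linarith
  have h2 : 0 < (N : ℝ) - 2 + α := by linarith
  have h3 : 0 < (N : ℝ) + 2 - α := by linarith
  unfold bubbleConst
  positivity

lemma bubbleHeight_pos [NeZero N] (hα : (4 - (N : ℝ)) / 2 < α) (hα2 : α < 2) (ht : 0 < t) :
    0 < bubbleHeight N α t :=
  mul_pos (bubbleConst_pos hα hα2) (by positivity)

lemma critExp_sub_two_eq (hα : (4 - (N : ℝ)) / 2 < α) (hα2 : α < 2) :
    critExp N α - 2 = 4 / (((N : ℝ) - 4 + 2 * α) / (2 - α)) := by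
  have h1 : (N : ℝ) - 4 + 2 * α ≠ 0 := by
    have : 0 < (N : ℝ) - 4 + 2 * α := by linarith
    exact this.ne'
  have h2 : 2 - α ≠ 0 := by linarith
  rw [critExp]
  field_simp
  ring

/-- With b = (N - 4 + 2α)/(2 - α), the exponent in `bubbleConst` is b/4 while p - 2 = 4/b, so the
normalization returns the four-factor product itself. -/
lemma bubbleHeight_rpow [NeZero N] (hα : (4 - (N : ℝ)) / 2 < α) (hα2 : α < 2) (ht : 0 < t) :
    bubbleHeight N α t ^ (critExp N α - 2)
      = (((N : ℝ) - 4 + 2 * α) * (N - 2 + α) * N * (N + 2 - α)) * (t ^ (2 - α)) ^ 2 := by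
  have hN : (0 : ℝ) < N := Nat.cast_pos.2 (Nat.pos_of_neZero N)
  have h1 : 0 < (N : ℝ) - 4 + 2 * α := by linarith
  have h2 : 0 < (N : ℝ) - 2 + α := by linarith
  have h3 : 0 < (N : ℝ) + 2 - α := by linarith
  have h4 : 2 - α ≠ 0 := by linarith
  have h5 : 8 - 4 * α ≠ 0 := by linarith
  rw [bubbleHeight, Real.mul_rpow (bubbleConst_pos hα hα2).le (by positivity), bubbleConst,
    ← Real.rpow_mul (by positivity), ← Real.rpow_mul ht.le, critExp_sub_two_eq hα hα2,
    ← Real.rpow_natCast (t ^ (2 - α)), ← Real.rpow_mul ht.le]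
  congr 1
  · rw [show ((N : ℝ) - 4 + 2 * α) / (8 - 4 * α) * (4 / (((N : ℝ) - 4 + 2 * α) / (2 - α))) = 1 by
      rw [show 8 - 4 * α = 4 * (2 - α) by ring]
      field_simp, Real.rpow_one]
  · congr 1
    push_cast
    field_simp
    ring

/-- Since p - 2 = 4/b, the nonlinearity raises the exponent b to b + 4, the exponent that remains
after two weighted Laplacians. -/
lemma critFun_bubble [NeZero N] (hα : (4 - (N : ℝ)) / 2 < α) (hα2 : α < 2) (ht : 0 < t) {r : ℝ}
    (hr : 0 ≤ r) :
    critFun N α (bubbleHeight N α t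
      * bubblePow (t ^ (2 - α)) (2 - α) (((N : ℝ) - 4 + 2 * α) / (2 - α)) r)
      = (((N : ℝ) - 4 + 2 * α) * (N - 2 + α) * N * (N + 2 - α)) * (t ^ (2 - α)) ^ 2
        * bubbleHeight N α t
        * bubblePow (t ^ (2 - α)) (2 - α) (((N : ℝ) - 4 + 2 * α) / (2 - α) + 4) r := by
  have hA := bubbleHeight_pos hα hα2 ht
  have hq : 0 < t ^ (2 - α) := by positivity
  have h1 : 0 < (N : ℝ) - 4 + 2 * α := by linarith
  have h2 : 0 < 2 - α := by linarith
  have hE := bubblePow_pos (σ := 2 - α) hq (((N : ℝ) - 4 + 2 * α) / (2 - α)) hr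
  have hb := zero_lt_one.trans_le (one_le_bubbleBase (σ := 2 - α) hq hr)
  rw [critFun, abs_of_pos (mul_pos hA hE), Real.mul_rpow hA.le hE.le, bubbleHeight_rpow hα hα2 ht]
  have : bubblePow (t ^ (2 - α)) (2 - α) (((N : ℝ) - 4 + 2 * α) / (2 - α)) r ^ (critExp N α - 2)
      * bubblePow (t ^ (2 - α)) (2 - α) (((N : ℝ) - 4 + 2 * α) / (2 - α)) r
      = bubblePow (t ^ (2 - α)) (2 - α) (((N : ℝ) - 4 + 2 * α) / (2 - α) + 4) r := by
    rw [bubblePow, bubblePow, ← Real.rpow_mul hb.le, ← Real.rpow_add hb,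
      critExp_sub_two_eq hα hα2]
    congr 1
    field_simp
    ring
  rw [← this]
  ring

/-- The bubbles are nontrivial radial solutions. -/
lemma isNontrivialRadialSolution_bubble [NeZero N] (hα : (4 - (N : ℝ)) / 2 < α) (hα2 : α < 2)
    (ht : 0 < t) :
    IsNontrivialRadialSolution α (bubble N α t) := by
  have hq : 0 < t ^ (2 - α) := by positivity
  have hA := bubbleHeight_pos hα hα2 ht
  obtain ⟨σ, hσ⟩ : ∃ σ, σ = 2 - α := ⟨_, rfl⟩
  obtain ⟨b, hb⟩ : ∃ b, b = ((N : ℝ) - 4 + 2 * α) / σ := ⟨_, rfl⟩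
  obtain ⟨q, hqd⟩ : ∃ q, q = t ^ (2 - α) := ⟨_, rfl⟩
  obtain ⟨A, hAd⟩ : ∃ A, A = bubbleHeight N α t := ⟨_, rfl⟩
  have hσ0 : 0 < σ := by linarith
  have hbσ : b * σ = (N : ℝ) - 4 + 2 * α := by
    rw [hb]
    field_simp
  have hb0 : 0 < b := by
    rw [hb]
    exact div_pos (by linarith) hσ0
  -- In these terms the four factors N - 4 + 2α, N - 2 + α, N and N + 2 - α are bσ, (b + 1)σ, (b +
  -- 2)σ and (b + 3)σ.
  have hN : (N : ℝ) = (b + 2) * σ := by linarith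
  have hf := fun r (hr : (0 : ℝ) ≤ r) => critFun_bubble hα hα2 ht hr
  have hbub : bubble N α t = fun x => A * bubblePow q σ b ‖x‖ := by
    funext x
    rw [bubble_eq t ht, hAd, hqd, hb, hσ]
  rw [← hqd] at hq
  rw [← hAd] at hA
  rw [← hAd, ← hqd, ← hσ, ← hb] at hf
  have hcont : ∀ c, Continuous fun x : Euc N => bubblePow q σ c ‖x‖ := fun c =>
    (continuous_const.add (continuous_const.mul ((Real.continuous_rpow_const hσ0.le).comp
      continuous_norm))).rpow_const fun x =>
        Or.inl (zero_lt_one.trans_le (one_le_bubbleBase hq (norm_nonneg x))).ne'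
  have hmeas : Measurable fun r => A * bubblePow q σ b r := by
    unfold bubblePow
    fun_prop
  have H1 := hasRadialFlux_bubblePow (N := N) hα2 hq hb0 (by rw [← hσ]; linarith) A 0
  -- These coefficients are those of the weighted Laplacian of the bubble: N - (b + 1)σ = σ, so it
  -- is -q σ² A b times the power of exponent b + 1 plus (b + 1) times that of exponent b + 2.
  have H2 := hasRadialFlux_bubblePow (N := N) hα2 hq (by linarith : 0 < b + 1)
    (by rw [← hσ]; linarith) (-(q * σ ^ 2 * A * b)) (-(q * σ ^ 2 * A * b) * (b + 1))
  rw [← hσ] at H1 H2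
  have hE := H1.isEnergyLimit hα hα2
  have hcrit : critPower α (bubble N α t) = fun x : Euc N =>
      (((N : ℝ) - 4 + 2 * α) * (N - 2 + α) * N * (N + 2 - α)) * q ^ 2 * A
        * bubblePow q σ (b + 4) ‖x‖ := by
    funext x
    rw [hbub]
    exact hf _ (norm_nonneg x)
  have hlim : IsEnergyLimit α (bubble N α t) _ := hE.congr (by
    rw [hbub]
    exact .of_forall fun x => by simp)
  refine ⟨⟨_, hlim⟩, ⟨?_, _, hlim, fun ψ hψ => ?_⟩, ⟨_, hmeas, by rw [hbub]⟩, fun h => ?_⟩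
  · rw [hcrit]
    exact (continuous_const.mul (hcont _)).locallyIntegrable
  · have e := H2.integral_mul_weightedLap hα hα2 hψ
    rw [hcrit]
    refine Eq.trans ?_ (e.trans ?_)
    · refine integral_congr_ae ?_
      filter_upwards [ae_ne_zero] with x hx
      rw [lap_bubblePow hq _ _ _ _ (norm_pos_iff.2 hx), hN, show b + 1 + 1 = b + 2 by ring]
      ring
    · refine integral_congr_ae ?_
      filter_upwards [ae_ne_zero] with x hx
      -- The term of exponent b + 2 vanishes since N = (b + 2)σ, those of exponent b + 3 cancel, and
      -- q² σ⁴ A b(b + 1)(b + 2)(b + 3) is left in front of exponent b + 4.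
      rw [lap_bubblePow hq _ _ _ _ (norm_pos_iff.2 hx), show b + 1 + 3 = b + 4 by ring,
        show b + 1 + 2 = b + 3 by ring, show b + 1 + 1 = b + 2 by ring, ← hbσ,
        show (N : ℝ) - 2 + α = (b + 1) * σ by linarith,
        show (N : ℝ) + 2 - α = (b + 3) * σ by linarith, hN]
      ring
  · obtain ⟨x, hx⟩ := h.exists
    rw [hbub] at hx
    exact (mul_pos hA (bubblePow_pos hq b (norm_nonneg x))).ne' hx

end Bubble

/-! ### Classification of radial solutions. -/

section Classification

variable {N : ℕ} {α t : ℝ} {u u' : Euc N → ℝ}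

lemma IsRegularProfile.neg {g v : ℝ → ℝ} (P : IsRegularProfile N α g v) :
    IsRegularProfile N α (fun r => -g r) fun r => -v r where
  eq_left r := by
    rw [P.eq_left r]
    simp only [greenOp, neg_mul, integral_neg, mul_neg]
  eq_right r := by
    rw [P.eq_right r]
    simp only [greenOp, critFun_neg, neg_mul, integral_neg, mul_neg]
  int_left := by
    simp only [neg_mul]
    exact P.int_left.neg
  int_right := by
    simp only [critFun_neg, neg_mul]
    exact P.int_right.neg

lemma eqOn_Ici_of_ae_eq_comp_norm [NeZero N] {g h : ℝ → ℝ} (hg : ContinuousOn g (Set.Ici 0))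
    (hh : ContinuousOn h (Set.Ici 0)) (hgh : ∀ᵐ x : Euc N, g ‖x‖ = h ‖x‖) :
    Set.EqOn g h (Set.Ici 0) := by
  have h1 := eqOn_Ioi_of_ae_eq_comp_norm (hg.mono Set.Ioi_subset_Ici_self)
    (hh.mono Set.Ioi_subset_Ici_self) hgh
  exact h1.of_subset_closure hg hh Set.Ioi_subset_Ici_self (by rw [closure_Ioi])

lemma continuousOn_bubblePow {q σ c : ℝ} (hq : 0 < q) (hσ : 0 < σ) :
    ContinuousOn (bubblePow q σ c) (Set.Ici 0) := by
  refine ContinuousOn.rpow_const ?_ fun r hr =>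
    Or.inl (zero_lt_one.trans_le (one_le_bubbleBase hq hr)).ne'
  exact (continuous_const.add (continuous_const.mul
    (Real.continuous_rpow_const hσ.le))).continuousOn

/-- A profile that is positive at the origin is the profile of a bubble. -/
lemma exists_eq_bubble_of_pos [NeZero N] (hα : (4 - (N : ℝ)) / 2 < α) (hα2 : α < 2) {g v : ℝ → ℝ}
    (P : IsRegularProfile N α g v) (hg : 0 < g 0) :
    ∃ t : ℝ, 0 < t ∧ ∀ x : Euc N, g ‖x‖ = bubble N α t x := by
  have hC := bubbleConst_pos hα hα2
  have hγ : 0 < ((N : ℝ) - 4 + 2 * α) / 2 := by linarith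
  have hσ : 0 < 2 - α := by linarith
  -- The height is a constant times a positive power of t, so it takes the prescribed value g(0).
  obtain ⟨t, ht, hgt⟩ : ∃ t, 0 < t ∧ bubbleHeight N α t = g 0 := by
    refine ⟨(g 0 / bubbleConst N α) ^ (((N : ℝ) - 4 + 2 * α) / 2)⁻¹, by positivity, ?_⟩
    rw [bubbleHeight, ← Real.rpow_mul (by positivity), inv_mul_cancel₀ hγ.ne', Real.rpow_one,
      mul_div_cancel₀ _ hC.ne']
  have hq : 0 < t ^ (2 - α) := by positivity
  obtain ⟨-, hsol, hrad, -⟩ := isNontrivialRadialSolution_bubble (N := N) hα hα2 ht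
  obtain ⟨G, V, Q, hG⟩ := exists_isRegularProfile hα hα2 hsol hrad
  have heq : Set.EqOn G (fun r => bubbleHeight N α t
      * bubblePow (t ^ (2 - α)) (2 - α) (((N : ℝ) - 4 + 2 * α) / (2 - α)) r) (Set.Ici 0) :=
    eqOn_Ici_of_ae_eq_comp_norm (N := N) (Q.continuousOn_left hα hα2)
      (continuousOn_const.mul (continuousOn_bubblePow hq hσ)) (by
        filter_upwards [hG] with x hx
        rw [← hx, bubble_eq t ht])
  have h0 : g 0 = G 0 := by
    rw [heq Set.self_mem_Ici, ← hgt]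
    simp [bubblePow, Real.zero_rpow hσ.ne']
  refine ⟨t, ht, fun x => ?_⟩
  rw [P.unique hα hα2 Q h0 (norm_nonneg x), bubble_eq t ht]
  exact heq (norm_nonneg x)

lemma isNontrivialRadialSolution_iff [NeZero N] (hα : (4 - (N : ℝ)) / 2 < α) (hα2 : α < 2) :
    IsNontrivialRadialSolution α u ↔
      ∃ t : ℝ, 0 < t ∧ (u =ᵐ[volume] bubble N α t ∨ u =ᵐ[volume] -bubble N α t) := by
  constructor
  · rintro ⟨-, hsol, hrad, hne⟩
    obtain ⟨g, v, P, hg⟩ := exists_isRegularProfile hα hα2 hsol hrad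
    -- If g(0) = 0, uniqueness against the zero profile forces u to vanish.
    have h0 : g 0 ≠ 0 := fun h0 => hne (by
      filter_upwards [hg] with x hx
      rw [hx, P.unique hα hα2 .zero h0 (norm_nonneg x), Pi.zero_apply])
    rcases h0.lt_or_gt with h | h
    · obtain ⟨t, ht, hb⟩ := exists_eq_bubble_of_pos hα hα2 P.neg (neg_pos.2 h)
      refine ⟨t, ht, Or.inr ?_⟩
      filter_upwards [hg] with x hx
      rw [hx, Pi.neg_apply, ← hb, neg_neg]
    · obtain ⟨t, ht, hb⟩ := exists_eq_bubble_of_pos hα hα2 P h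
      refine ⟨t, ht, Or.inl ?_⟩
      filter_upwards [hg] with x hx
      rw [hx, hb]
  · rintro ⟨t, ht, h | h⟩
    · exact (isNontrivialRadialSolution_bubble hα hα2 ht).congr h.symm
    · exact (isNontrivialRadialSolution_bubble hα hα2 ht).neg.congr h.symm

lemma energyScale_congr (ht : t ≠ 0) (h : u =ᵐ[volume] u') :
    energyScale α t u =ᵐ[volume] energyScale α t u' := by
  filter_upwards [(Measure.quasiMeasurePreserving_smul (volume : Measure (Euc N)) ht).ae h] with x hx
  simp only [energyScale, hx]

lemma energyScale_neg : energyScale α t (-u) = -energyScale α t u := by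
  funext x
  simp [energyScale]

lemma energyScale_bubble {s t : ℝ} (hs : 0 < s) (ht : 0 < t) :
    energyScale α (t / s) (bubble N α s) = bubble N α t := by
  funext x
  simp only [energyScale, bubble]
  have h1 : 0 < t / s := div_pos ht hs
  rw [norm_smul, Real.norm_of_nonneg h1.le, Real.mul_rpow h1.le (norm_nonneg x), ← mul_assoc,
    ← Real.mul_rpow hs.le h1.le, mul_div_cancel₀ t hs.ne', mul_div_assoc', mul_left_comm,
    ← Real.mul_rpow h1.le hs.le, div_mul_cancel₀ t hs.ne']

end Classification

theorem theorem1p1 (N : ℕ) (hN : 2 ≤ N) (α : ℝ) (hα : (4 - (N : ℝ)) / 2 < α) (hα2 : α < 2) :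
    -- there is a nontrivial radial solution
    (∃ u : EuclideanSpace ℝ (Fin N) → ℝ, IsNontrivialRadialSolution α u) ∧
    -- it is unique up to scaling and change of sign
    (∀ u v : EuclideanSpace ℝ (Fin N) → ℝ,
      IsNontrivialRadialSolution α u → IsNontrivialRadialSolution α v →
        ∃ t : ℝ, 0 < t ∧
          (v =ᵐ[volume] energyScale α t u ∨ v =ᵐ[volume] -energyScale α t u)) ∧
    -- the solutions are exactly the functions `± U_{t,α}`, `t > 0`
    (∀ u : EuclideanSpace ℝ (Fin N) → ℝ, IsNontrivialRadialSolution α u ↔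
      ∃ t : ℝ, 0 < t ∧ (u =ᵐ[volume] bubble N α t ∨ u =ᵐ[volume] -bubble N α t)) := by
  have : NeZero N := ⟨by omega⟩
  refine ⟨⟨_, isNontrivialRadialSolution_bubble hα hα2 one_pos⟩, fun u v hu hv => ?_,
    fun u => isNontrivialRadialSolution_iff hα hα2⟩
  obtain ⟨s, hs, hu⟩ := (isNontrivialRadialSolution_iff hα hα2).1 hu
  obtain ⟨t, ht, hv⟩ := (isNontrivialRadialSolution_iff hα hα2).1 hv
  have h0 : 0 < t / s := div_pos ht hs
  have key : energyScale α (t / s) u =ᵐ[volume] bubble N α t ∨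
      energyScale α (t / s) u =ᵐ[volume] -bubble N α t := by
    rw [← energyScale_bubble hs ht, ← energyScale_neg]
    exact hu.imp (energyScale_congr h0.ne') (energyScale_congr h0.ne')
  refine ⟨t / s, h0, ?_⟩
  rcases key with h | h <;> rcases hv with h' | h'
  · exact Or.inl (h'.trans h.symm)
  · exact Or.inr (h'.trans h.neg.symm)
  · exact Or.inr (h'.trans (by simpa using h.neg.symm))
  · exact Or.inl (h'.trans h.symm)
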